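/- For nonempty open intervals $I,J\subseteq\mathbb R$, let $\mathfrak g=\mathfrak g(I,J)$ be the Lie algebra of vector fields in the variables $(t,x,y,u,v)$, $t\in I$, $y\in J$, $x,u,v\in\mathbb R$, spanned by $$D(f)=f\partial_t+\tfrac12f_tx\partial_x-\left(\tfrac12f_tu+\tfrac14f_{tt}x\right)\partial_u,\quad S(\alpha)=\alpha\partial_y-\alpha_yv\partial_v,\quad P(g)=g\partial_x-\tfrac12g_t\partial_u,\quad Z(\beta)=\beta\partial_v,$$ where $f=f(t)$, $g=g(t)$ run through the smooth functions on $I$ and $\alpha=\alpha(y)$, $\beta=\beta(y)$ through the smooth functions on $J$ (the maximal Lie invariance algebra of the Boiti--Leon--Pempinelli system). Let $G$ be the pseudogroup of the transformations (the complete point-symmetry pseudogroup of this system) $$\tilde t=T(t),\quad \tilde x=\varepsilon T_t^{1/2}x+X^0(t),\quad \tilde y=Y(y),\quad \tilde u=\frac{\varepsilon}{T_t^{1/2}}u-\frac{\varepsilon T_{tt}}{4T_t^{3/2}}x-\frac{X^0_t}{2T_t},\quad \tilde v=\frac1{Y_y}v+V^0(y),$$ where $T,X^0$ (resp. $Y,V^0$)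 are smooth functions on an open interval of $t$ (resp. $y$), $T_t>0$, $Y_y\ne0$ everywhere, and $\varepsilon=\pm1$. Subalgebras $\mathfrak s\subset\mathfrak g(I,J)$ and $\mathfrak s'\subset\mathfrak g(I',J')$ are $G$-equivalent if $\Phi_*\mathfrak s=\mathfrak s'$ for some $\Phi\in G$ defined for $t\in I$, $y\in J$ with $T(I)=I'$, $Y(J)=J'$. As usual in this local setting, the subalgebras considered are those that restrict faithfully: no nonzero element vanishes identically over nonempty open subintervals $I_0\subseteq I$, $J_0\subseteq J$ (automatic for real-analytic parameter functions). Consider, for $\delta,\delta'\in\{0,1\}$, the non-Abelian algebras $$\begin{gathered} \mathfrak s_{2.1}=\langle D(1)+S(1),D(t)+S(y)\rangle,\quad \mathfrak s_{2.2}^\delta=\langle D(1)+Z(\delta),D(t)-S(y)\rangle,\quad \mathfrak s_{2.3}^\delta=\langle D(1),D(t)+Z(\delta)\rangle,\\ \mathfrak s_{2.4}^\delta=\langle S(1)-P(\delta),D(2t)+S(y)\rangle,\quad \mathfrak s_{2.5}^\delta=\langle S(1),S(y)+P(\delta)\rangle,\\ \mathfrak s_{2.6}^{\delta\delta'}=\langle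 P(\delta)+Z(\delta'),D(2t)-S(y)\rangle_{(\delta,\delta')\neq(0,0)},\\ \mathfrak s_{2.7}^\delta=\langle P(1),D(2t)+Z(\delta)\rangle,\quad \mathfrak s_{2.8}^\delta=\langle Z(1),-S(y)+P(\delta)\rangle \end{gathered}$$ and the Abelian algebras $$\begin{gathered} \mathfrak s_{2.9}^{\delta\delta'}=\langle D(1)+Z(\delta),S(1)-P(\delta')\rangle,\quad \mathfrak s_{2.10}^{\delta\delta'}=\langle D(1)+S(1),P(\delta)+Z(\delta')\rangle_{(\delta,\delta')\neq(0,0)},\\ \mathfrak s_{2.11}^{\delta\beta}=\langle D(1)+Z(\beta),P(\delta)+Z(1)\rangle,\quad \mathfrak s_{2.12}^\delta=\langle D(1)+Z(\delta),P(1)\rangle,\\ \mathfrak s_{2.13}^{g\delta}=\langle S(1)+P(g),P(1)+Z(\delta)\rangle,\quad \mathfrak s_{2.14}^\delta=\langle S(1)-P(\delta),Z(1)\rangle,\quad \mathfrak s_{2.15}=\langle P(1),Z(1)\rangle,\\ \mathfrak s_{2.16}^{g\delta}=\langle P(1)+Z(\delta),P(g)\rangle_{g\ne\mathrm{const}},\quad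 \mathfrak s_{2.17}^{\delta\beta}=\langle P(\delta)+Z(1),Z(\beta)\rangle_{\beta\ne\mathrm{const}},\\ \mathfrak s_{2.18}^{g\beta}=\langle P(1)+Z(1),P(g)+Z(\beta)\rangle_{g,\beta\ne\mathrm{const}}, \end{gathered}$$ where $g=g(t)$ and $\beta=\beta(y)$ are arbitrary smooth functions subject to the indicated constraints, and "$\ne\mathrm{const}$" means constant on no nonempty open subinterval. Then: 1. Over any nonempty open intervals, each listed algebra is a two-dimensional subalgebra of $\mathfrak g$ that restricts faithfully, and it is non-Abelian or Abelian as indicated. 2. The list is complete: for every two-dimensional subalgebra $\mathfrak s$ of $\mathfrak g(I,J)$ that restricts faithfully, there are nonempty open subintervals $I_0\subseteq I$, $J_0\subseteq J$ such that the restriction of $\mathfrak s$ to $t\in I_0$, $y\in J_0$ is $G$-equivalent to a listed algebra over some nonempty open intervals. 3. Listed algebras from different families, or from the same family with different values of $(\delta,\delta')$, are not $G$-equivalent over any nonempty open intervals. -/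

import Mathlib

open Set
open scoped ContDiff

noncomputable section

namespace BLP

/-- The space with coordinates `(t, x, y, u, v) = (p 0, p 1, p 2, p 3, p 4)`. -/
abbrev Pt := Fin 5 → ℝ

/-- Nonempty open intervals of the real line, possibly unbounded. -/
def IsOpenInterval (I : Set ℝ) : Prop := IsOpen I ∧ I.OrdConnected ∧ I.Nonempty

/-- The domain `t ∈ I`, `y ∈ J`, with `x`, `u`, `v` arbitrary. -/
def strip (I J : Set ℝ) : Set Pt := {p | p 0 ∈ I ∧ p 2 ∈ J}

/-- Restriction of vector fields to `Ω`. A vector field on an open set `Ω` is represented by the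
function `Pt → Pt` that equals it on `Ω` and is zero outside `Ω`. -/
def restrictTo (Ω : Set Pt) : (Pt → Pt) →ₗ[ℝ] (Pt → Pt) where
  toFun V := Ω.indicator V
  map_add' V W := Set.indicator_add Ω V W
  map_smul' c V := Set.indicator_const_smul Ω c V

/-- `D(f) = f ∂_t + (1/2) f_t x ∂_x - ((1/2) f_t u + (1/4) f_tt x) ∂_u`. -/
def D (I J : Set ℝ) (f : ℝ → ℝ) : Pt → Pt :=
  restrictTo (strip I J) fun p =>
    ![f (p 0), 1 / 2 * deriv f (p 0) * p 1, 0,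
      -(1 / 2 * deriv f (p 0) * p 3 + 1 / 4 * deriv (deriv f) (p 0) * p 1), 0]

/-- `S(α) = α ∂_y - α_y v ∂_v`. -/
def S (I J : Set ℝ) (α : ℝ → ℝ) : Pt → Pt :=
  restrictTo (strip I J) fun p => ![0, 0, α (p 2), 0, -(deriv α (p 2) * p 4)]

/-- `P(g) = g ∂_x - (1/2) g_t ∂_u`. -/
def P (I J : Set ℝ) (g : ℝ → ℝ) : Pt → Pt :=
  restrictTo (strip I J) fun p => ![0, g (p 0), 0, -(1 / 2 * deriv g (p 0)), 0]

/-- `Z(β) = β ∂_v`. -/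
def Z (I J : Set ℝ) (β : ℝ → ℝ) : Pt → Pt :=
  restrictTo (strip I J) fun p => ![0, 0, 0, 0, β (p 2)]

/-- The algebra `𝔤` over the domain `t ∈ I`, `y ∈ J`: the span of all `D(f)`, `S(α)`, `P(g)`, `Z(β)`
with `f`, `g` smooth on `I` and `α`, `β` smooth on `J`. -/
def symAlgebra (I J : Set ℝ) : Submodule ℝ (Pt → Pt) :=
  Submodule.span ℝ
    ({V | ∃ f, ContDiffOn ℝ ∞ f I ∧ V = D I J f} ∪ {V | ∃ α, ContDiffOn ℝ ∞ α J ∧ V = S I J α} ∪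
      {V | ∃ g, ContDiffOn ℝ ∞ g I ∧ V = P I J g} ∪ {V | ∃ β, ContDiffOn ℝ ∞ β J ∧ V = Z I J β})

/-- Two-dimensional Lie subalgebras of `𝔤` (with the Lie bracket of vector fields). -/
def IsTwoDimSubalgebra (I J : Set ℝ) (s : Submodule ℝ (Pt → Pt)) : Prop :=
  s ≤ symAlgebra I J ∧ Module.finrank ℝ s = 2 ∧
    ∀ V ∈ s, ∀ W ∈ s, VectorField.lieBracket ℝ V W ∈ s

def IsAbelian (s : Submodule ℝ (Pt → Pt)) : Prop :=
  ∀ V ∈ s, ∀ W ∈ s, VectorField.lieBracket ℝ V W = 0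

/-- No nonzero element of `s` vanishes identically over a smaller domain `t ∈ I'`, `y ∈ J'`;
that is, `s` keeps its dimension when it is restricted to smaller intervals. -/
def RestrictsFaithfully (I J : Set ℝ) (s : Submodule ℝ (Pt → Pt)) : Prop :=
  ∀ I' ⊆ I, ∀ J' ⊆ J, IsOpenInterval I' → IsOpenInterval J' →
    ∀ V ∈ s, V ≠ 0 → ∃ p ∈ strip I' J', V p ≠ 0

/-- The point transformation
`t ↦ T`, `x ↦ ε T_t^{1/2} x + X⁰`, `y ↦ Y`,
`u ↦ ε T_t^{-1/2} u - (ε/4) T_tt T_t^{-3/2} x - X⁰_t / (2 T_t)`, `v ↦ v / Y_y + V⁰`. -/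
def pointTransformation (ε : ℝ) (T X₀ Y V₀ : ℝ → ℝ) : Pt → Pt := fun p =>
  ![T (p 0),
    ε * √(deriv T (p 0)) * p 1 + X₀ (p 0),
    Y (p 2),
    ε / √(deriv T (p 0)) * p 3 - ε * deriv (deriv T) (p 0) / (4 * √(deriv T (p 0)) ^ 3) * p 1
      - deriv X₀ (p 0) / (2 * deriv T (p 0)),
    1 / deriv Y (p 2) * p 4 + V₀ (p 2)]

/-- `Φ` belongs to the pseudogroup `G` and is defined for `t ∈ I`, `y ∈ J`, with image
`t ∈ I'`, `y ∈ J'`. -/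
def InPseudogroup (I J I' J' : Set ℝ) (Φ : Pt → Pt) : Prop :=
  ∃ (ε : ℝ) (T X₀ Y V₀ : ℝ → ℝ), (ε = 1 ∨ ε = -1) ∧
    ContDiffOn ℝ ∞ T I ∧ ContDiffOn ℝ ∞ X₀ I ∧ ContDiffOn ℝ ∞ Y J ∧ ContDiffOn ℝ ∞ V₀ J ∧
    (∀ t ∈ I, 0 < deriv T t) ∧ (∀ y ∈ J, deriv Y y ≠ 0) ∧ T '' I = I' ∧ Y '' J = J' ∧
    Φ = pointTransformation ε T X₀ Y V₀

/-- `W` is the pushforward by `Φ` of the vector field `V` on `Ω`, that is, `W ∘ Φ = dΦ (V)`. -/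
def IsPushforward (Φ : Pt → Pt) (Ω : Set Pt) (V W : Pt → Pt) : Prop :=
  ∀ p ∈ Ω, W (Φ p) = fderiv ℝ Φ p (V p)

/-- `G`-equivalence of a space `s` of vector fields over `t ∈ I`, `y ∈ J` and a space `s'` of vector
fields over `t ∈ I'`, `y ∈ J'`: `Φ_* s = s'` for some `Φ ∈ G`. -/
def GEquivalent (I J : Set ℝ) (s : Submodule ℝ (Pt → Pt))
    (I' J' : Set ℝ) (s' : Submodule ℝ (Pt → Pt)) : Prop :=
  ∃ Φ, InPseudogroup I J I' J' Φ ∧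
    (∀ V ∈ s, ∃ W ∈ s', IsPushforward Φ (strip I J) V W) ∧
    (∀ W ∈ s', ∃ V ∈ s, IsPushforward Φ (strip I J) V W)

/-- The eighteen families, each with the values of its parameters `δ, δ' ∈ {0, 1}`. -/
inductive Label
  | s1
  | s2 (δ : Fin 2)
  | s3 (δ : Fin 2)
  | s4 (δ : Fin 2)
  | s5 (δ : Fin 2)
  | s6 (δ δ' : Fin 2)
  | s7 (δ : Fin 2)
  | s8 (δ : Fin 2)
  | s9 (δ δ' : Fin 2)
  | s10 (δ δ' : Fin 2)
  | s11 (δ : Fin 2)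
  | s12 (δ : Fin 2)
  | s13 (δ : Fin 2)
  | s14 (δ : Fin 2)
  | s15
  | s16 (δ : Fin 2)
  | s17 (δ : Fin 2)
  | s18

/-- The families of the Abelian part of the list. -/
def Label.InAbelianPart : Label → Prop
  | .s1 | .s2 _ | .s3 _ | .s4 _ | .s5 _ | .s6 _ _ | .s7 _ | .s8 _ => False
  | _ => True

/-- `h` is constant on no nonempty open subinterval of `I`. -/
def NowhereConstantOn (h : ℝ → ℝ) (I : Set ℝ) : Prop :=
  ∀ I' ⊆ I, IsOpenInterval I' → ¬ ∃ c, ∀ x ∈ I', h x = c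

/-- The constraints on the parameters `δ, δ'`, `g = g(t)` and `β = β(y)`. -/
def Label.Admissible (I J : Set ℝ) (g β : ℝ → ℝ) : Label → Prop
  | .s6 δ δ' => (δ, δ') ≠ (0, 0)
  | .s10 δ δ' => (δ, δ') ≠ (0, 0)
  | .s11 _ => ContDiffOn ℝ ∞ β J
  | .s13 _ => ContDiffOn ℝ ∞ g I
  | .s16 _ => ContDiffOn ℝ ∞ g I ∧ NowhereConstantOn g I
  | .s17 _ => ContDiffOn ℝ ∞ β J ∧ NowhereConstantOn β J
  | .s18 => (ContDiffOn ℝ ∞ g I ∧ NowhereConstantOn g I) ∧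
      (ContDiffOn ℝ ∞ β J ∧ NowhereConstantOn β J)
  | _ => True

/-- The constant function with the value `δ ∈ {0, 1}`. -/
def const (δ : Fin 2) : ℝ → ℝ := fun _ => (δ.val : ℝ)

/-- The two basis elements of the listed algebras. -/
def Label.basis (I J : Set ℝ) (g β : ℝ → ℝ) : Label → (Pt → Pt) × (Pt → Pt)
  | .s1 => (D I J (const 1) + S I J (const 1), D I J (fun t => t) + S I J (fun y => y))
  | .s2 δ => (D I J (const 1) + Z I J (const δ), D I J (fun t => t) - S I J (fun y => y))
  | .s3 δ => (D I J (const 1), D I J (fun t => t) + Z I J (const δ))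
  | .s4 δ => (S I J (const 1) - P I J (const δ), D I J (fun t => 2 * t) + S I J (fun y => y))
  | .s5 δ => (S I J (const 1), S I J (fun y => y) + P I J (const δ))
  | .s6 δ δ' => (P I J (const δ) + Z I J (const δ'), D I J (fun t => 2 * t) - S I J (fun y => y))
  | .s7 δ => (P I J (const 1), D I J (fun t => 2 * t) + Z I J (const δ))
  | .s8 δ => (Z I J (const 1), -S I J (fun y => y) + P I J (const δ))
  | .s9 δ δ' => (D I J (const 1) + Z I J (const δ), S I J (const 1) - P I J (const δ'))
  | .s10 δ δ' => (D I J (const 1) + S I J (const 1), P I J (const δ) + Z I J (const δ'))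
  | .s11 δ => (D I J (const 1) + Z I J β, P I J (const δ) + Z I J (const 1))
  | .s12 δ => (D I J (const 1) + Z I J (const δ), P I J (const 1))
  | .s13 δ => (S I J (const 1) + P I J g, P I J (const 1) + Z I J (const δ))
  | .s14 δ => (S I J (const 1) - P I J (const δ), Z I J (const 1))
  | .s15 => (P I J (const 1), Z I J (const 1))
  | .s16 δ => (P I J (const 1) + Z I J (const δ), P I J g)
  | .s17 δ => (P I J (const δ) + Z I J (const 1), Z I J β)
  | .s18 => (P I J (const 1) + Z I J (const 1), P I J g + Z I J β)

/-- The listed algebra with the given label and functional parameters, over `t ∈ I`, `y ∈ J`. -/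
def Label.algebra (I J : Set ℝ) (g β : ℝ → ℝ) (l : Label) : Submodule ℝ (Pt → Pt) :=
  Submodule.span ℝ {(l.basis I J g β).1, (l.basis I J g β).2}

end BLP

end

/-! The algebra is the direct sum of two commuting ideals, one consisting of the fields `D(f) +
P(g)` and the other of the fields `S(α) + Z(β)`, and `G` splits accordingly. Each ideal is a
semidirect product of the vector fields on an interval with a module of densities, of weight `1/2`
in the block `(t, x, u)` and of weight `-1` in the block `(y, v)`. A transformation changes the base
variable by `T`, multiplies the density by `m`, which is a constant multiple of the power `σ.wt` of
`T'`, and adds the Lie derivative of the shift `X` along the transformed field. Both blocks are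
therefore treated at once as pairs of functions of one variable; `lieBracket_vf` and
`Represents.isPushforward_iff` translate back to five variables.

For completeness, the blocks are normalized independently of each other, while the change of basis
is common to both. In the non-Abelian case a basis with `[V₁, V₂] = V₁` satisfies this relation in
each block. There are three normal forms per block (`nonabelian_normal_form`), and of the nine
combinations only the one with `V₁ = 0` is excluded; this leaves eight families. In the Abelian case
the vector-field components in a block are proportional, because their Wronskian vanishes, so one of
them can be subtracted away. The cases are then distinguished by the vector-field components that
survive (`good_abelian`), and the remaining constants are normalized by dilations. A smooth function
may vanish on a part of the interval only, which is why subintervals are taken throughout; faithful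
restriction, in the form of `Indep`, keeps the fields independent.

For inequivalence, `G` preserves the vanishing of the bracket and, for each element, the vanishing
of `f`, of `(f, g)`, of `α` and of `(α, β)`. Twelve yes-or-no questions about these profiles
determine the label (`labelOf_inv`). -/

noncomputable section

namespace BLP

open Filter Topology

/-! ### Calculus on an interval: antiderivatives, signs and smooth inverses. -/

section OneVariable

variable {I : Set ℝ} {f g h T : ℝ → ℝ} {t : ℝ}

theorem smooth_deriv (hI : IsOpen I) (hf : ContDiffOn ℝ ∞ f I) : ContDiffOn ℝ ∞ (deriv f) I :=
  ((contDiffOn_infty_iff_deriv_of_isOpen hI).1 hf).2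

theorem smooth_hasDerivAt (hI : IsOpen I) (hf : ContDiffOn ℝ ∞ f I) (ht : t ∈ I) :
    HasDerivAt f (deriv f t) t :=
  ((((contDiffOn_infty_iff_deriv_of_isOpen hI).1 hf).1 t ht).differentiableAt
    (hI.mem_nhds ht)).hasDerivAt

theorem smooth_of_hasDerivAt (hI : IsOpen I) (hg : ContDiffOn ℝ ∞ g I)
    (h : ∀ t ∈ I, HasDerivAt f (g t) t) : ContDiffOn ℝ ∞ f I :=
  (contDiffOn_infty_iff_deriv_of_isOpen hI).2
    ⟨fun t ht => (h t ht).differentiableAt.differentiableWithinAt,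
      hg.congr fun t ht => (h t ht).deriv⟩

theorem deriv_congr_on (hI : IsOpen I) (h : ∀ t ∈ I, f t = g t) (ht : t ∈ I) :
    deriv f t = deriv g t :=
  Filter.EventuallyEq.deriv_eq (eventually_of_mem (hI.mem_nhds ht) h)

theorem deriv_of_eqOn (hI : IsOpen I) (h : ∀ t ∈ I, f t = g t) (ht : t ∈ I) {g' : ℝ}
    (hg : HasDerivAt g g' t) : deriv f t = g' := by
  rw [deriv_congr_on hI h ht, hg.deriv]

theorem exists_antideriv (hI : IsOpenInterval I) (hf : ContDiffOn ℝ ∞ f I) :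
    ∃ F : ℝ → ℝ, ContDiffOn ℝ ∞ F I ∧ ∀ t ∈ I, HasDerivAt F (f t) t := by
  obtain ⟨hO, hC, t₀, ht₀⟩ := hI
  have key : ∀ t ∈ I, HasDerivAt (fun u => ∫ x in t₀..u, f x) (f t) t := by
    intro t ht
    refine intervalIntegral.integral_hasDerivAt_right ?_ ?_ ?_
    · exact (hf.continuousOn.mono (hC.uIcc_subset ht₀ ht)).intervalIntegrable
    · exact hf.continuousOn.stronglyMeasurableAtFilter hO t ht
    · exact hf.continuousOn.continuousAt (hO.mem_nhds ht)
  exact ⟨_, smooth_of_hasDerivAt hO hf key, key⟩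

theorem const_of_deriv_zero (hI : IsOpenInterval I) (h : ∀ t ∈ I, HasDerivAt f 0 t) :
    ∃ c, ∀ t ∈ I, f t = c := by
  obtain ⟨hO, hC, t₀, ht₀⟩ := hI
  refine ⟨f t₀, fun t ht => ?_⟩
  exact hO.is_const_of_deriv_eq_zero hC.isPreconnected
    (fun x hx => (h x hx).differentiableAt.differentiableWithinAt) (fun x hx => (h x hx).deriv)
    ht ht₀

/-- A continuous function without zeros has a constant sign on an interval. -/
theorem exists_sign (hI : IsOpenInterval I) (hf : ContinuousOn f I) (h0 : ∀ t ∈ I, f t ≠ 0) :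
    ∃ s : ℝ, (s = 1 ∨ s = -1) ∧ ∀ t ∈ I, 0 < s * f t := by
  obtain ⟨hO, hC, t₀, ht₀⟩ := hI
  have hp := hC.isPreconnected.image f hf
  have h0' : (0 : ℝ) ∉ f '' I := fun ⟨t, ht, h⟩ => h0 t ht h
  have hoc := hp.ordConnected
  rcases lt_or_gt_of_ne (h0 t₀ ht₀) with h | h
  · refine ⟨-1, Or.inr rfl, fun t ht => ?_⟩
    by_contra hcon
    -- Otherwise `0` would lie between `f t₀` and `f t`, hence in the image of the interval.
    exact h0' (hoc.out (mem_image_of_mem f ht₀) (mem_image_of_mem f ht) ⟨h.le, by linarith⟩)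
  · refine ⟨1, Or.inl rfl, fun t ht => ?_⟩
    by_contra hcon
    exact h0' (hoc.out (mem_image_of_mem f ht) (mem_image_of_mem f ht₀) ⟨by linarith, h.le⟩)

theorem exists_subinterval (hO : IsOpen I) (ht : t ∈ I) : ∃ I₀ ⊆ I, IsOpenInterval I₀ ∧ t ∈ I₀ := by
  obtain ⟨r, hr, hb⟩ := Metric.isOpen_iff.1 hO t ht
  rw [Real.ball_eq_Ioo] at hb
  exact ⟨_, hb, ⟨isOpen_Ioo, ordConnected_Ioo, ⟨t, by constructor <;> linarith⟩⟩,
    by constructor <;> linarith⟩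

theorem exists_subinterval_ne_zero (hI : IsOpen I) (hf : ContinuousOn f I)
    (h : ¬ ∀ t ∈ I, f t = 0) : ∃ I₀ ⊆ I, IsOpenInterval I₀ ∧ ∀ t ∈ I₀, f t ≠ 0 := by
  push Not at h
  obtain ⟨t, ht, h⟩ := h
  have hO : IsOpen (I ∩ f ⁻¹' {0}ᶜ) := hf.isOpen_inter_preimage hI isOpen_compl_singleton
  obtain ⟨I₀, h₀, h₁, -⟩ := exists_subinterval hO (t := t) ⟨ht, h⟩
  exact ⟨I₀, fun x hx => (h₀ hx).1, h₁, fun x hx => (h₀ hx).2⟩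

theorem injOn_of_deriv_ne_zero (hI : IsOpenInterval I) (hT : ContDiffOn ℝ ∞ T I)
    (h0 : ∀ t ∈ I, deriv T t ≠ 0) : InjOn T I := by
  have key : ∀ a ∈ I, ∀ b ∈ I, a < b → T a ≠ T b := by
    intro a ha b hb hab heq
    have hs : Icc a b ⊆ I := hI.2.1.out ha hb
    obtain ⟨c, hc, hc'⟩ := exists_deriv_eq_zero hab (hT.continuousOn.mono hs) heq
    exact h0 c (hs ⟨hc.1.le, hc.2.le⟩) hc'
  intro a ha b hb heq
  rcases lt_trichotomy a b with h | h | h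
  · exact absurd heq (key a ha b hb h)
  · exact h
  · exact absurd heq.symm (key b hb a ha h)

/-- The image of an interval under a local diffeomorphism, and the smooth inverse. -/
theorem exists_inverse (hI : IsOpenInterval I) (hT : ContDiffOn ℝ ∞ T I)
    (h0 : ∀ t ∈ I, deriv T t ≠ 0) :
    IsOpenInterval (T '' I) ∧ ∃ τ : ℝ → ℝ, ContDiffOn ℝ ∞ τ (T '' I) ∧
      (∀ t ∈ I, τ (T t) = t) ∧ MapsTo τ (T '' I) I := by
  have hinj := injOn_of_deriv_ne_zero hI hT h0
  have hstrict : ∀ t ∈ I, HasStrictDerivAt T (deriv T t) t := fun t ht =>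
    (hT.contDiffAt (hI.1.mem_nhds ht)).hasStrictDerivAt (by simp)
  have hOpen : ∀ U ⊆ I, IsOpen U → IsOpen (T '' U) := by
    intro U hU hUO
    rw [isOpen_iff_mem_nhds]
    rintro _ ⟨t, ht, rfl⟩
    rw [← (hstrict t (hU ht)).map_nhds_eq (h0 t (hU ht))]
    exact image_mem_map (hUO.mem_nhds ht)
  have hleft : ∀ t ∈ I, Function.invFunOn T I (T t) = t := fun t ht =>
    hinj.leftInvOn_invFunOn ht
  refine ⟨⟨hOpen I Subset.rfl hI.1, ?_, hI.2.2.image T⟩, Function.invFunOn T I, ?_, hleft, ?_⟩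
  · exact (hI.2.1.isPreconnected.image T hT.continuousOn).ordConnected
  · rintro _ ⟨t, ht, rfl⟩
    have hc := hT.contDiffAt (hI.1.mem_nhds ht)
    have hf' : HasFDerivAt T
        ((ContinuousLinearEquiv.unitsEquivAut ℝ (Units.mk0 _ (h0 t ht)) : ℝ ≃L[ℝ] ℝ) : ℝ →L[ℝ] ℝ)
        t := ((hstrict t ht).hasStrictFDerivAt_equiv (h0 t ht)).hasFDerivAt
    have hn : (∞ : WithTop ℕ∞) ≠ 0 := by simp
    -- The inverse function theorem supplies a smooth local inverse; it remains to see that it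
    -- agrees near `T t` with the global inverse. As `T` maps neighbourhoods of `t` onto
    -- neighbourhoods of `T t`, this can be checked at the points `T x` with `x` near `t`.
    have hloc := hc.to_localInverse hf' hn
    have hgt := hc.localInverse_apply_image hf' hn
    refine (hloc.congr_of_eventuallyEq ?_).contDiffWithinAt
    have h1 : ∀ᶠ x in 𝓝 t, hc.localInverse hf' hn (T x) = x :=
      (hc.hasStrictFDerivAt' hf' hn).eventually_left_inverse
    have h2 : ∀ᶠ s in 𝓝 (T t), ∃ x ∈ I, T x = s ∧ hc.localInverse hf' hn (T x) = x := by
      rw [← (hstrict t ht).map_nhds_eq (h0 t ht), eventually_map]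
      filter_upwards [h1, hI.1.mem_nhds ht] with x hx hxI using ⟨x, hxI, rfl, hx⟩
    filter_upwards [h2] with s hs
    obtain ⟨x, hxI, rfl, hx⟩ := hs
    rw [hleft x hxI, hx]
  · rintro _ ⟨t, ht, rfl⟩
    rw [hleft t ht]; exact ht

end OneVariable

/-! ### One block of variables: pairs, their bracket and their transformations. -/

section

/-- A pair `(f, g)` stands for `D(f) + P(g)` in the variables `(t, x, u)` or for `S(f) + Z(g)` in the
variables `(y, v)`. -/
abbrev Pair := (ℝ → ℝ) × (ℝ → ℝ)

/-- The two blocks of variables, `(t, x, u)` and `(y, v)`. -/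
inductive Side
  | t
  | y

/-- The weight of the second component as a density. -/
def Side.wt : Side → ℝ
  | .t => 1 / 2
  | .y => -1

theorem Side.wt_ne_zero (σ : Side) : σ.wt ≠ 0 := by cases σ <;> norm_num [Side.wt]

/-- `m` is the factor by which the change of variable `T` acts on densities. -/
def IsMult : Side → Set ℝ → (ℝ → ℝ) → (ℝ → ℝ) → Prop
  | .t, I, T, m => ∃ ε : ℝ, (ε = 1 ∨ ε = -1) ∧ ∀ t ∈ I, 0 < deriv T t ∧ m t = ε * √(deriv T t)
  | .y, I, T, m => ∀ t ∈ I, deriv T t ≠ 0 ∧ m t = 1 / deriv T t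

/-- One block of an element of `G`: the base variable goes to `T`, and the fibre variable, `x` or
`v`, is multiplied by `m` and shifted by `X`. -/
structure IsMove (σ : Side) (I : Set ℝ) (T m X : ℝ → ℝ) : Prop where
  interval : IsOpenInterval I
  smoothT : ContDiffOn ℝ ∞ T I
  smoothX : ContDiffOn ℝ ∞ X I
  mult : IsMult σ I T m

def Smooth (I : Set ℝ) (A : Pair) : Prop := ContDiffOn ℝ ∞ A.1 I ∧ ContDiffOn ℝ ∞ A.2 I

/-- The derivative of the first component of the transformed pair, in the old variable. -/
def pushDeriv (T : ℝ → ℝ) (A : Pair) (t : ℝ) : ℝ :=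
  deriv A.1 t + deriv (deriv T) t * A.1 t / deriv T t

/-- `B` is the transformed pair of `A`. -/
def Push (σ : Side) (I : Set ℝ) (T m X : ℝ → ℝ) (A B : Pair) : Prop :=
  ∀ t ∈ I, B.1 (T t) = deriv T t * A.1 t ∧
    B.2 (T t) = m t * A.2 t + deriv X t * A.1 t - σ.wt * X t * pushDeriv T A t

/-- The Lie bracket of pairs. -/
def br (k : ℝ) (A B : Pair) : Pair :=
  (fun t => A.1 t * deriv B.1 t - B.1 t * deriv A.1 t,
   fun t => A.1 t * deriv B.2 t - k * deriv A.1 t * B.2 t -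
    (B.1 t * deriv A.2 t - k * deriv B.1 t * A.2 t))

variable {σ : Side} {I I' : Set ℝ} {T m X : ℝ → ℝ} {A A₁ A₂ B B₁ B₂ : Pair} {t : ℝ}

theorem Smooth.mono (h : Smooth I A) (hI : I' ⊆ I) : Smooth I' A := ⟨h.1.mono hI, h.2.mono hI⟩

theorem Smooth.lin (h₁ : Smooth I A₁) (h₂ : Smooth I A₂) (a b : ℝ) :
    Smooth I (a • A₁ + b • A₂) :=
  ⟨(contDiffOn_const.smul h₁.1).add (contDiffOn_const.smul h₂.1),
    (contDiffOn_const.smul h₁.2).add (contDiffOn_const.smul h₂.2)⟩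

theorem lin_fst (a b : ℝ) : (a • A₁ + b • A₂).1 t = a * A₁.1 t + b * A₂.1 t := rfl

theorem lin_snd (a b : ℝ) : (a • A₁ + b • A₂).2 t = a * A₁.2 t + b * A₂.2 t := rfl

theorem deriv_lin_fst (hI : IsOpen I) (h₁ : Smooth I A₁) (h₂ : Smooth I A₂) (a b : ℝ)
    (ht : t ∈ I) : deriv (a • A₁ + b • A₂).1 t = a * deriv A₁.1 t + b * deriv A₂.1 t :=
  (((smooth_hasDerivAt hI h₁.1 ht).const_mul a).add
    ((smooth_hasDerivAt hI h₂.1 ht).const_mul b)).deriv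

theorem deriv_lin_snd (hI : IsOpen I) (h₁ : Smooth I A₁) (h₂ : Smooth I A₂) (a b : ℝ)
    (ht : t ∈ I) : deriv (a • A₁ + b • A₂).2 t = a * deriv A₁.2 t + b * deriv A₂.2 t :=
  (((smooth_hasDerivAt hI h₁.2 ht).const_mul a).add
    ((smooth_hasDerivAt hI h₂.2 ht).const_mul b)).deriv

theorem br_smooth (hI : IsOpen I) (k : ℝ) (h₁ : Smooth I A₁) (h₂ : Smooth I A₂) :
    Smooth I (br k A₁ A₂) := by
  have a := smooth_deriv hI h₁.1
  have b := smooth_deriv hI h₁.2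
  have c := smooth_deriv hI h₂.1
  have d := smooth_deriv hI h₂.2
  exact ⟨(h₁.1.mul c).sub (h₂.1.mul a),
    ((h₁.1.mul d).sub ((contDiffOn_const.mul a).mul h₂.2)).sub
      ((h₂.1.mul b).sub ((contDiffOn_const.mul c).mul h₁.2))⟩

/-- The bracket is bilinear and alternating, so a change of basis multiplies it by the determinant.
-/
theorem br_lin (hI : IsOpen I) (k : ℝ) (h₁ : Smooth I A₁) (h₂ : Smooth I A₂) (a b c d : ℝ)
    (ht : t ∈ I) :
    (br k (a • A₁ + b • A₂) (c • A₁ + d • A₂)).1 t = (a * d - b * c) * (br k A₁ A₂).1 t ∧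
    (br k (a • A₁ + b • A₂) (c • A₁ + d • A₂)).2 t = (a * d - b * c) * (br k A₁ A₂).2 t := by
  simp only [br, deriv_lin_fst hI h₁ h₂ _ _ ht, deriv_lin_snd hI h₁ h₂ _ _ ht, lin_fst, lin_snd]
  constructor <;> ring

theorem IsMult.deriv_ne_zero (h : IsMult σ I T m) (ht : t ∈ I) : deriv T t ≠ 0 := by
  cases σ with
  | t => obtain ⟨ε, -, h⟩ := h; exact (h t ht).1.ne'
  | y => exact (h t ht).1

theorem IsMult.ne_zero (h : IsMult σ I T m) (ht : t ∈ I) : m t ≠ 0 := by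
  cases σ with
  | t =>
    obtain ⟨ε, hε, h⟩ := h
    rw [(h t ht).2]
    have := Real.sqrt_pos.2 (h t ht).1
    rcases hε with rfl | rfl <;> simp [this.ne']
  | y => rw [(h t ht).2]; exact one_div_ne_zero (h t ht).1

/-- Since `m` is a constant times the power `σ.wt` of `deriv T`, its logarithmic derivative is
`σ.wt` times that of `deriv T`. This is the only property of `m` that the chain rules below need,
and it makes them uniform in the two blocks. -/
theorem IsMult.hasDerivAt (hI : IsOpen I) (hT : ContDiffOn ℝ ∞ T I) (h : IsMult σ I T m)
    (ht : t ∈ I) : HasDerivAt m (σ.wt * m t * deriv (deriv T) t / deriv T t) t := by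
  have h2 := smooth_hasDerivAt hI (smooth_deriv hI hT) ht
  cases σ with
  | t =>
    obtain ⟨ε, -, h⟩ := h
    have hp := (h t ht).1
    have hs := Real.sq_sqrt hp.le
    have hs0 := (Real.sqrt_pos.2 hp).ne'
    have := (h2.sqrt hp.ne').const_mul ε
    refine (this.congr_of_eventuallyEq
      (eventually_of_mem (hI.mem_nhds ht) fun s hs => (h s hs).2)).congr_deriv ?_
    rw [(h t ht).2, Side.wt]
    rw [eq_div_iff hp.ne']
    field_simp
    rw [hs]
  | y =>
    have hp := (h t ht).1
    have := h2.inv hp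
    refine (this.congr_of_eventuallyEq
      (eventually_of_mem (hI.mem_nhds ht) fun s hs => ?_)).congr_deriv ?_
    · simp [(h s hs).2]
    · rw [(h t ht).2, Side.wt]
      field_simp

theorem IsMult.smooth (hI : IsOpen I) (hT : ContDiffOn ℝ ∞ T I) (h : IsMult σ I T m) :
    ContDiffOn ℝ ∞ m I := by
  have h2 := smooth_deriv hI hT
  cases σ with
  | t =>
    obtain ⟨ε, -, h⟩ := h
    refine (contDiffOn_const.mul (h2.sqrt fun t ht => (h t ht).1.ne')).congr fun t ht => (h t ht).2
  | y =>
    refine (h2.inv fun t ht => (h t ht).1).congr fun t ht => ?_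
    simp [(h t ht).2]

theorem IsMult.mono (h : IsMult σ I T m) (hI : I' ⊆ I) : IsMult σ I' T m := by
  cases σ with
  | t => obtain ⟨ε, hε, h⟩ := h; exact ⟨ε, hε, fun t ht => h t (hI ht)⟩
  | y => exact fun t ht => h t (hI ht)

theorem IsMove.mono (h : IsMove σ I T m X) (hI : I' ⊆ I) (hI' : IsOpenInterval I') :
    IsMove σ I' T m X :=
  ⟨hI', h.smoothT.mono hI, h.smoothX.mono hI, h.mult.mono hI⟩

theorem IsMove.image (h : IsMove σ I T m X) : IsOpenInterval (T '' I) :=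
  (exists_inverse h.interval h.smoothT fun _ ht => h.mult.deriv_ne_zero ht).1

theorem pushDeriv_smooth (h : IsMove σ I T m X) (hA : Smooth I A) :
    ContDiffOn ℝ ∞ (pushDeriv T A) I := by
  have hO := h.interval.1
  have h1 := smooth_deriv hO h.smoothT
  exact (smooth_deriv hO hA.1).add
    (((smooth_deriv hO h1).mul hA.1).div h1 fun t ht => h.mult.deriv_ne_zero ht)

theorem IsMove.exists_push (h : IsMove σ I T m X) (hA : Smooth I A) :
    ∃ B, Smooth (T '' I) B ∧ Push σ I T m X A B := by
  obtain ⟨-, τ, hτ, hl, hm⟩ :=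
    exists_inverse h.interval h.smoothT fun _ ht => h.mult.deriv_ne_zero ht
  have hO := h.interval.1
  have h1 := smooth_deriv hO h.smoothT
  have hX := smooth_deriv hO h.smoothX
  have hm' := h.mult.smooth hO h.smoothT
  have hp := pushDeriv_smooth h hA
  refine ⟨((fun t => deriv T t * A.1 t) ∘ τ,
    (fun t => m t * A.2 t + deriv X t * A.1 t - σ.wt * X t * pushDeriv T A t) ∘ τ),
    ⟨(h1.mul hA.1).comp hτ hm, ?_⟩, ?_⟩
  · exact (((hm'.mul hA.2).add (hX.mul hA.1)).sub
      ((contDiffOn_const.mul h.smoothX).mul hp)).comp hτ hm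
  · intro t ht
    simp only [Function.comp, hl t ht, and_self]

theorem Push.unique (h₁ : Push σ I T m X A B₁) (h₂ : Push σ I T m X A B₂) :
    ∀ s ∈ T '' I, B₁.1 s = B₂.1 s ∧ B₁.2 s = B₂.2 s := by
  rintro _ ⟨t, ht, rfl⟩
  rw [(h₁ t ht).1, (h₁ t ht).2, (h₂ t ht).1, (h₂ t ht).2]
  exact ⟨rfl, rfl⟩

theorem Push.smooth (h : IsMove σ I T m X) (hA : Smooth I A) (hP : Push σ I T m X A B) :
    Smooth (T '' I) B := by
  obtain ⟨B', hB', hP'⟩ := h.exists_push hA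
  exact ⟨hB'.1.congr fun s hs => (hP.unique hP' s hs).1,
    hB'.2.congr fun s hs => (hP.unique hP' s hs).2⟩

theorem Push.congr_right (hP : Push σ I T m X A B₁)
    (h : ∀ s ∈ T '' I, B₁.1 s = B₂.1 s ∧ B₁.2 s = B₂.2 s) : Push σ I T m X A B₂ := by
  intro t ht
  rw [← (h _ (mem_image_of_mem T ht)).1, ← (h _ (mem_image_of_mem T ht)).2]
  exact hP t ht

theorem Push.mono (h : Push σ I T m X A B) (hI : I' ⊆ I) : Push σ I' T m X A B :=
  fun t ht => h t (hI ht)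

/-- Differentiate `B.1 ∘ T = T' * A.1` and divide by `T'`. Thus the shift terms in `Push` form the
Lie derivative of the shift, as a density of weight `σ.wt`, along the new field `B.1`. -/
theorem Push.deriv_fst (h : IsMove σ I T m X) (hA : Smooth I A) (hP : Push σ I T m X A B)
    (ht : t ∈ I) : deriv B.1 (T t) = pushDeriv T A t := by
  have hO := h.interval.1
  have hB := hP.smooth h hA
  have hd := h.mult.deriv_ne_zero ht
  have e1 := (smooth_hasDerivAt h.image.1 hB.1 (mem_image_of_mem T ht)).comp t
    (smooth_hasDerivAt hO h.smoothT ht)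
  have e2 := (smooth_hasDerivAt hO (smooth_deriv hO h.smoothT) ht).mul
    (smooth_hasDerivAt hO hA.1 ht)
  have e3 : deriv (B.1 ∘ T) t = _ := deriv_of_eqOn hO (fun t ht => (hP t ht).1) ht e2
  rw [e1.deriv] at e3
  rw [pushDeriv, ← mul_left_inj' hd, e3]
  field_simp
  ring

theorem pushDeriv_hasDerivAt (h : IsMove σ I T m X) (hA : Smooth I A) (ht : t ∈ I) :
    HasDerivAt (pushDeriv T A) (deriv (deriv A.1) t +
      ((deriv (deriv (deriv T)) t * A.1 t + deriv (deriv T) t * deriv A.1 t) * deriv T t -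
        deriv (deriv T) t * A.1 t * deriv (deriv T) t) / deriv T t ^ 2) t := by
  have hO := h.interval.1
  have h1 := smooth_deriv hO h.smoothT
  have h2 := smooth_deriv hO h1
  exact (smooth_hasDerivAt hO (smooth_deriv hO hA.1) ht).add
    (((smooth_hasDerivAt hO h2 ht).mul (smooth_hasDerivAt hO hA.1 ht)).div
      (smooth_hasDerivAt hO h1 ht) (h.mult.deriv_ne_zero ht))

theorem Push.deriv_snd (h : IsMove σ I T m X) (hA : Smooth I A) (hP : Push σ I T m X A B)
    (ht : t ∈ I) : deriv B.2 (T t) = (σ.wt * m t * deriv (deriv T) t / deriv T t * A.2 t +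
      m t * deriv A.2 t + deriv (deriv X) t * A.1 t + deriv X t * deriv A.1 t -
      σ.wt * (deriv X t * pushDeriv T A t + X t * deriv (pushDeriv T A) t)) / deriv T t := by
  have hO := h.interval.1
  have hB := hP.smooth h hA
  have hd := h.mult.deriv_ne_zero ht
  have e1 := (smooth_hasDerivAt h.image.1 hB.2 (mem_image_of_mem T ht)).comp t
    (smooth_hasDerivAt hO h.smoothT ht)
  have e2 := (((h.mult.hasDerivAt hO h.smoothT ht).mul (smooth_hasDerivAt hO hA.2 ht)).add
    ((smooth_hasDerivAt hO (smooth_deriv hO h.smoothX) ht).mul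
      (smooth_hasDerivAt hO hA.1 ht))).sub
    (((smooth_hasDerivAt hO h.smoothX ht).const_mul σ.wt).mul
      (smooth_hasDerivAt hO (pushDeriv_smooth h hA) ht))
  have e3 : deriv (B.2 ∘ T) t = _ := deriv_of_eqOn hO (fun t ht => (hP t ht).2) ht e2
  rw [e1.deriv] at e3
  rw [eq_div_iff hd, e3]
  ring

/-- Transformations respect the bracket. -/
theorem Push.bracket (h : IsMove σ I T m X) (h₁ : Smooth I A₁) (h₂ : Smooth I A₂)
    (hP₁ : Push σ I T m X A₁ B₁) (hP₂ : Push σ I T m X A₂ B₂) :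
    Push σ I T m X (br σ.wt A₁ A₂) (br σ.wt B₁ B₂) := by
  intro t ht
  have hO := h.interval.1
  have hd := h.mult.deriv_ne_zero ht
  have e := ((smooth_hasDerivAt hO h₁.1 ht).mul
    (smooth_hasDerivAt hO (smooth_deriv hO h₂.1) ht)).sub
    ((smooth_hasDerivAt hO h₂.1 ht).mul (smooth_hasDerivAt hO (smooth_deriv hO h₁.1) ht))
  have e' : deriv (br σ.wt A₁ A₂).1 t = _ := HasDerivAt.deriv e
  simp only [br] at e' ⊢
  simp only [pushDeriv, e', (hP₁ t ht).1, (hP₂ t ht).1, (hP₁ t ht).2, (hP₂ t ht).2,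
    hP₁.deriv_fst h h₁ ht, hP₂.deriv_fst h h₂ ht, hP₁.deriv_snd h h₁ ht, hP₂.deriv_snd h h₂ ht,
    (pushDeriv_hasDerivAt h h₁ ht).deriv, (pushDeriv_hasDerivAt h h₂ ht).deriv]
  -- What remains is a rational identity. The terms with `T'''` and `X''` are symmetric in the two
  -- pairs and cancel.
  constructor
  · field_simp
    ring
  · field_simp
    ring

theorem Push.lin (h : IsMove σ I T m X) (h₁ : Smooth I A₁) (h₂ : Smooth I A₂)
    (hP₁ : Push σ I T m X A₁ B₁) (hP₂ : Push σ I T m X A₂ B₂) (a b : ℝ) :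
    Push σ I T m X (a • A₁ + b • A₂) (a • B₁ + b • B₂) := by
  intro t ht
  simp only [lin_fst, lin_snd, pushDeriv, deriv_lin_fst h.interval.1 h₁ h₂ _ _ ht,
    (hP₁ t ht).1, (hP₂ t ht).1, (hP₁ t ht).2, (hP₂ t ht).2]
  constructor <;> ring

theorem deriv_comp_move {T₂ : ℝ → ℝ} (h : IsMove σ I T m X) (h₂ : ContDiffOn ℝ ∞ T₂ (T '' I))
    (ht : t ∈ I) : HasDerivAt (T₂ ∘ T) (deriv T₂ (T t) * deriv T t) t :=
  (smooth_hasDerivAt h.image.1 h₂ (mem_image_of_mem T ht)).comp t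
    (smooth_hasDerivAt h.interval.1 h.smoothT ht)

/-- The maps are affine in the fibre variable, so multipliers multiply and the shifts combine as in
`m₂ (m x + X) + X₂`. -/
theorem IsMove.comp {T₂ m₂ X₂ : ℝ → ℝ} (h : IsMove σ I T m X) (h₂ : IsMove σ (T '' I) T₂ m₂ X₂) :
    IsMove σ I (T₂ ∘ T) (fun t => m₂ (T t) * m t) (fun t => m₂ (T t) * X t + X₂ (T t)) := by
  have hm : MapsTo T I (T '' I) := mapsTo_image T I
  refine ⟨h.interval, h₂.smoothT.comp h.smoothT hm, ?_, ?_⟩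
  · exact (((h₂.mult.smooth h₂.interval.1 h₂.smoothT).comp h.smoothT hm).mul h.smoothX).add
      (h₂.smoothX.comp h.smoothT hm)
  · have hd : ∀ t ∈ I, deriv (T₂ ∘ T) t = deriv T₂ (T t) * deriv T t := fun t ht =>
      (deriv_comp_move h h₂.smoothT ht).deriv
    have e₁ := h.mult
    have e₂ := h₂.mult
    cases σ with
    | t =>
      obtain ⟨ε, hε, e₁⟩ := e₁
      obtain ⟨ε', hε', e₂⟩ := e₂
      refine ⟨ε' * ε, by rcases hε with rfl | rfl <;> rcases hε' with rfl | rfl <;> simp,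
        fun t ht => ?_⟩
      have a := e₁ t ht
      have b := e₂ _ (hm ht)
      simp only [hd t ht, a.2, b.2, Real.sqrt_mul b.1.le]
      exact ⟨mul_pos b.1 a.1, by ring⟩
    | y =>
      intro t ht
      have a := e₁ t ht
      have b := e₂ _ (hm ht)
      simp only [hd t ht, a.2, b.2]
      exact ⟨mul_ne_zero b.1 a.1, by field_simp⟩

theorem Push.comp {T₂ m₂ X₂ : ℝ → ℝ} {C : Pair} (h : IsMove σ I T m X)
    (h₂ : IsMove σ (T '' I) T₂ m₂ X₂) (hA : Smooth I A) (hP : Push σ I T m X A B)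
    (hP₂ : Push σ (T '' I) T₂ m₂ X₂ B C) :
    Push σ I (T₂ ∘ T) (fun t => m₂ (T t) * m t) (fun t => m₂ (T t) * X t + X₂ (T t)) A C := by
  intro t ht
  have hO := h.interval.1
  have hm := mem_image_of_mem T ht
  have hd : ∀ t ∈ I, deriv (T₂ ∘ T) t = deriv T₂ (T t) * deriv T t := fun t ht =>
      (deriv_comp_move h h₂.smoothT ht).deriv
  have hT := smooth_hasDerivAt hO h.smoothT ht
  have hT' := smooth_hasDerivAt hO (smooth_deriv hO h.smoothT) ht
  have hdd : deriv (deriv (T₂ ∘ T)) t = _ := deriv_of_eqOn hO hd ht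
    (((smooth_hasDerivAt h₂.interval.1 (smooth_deriv h₂.interval.1 h₂.smoothT) hm).comp t hT).mul
      hT')
  have hX : deriv (fun t => m₂ (T t) * X t + X₂ (T t)) t = _ := HasDerivAt.deriv
    ((((h₂.mult.hasDerivAt h₂.interval.1 h₂.smoothT hm).comp t hT).mul
      (smooth_hasDerivAt hO h.smoothX ht)).add
      ((smooth_hasDerivAt h₂.interval.1 h₂.smoothX hm).comp t hT))
  have d1 := h.mult.deriv_ne_zero ht
  have d2 := h₂.mult.deriv_ne_zero hm
  have a := hP t ht
  have b := hP₂ _ hm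
  have c := hP.deriv_fst h hA ht
  simp only [Function.comp_apply] at hdd
  simp only [pushDeriv, Function.comp_apply, hd t ht, hdd, hX, b.1, b.2, a.1, a.2, c]
  constructor
  · ring
  · field_simp
    ring

end

/-! ### Simultaneous reduction of two pairs on a subinterval. -/

section

/-- The pairs `A₁`, `A₂` over `I` are taken to `B₁`, `B₂` over `I'` by a transformation defined on a
subinterval of `I`. -/
def Reduces (σ : Side) (I : Set ℝ) (A₁ A₂ : Pair) (I' : Set ℝ) (B₁ B₂ : Pair) : Prop :=
  ∃ I₀ ⊆ I, ∃ T m X, IsMove σ I₀ T m X ∧ T '' I₀ = I' ∧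
    Push σ I₀ T m X A₁ B₁ ∧ Push σ I₀ T m X A₂ B₂

def Agree (I : Set ℝ) (A B : Pair) : Prop := ∀ t ∈ I, A.1 t = B.1 t ∧ A.2 t = B.2 t

/-- A pair of constant functions. -/
def cp (a b : ℝ) : Pair := (fun _ => a, fun _ => b)

/-- The pair `(kt, 0)`. -/
def lp (k : ℝ) : Pair := (fun t => k * t, fun _ => 0)

variable {σ : Side} {I I' I'' : Set ℝ} {T m X : ℝ → ℝ} {A A₁ A₂ B B₁ B₂ C₁ C₂ : Pair} {t : ℝ}

theorem Agree.mono (h : Agree I A B) (hI : I' ⊆ I) : Agree I' A B := fun t ht => h t (hI ht)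

theorem Push.congr_left (hI : IsOpen I) (h : Agree I A₁ A₂) (hP : Push σ I T m X A₁ B) :
    Push σ I T m X A₂ B := by
  intro t ht
  have e : deriv A₁.1 t = deriv A₂.1 t := deriv_congr_on hI (fun t ht => (h t ht).1) ht
  have := hP t ht
  rw [pushDeriv, (h t ht).1, (h t ht).2, e] at this
  exact this

theorem push_zero : Push σ I T m X (cp 0 0) (cp 0 0) := by
  intro t _
  simp [cp, pushDeriv]

/-- Vanishing of `A.1` on an open set also kills `pushDeriv T A`, which leaves `m * A.2 = 0`. The
subinterval `I'` makes it possible to pull vanishing back from a part of the image. -/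
theorem Push.agree_zero (h : IsMove σ I T m X) (hP : Push σ I T m X A B) (hI : I' ⊆ I)
    (hI' : IsOpen I') (hB : ∀ t ∈ I', B.1 (T t) = 0 ∧ B.2 (T t) = 0) : Agree I' A (cp 0 0) := by
  have h1 : ∀ t ∈ I', A.1 t = 0 := fun t ht => by
    have := (hP t (hI ht)).1
    rw [(hB t ht).1] at this
    exact (mul_eq_zero.1 this.symm).resolve_left (h.mult.deriv_ne_zero (hI ht))
  intro t ht
  refine ⟨h1 t ht, ?_⟩
  have := (hP t (hI ht)).2
  have e : deriv A.1 t = 0 :=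
    deriv_of_eqOn hI' (g := fun _ => 0) h1 ht (hasDerivAt_const _ _)
  rw [(hB t ht).2, pushDeriv, h1 t ht, e] at this
  have h2 : m t * A.2 t = 0 := by linear_combination -this
  exact (mul_eq_zero.1 h2).resolve_left (h.mult.ne_zero (hI ht))

theorem isMult_id : IsMult σ I (fun t => t) fun _ => 1 := by
  cases σ with
  | t => exact ⟨1, Or.inl rfl, fun t _ => by simp⟩
  | y => intro t _; simp

theorem reduces_of_subset (hI : I' ⊆ I) (hI' : IsOpenInterval I') :
    Reduces σ I A₁ A₂ I' A₁ A₂ := by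
  refine ⟨I', hI, fun t => t, fun _ => 1, fun _ => 0, ⟨hI', contDiffOn_id, contDiffOn_const,
    isMult_id⟩, by simp, ?_, ?_⟩ <;> intro t _ <;> simp

theorem Reduces.interval (h : Reduces σ I A₁ A₂ I' B₁ B₂) : IsOpenInterval I' := by
  obtain ⟨I₀, -, T, m, X, hm, rfl, -⟩ := h
  exact hm.image

theorem Reduces.smooth (h : Reduces σ I A₁ A₂ I' B₁ B₂) (h₁ : Smooth I A₁) (h₂ : Smooth I A₂) :
    Smooth I' B₁ ∧ Smooth I' B₂ := by
  obtain ⟨I₀, hs, T, m, X, hm, rfl, hP₁, hP₂⟩ := h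
  exact ⟨hP₁.smooth hm (h₁.mono hs), hP₂.smooth hm (h₂.mono hs)⟩

theorem Reduces.congr (h : Reduces σ I A₁ A₂ I' B₁ B₂) (h₁ : Agree I' B₁ C₁)
    (h₂ : Agree I' B₂ C₂) : Reduces σ I A₁ A₂ I' C₁ C₂ := by
  obtain ⟨I₀, hs, T, m, X, hm, rfl, hP₁, hP₂⟩ := h
  exact ⟨I₀, hs, T, m, X, hm, rfl, hP₁.congr_right h₁, hP₂.congr_right h₂⟩

theorem Reduces.congr_left (h : Reduces σ I B₁ B₂ I' C₁ C₂) (h₁ : Agree I B₁ A₁)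
    (h₂ : Agree I B₂ A₂) : Reduces σ I A₁ A₂ I' C₁ C₂ := by
  obtain ⟨I₀, hs, T, m, X, hm, rfl, hP₁, hP₂⟩ := h
  exact ⟨I₀, hs, T, m, X, hm, rfl, hP₁.congr_left hm.interval.1 (h₁.mono hs),
    hP₂.congr_left hm.interval.1 (h₂.mono hs)⟩

theorem Reduces.swap (h : Reduces σ I A₁ A₂ I' B₁ B₂) : Reduces σ I A₂ A₁ I' B₂ B₁ := by
  obtain ⟨I₀, hs, T, m, X, hm, e, hP₁, hP₂⟩ := h
  exact ⟨I₀, hs, T, m, X, hm, e, hP₂, hP₁⟩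

/-- The second transformation is defined only on a subinterval `I₁` of the image of the first. The
composite lives on the preimage of `I₁`; this is open by continuity of `T`, and an interval because
it is the image of `I₁` under the continuous inverse `τ`. -/
theorem Reduces.trans (h₁ : Smooth I A₁) (h₂ : Smooth I A₂) (h : Reduces σ I A₁ A₂ I' B₁ B₂)
    (h' : Reduces σ I' B₁ B₂ I'' C₁ C₂) : Reduces σ I A₁ A₂ I'' C₁ C₂ := by
  obtain ⟨I₀, hs, T, m, X, hm, rfl, hP₁, hP₂⟩ := h
  obtain ⟨I₁, hs', T', m', X', hm', rfl, hP₁', hP₂'⟩ := h'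
  obtain ⟨-, τ, hτ, hl, hτm⟩ :=
    exists_inverse hm.interval hm.smoothT fun _ ht => hm.mult.deriv_ne_zero ht
  have hinv : τ '' I₁ = I₀ ∩ T ⁻¹' I₁ := by
    ext x
    constructor
    · rintro ⟨s, hs1, rfl⟩
      obtain ⟨t, ht, rfl⟩ := hs' hs1
      rw [hl t ht]
      exact ⟨ht, hs1⟩
    · rintro ⟨hx, hx'⟩
      exact ⟨T x, hx', hl x hx⟩
  have hI₂ : IsOpenInterval (τ '' I₁) := by
    refine ⟨?_, ?_, hm'.interval.2.2.image τ⟩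
    · rw [hinv]
      exact hm.smoothT.continuousOn.isOpen_inter_preimage hm.interval.1 hm'.interval.1
    · exact (hm'.interval.2.1.isPreconnected.image τ (hτ.continuousOn.mono hs')).ordConnected
  have hsub : τ '' I₁ ⊆ I₀ := by rw [hinv]; exact inter_subset_left
  have himg : T '' (τ '' I₁) = I₁ := by
    rw [image_image]
    refine (image_congr fun s hs1 => ?_).trans (image_id _)
    obtain ⟨t, ht, rfl⟩ := hs' hs1
    rw [hl t ht, id]
  have hmm := hm.mono hsub hI₂
  have hm'' := hm'
  rw [← himg] at hm'' hP₁' hP₂'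
  refine ⟨τ '' I₁, hsub.trans hs, _, _, _, hmm.comp hm'', ?_, ?_, ?_⟩
  · rw [image_comp, himg]
  · exact Push.comp hmm hm'' (h₁.mono (hsub.trans hs)) (hP₁.mono hsub) hP₁'
  · exact Push.comp hmm hm'' (h₂.mono (hsub.trans hs)) (hP₂.mono hsub) hP₂'

theorem Reduces.lin (h₁ : Smooth I A₁) (h₂ : Smooth I A₂) (h : Reduces σ I A₁ A₂ I' B₁ B₂)
    (a b c d : ℝ) :
    Reduces σ I (a • A₁ + b • A₂) (c • A₁ + d • A₂) I' (a • B₁ + b • B₂) (c • B₁ + d • B₂) := by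
  obtain ⟨I₀, hs, T, m, X, hm, e, hP₁, hP₂⟩ := h
  exact ⟨I₀, hs, T, m, X, hm, e, Push.lin hm (h₁.mono hs) (h₂.mono hs) hP₁ hP₂ a b,
    Push.lin hm (h₁.mono hs) (h₂.mono hs) hP₁ hP₂ c d⟩

/-- Structure constants survive a reduction. After one pair is straightened, they become
differential equations with simple coefficients for the other pair. -/
theorem Reduces.bracket (h₁ : Smooth I A₁) (h₂ : Smooth I A₂) (h : Reduces σ I A₁ A₂ I' B₁ B₂)
    {a b : ℝ} (hb : Agree I (br σ.wt A₁ A₂) (a • A₁ + b • A₂)) :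
    Agree I' (br σ.wt B₁ B₂) (a • B₁ + b • B₂) := by
  obtain ⟨I₀, hs, T, m, X, hm, rfl, hP₁, hP₂⟩ := h
  exact ((Push.bracket hm (h₁.mono hs) (h₂.mono hs) hP₁ hP₂).congr_left hm.interval.1
    (hb.mono hs)).unique (Push.lin hm (h₁.mono hs) (h₂.mono hs) hP₁ hP₂ a b)

/-- A relation found after a reduction comes from a relation on some subinterval before it; this is
how independence is transported. -/
theorem Reduces.vanish (h₁ : Smooth I A₁) (h₂ : Smooth I A₂) (h : Reduces σ I A₁ A₂ I' B₁ B₂)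
    {a b : ℝ} (hI : I'' ⊆ I') (hI'' : IsOpenInterval I'')
    (h0 : Agree I'' (a • B₁ + b • B₂) (cp 0 0)) :
    ∃ I₁ ⊆ I, IsOpenInterval I₁ ∧ Agree I₁ (a • A₁ + b • A₂) (cp 0 0) := by
  obtain ⟨I₀, hs, T, m, X, hm, rfl, hP₁, hP₂⟩ := h
  have hO : IsOpen (I₀ ∩ T ⁻¹' I'') :=
    hm.smoothT.continuousOn.isOpen_inter_preimage hm.interval.1 hI''.1
  obtain ⟨s, hs0⟩ := hI''.2.2
  obtain ⟨t, ht, rfl⟩ := hI hs0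
  obtain ⟨I₁, hI₁, hi, -⟩ := exists_subinterval hO (t := t) ⟨ht, hs0⟩
  have hsub : I₁ ⊆ I₀ := hI₁.trans inter_subset_left
  exact ⟨I₁, hsub.trans hs, hi,
    (Push.lin hm (h₁.mono hs) (h₂.mono hs) hP₁ hP₂ a b).agree_zero hm hsub hi.1
      fun t ht => h0 _ (hI₁ ht).2⟩

theorem Reduces.fst_zero (h : Reduces σ I A₁ A₂ I' B₁ B₂) (h0 : ∀ t ∈ I, A₁.1 t = 0) :
    ∀ s ∈ I', B₁.1 s = 0 := by
  obtain ⟨I₀, hs, T, m, X, hm, rfl, hP₁, hP₂⟩ := h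
  rintro _ ⟨t, ht, rfl⟩
  rw [(hP₁ t ht).1, h0 t (hs ht), mul_zero]

theorem Reduces.agree_zero (h : Reduces σ I A₁ A₂ I' B₁ B₂) (h0 : Agree I A₁ (cp 0 0)) :
    Agree I' B₁ (cp 0 0) := by
  obtain ⟨I₀, hs, T, m, X, hm, rfl, hP₁, hP₂⟩ := h
  exact (hP₁.congr_left hm.interval.1 (h0.mono hs)).unique push_zero

theorem exists_mult_of_pos (h : ∀ t ∈ I, 0 < deriv T t) : ∃ m, IsMult σ I T m := by
  cases σ with
  | t => exact ⟨_, 1, Or.inl rfl, fun t ht => ⟨h t ht, rfl⟩⟩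
  | y => exact ⟨_, fun t ht => ⟨(h t ht).ne', rfl⟩⟩

theorem IsMove.reduces (h : IsMove σ I T m X) (h₁ : Smooth I A₁) (h₂ : Smooth I A₂) :
    ∃ B₁ B₂, Push σ I T m X A₁ B₁ ∧ Push σ I T m X A₂ B₂ ∧ Smooth (T '' I) B₁ ∧
      Smooth (T '' I) B₂ ∧ Reduces σ I A₁ A₂ (T '' I) B₁ B₂ := by
  obtain ⟨B₁, s₁, p₁⟩ := h.exists_push h₁
  obtain ⟨B₂, s₂, p₂⟩ := h.exists_push h₂
  exact ⟨B₁, B₂, p₁, p₂, s₁, s₂, I, Subset.rfl, T, m, X, h, rfl, p₁, p₂⟩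

/-- Straightening a pair with a nowhere vanishing first component. -/
theorem exists_straighten (hI : IsOpenInterval I) (h₁ : Smooth I A₁) (h₂ : Smooth I A₂)
    (h0 : ∀ t ∈ I, A₁.1 t ≠ 0) : ∃ s : ℝ, (s = 1 ∨ s = -1) ∧ ∃ I' B₂,
      Reduces σ I A₁ A₂ I' (cp s 0) B₂ := by
  obtain ⟨s, hs, hpos⟩ := exists_sign hI h₁.1.continuousOn h0
  have hs2 : s * s = 1 := by rcases hs with rfl | rfl <;> norm_num
  -- The choice `T' = s / A₁.1` makes the new first component the constant `s`; taking the sign of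
  -- `A₁.1` for `s` keeps `T'` positive, as the block of `t` demands.
  have hsm : ContDiffOn ℝ ∞ (fun t => s / A₁.1 t) I := contDiffOn_const.div h₁.1 h0
  obtain ⟨T, hT, hTd⟩ := exists_antideriv hI hsm
  have hTp : ∀ t ∈ I, 0 < deriv T t := fun t ht => by
    rw [(hTd t ht).deriv]
    have : s / A₁.1 t = (s * A₁.1 t) / (A₁.1 t) ^ 2 := by field_simp [h0 t ht]
    rw [this]
    exact div_pos (hpos t ht) (by have := h0 t ht; positivity)
  obtain ⟨m, hm⟩ := exists_mult_of_pos (σ := σ) hTp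
  -- The new first component is constant, so the shift contributes only `X' * A₁.1`, and `X'` is
  -- chosen to cancel `m * A₁.2`.
  obtain ⟨X, hX, hXd⟩ := exists_antideriv hI
    (f := fun t => -(m t * A₁.2 t / A₁.1 t)) (((hm.smooth hI.1 hT).mul h₁.2).div h₁.1 h0).neg
  have hmove : IsMove σ I T m X := ⟨hI, hT, hX, hm⟩
  obtain ⟨B₁, B₂, p₁, p₂, s₁, s₂, hR⟩ := hmove.reduces h₁ h₂
  refine ⟨s, hs, T '' I, B₂, hR.congr ?_ fun _ _ => ⟨rfl, rfl⟩⟩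
  rintro _ ⟨t, ht, rfl⟩
  have e1 := (hTd t ht).deriv
  have e2 : deriv (deriv T) t = _ := deriv_of_eqOn hI.1 (fun t ht => (hTd t ht).deriv) ht
    ((hasDerivAt_const t s).div (smooth_hasDerivAt hI.1 h₁.1 ht) (h0 t ht))
  have hf := h0 t ht
  have hs0 : s ≠ 0 := by rcases hs with rfl | rfl <;> norm_num
  rw [(p₁ t ht).1, (p₁ t ht).2, pushDeriv, e1, e2, (hXd t ht).deriv]
  simp only [cp]
  constructor
  · field_simp
  · field_simp
    ring

end

/-! ### Normal forms within one block. -/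

section

variable {σ : Side} {I I' I'' : Set ℝ} {T m X : ℝ → ℝ} {A A₁ A₂ B B₁ B₂ C₁ C₂ : Pair} {t : ℝ}

theorem smooth_cp (a b : ℝ) : Smooth I (cp a b) := ⟨contDiffOn_const, contDiffOn_const⟩

theorem smooth_lp (k : ℝ) : Smooth I (lp k) := ⟨contDiffOn_const.mul contDiffOn_id, contDiffOn_const⟩

theorem deriv_lp (k t : ℝ) : deriv (lp k).1 t = k := by
  simp [lp]

theorem reduces_refl (hI : IsOpenInterval I) : Reduces σ I A₁ A₂ I A₁ A₂ :=
  reduces_of_subset Subset.rfl hI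

/-- The dilation of the variable that multiplies densities by `M`. -/
def Side.dil : Side → ℝ → ℝ
  | .t, M => M ^ 2
  | .y, M => 1 / M

theorem Side.dil_ne_zero (σ : Side) {M : ℝ} (hM : M ≠ 0) : σ.dil M ≠ 0 := by
  cases σ <;> simp [Side.dil, hM]

theorem isMult_dil {M : ℝ} (hM : M ≠ 0) :
    IsMult σ I (fun t => σ.dil M * t) fun _ => M := by
  have hd : ∀ t, deriv (fun t => σ.dil M * t) t = σ.dil M := fun t => by simp
  cases σ with
  | t =>
    rcases lt_or_gt_of_ne hM with h | h
    · refine ⟨-1, Or.inr rfl, fun t _ => ?_⟩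
      rw [hd, Side.dil, Real.sqrt_sq_eq_abs, abs_of_neg h]
      exact ⟨by positivity, by ring⟩
    · refine ⟨1, Or.inl rfl, fun t _ => ?_⟩
      rw [hd, Side.dil, Real.sqrt_sq_eq_abs, abs_of_pos h]
      exact ⟨by positivity, by ring⟩
  | y =>
    intro t _
    rw [hd, Side.dil]
    exact ⟨one_div_ne_zero hM, by simp⟩

def dilate (σ : Side) (M : ℝ) (A : Pair) : Pair :=
  (fun s => σ.dil M * A.1 (s / σ.dil M), fun s => M * A.2 (s / σ.dil M))

theorem exists_dilate (hI : IsOpenInterval I) {M : ℝ} (hM : M ≠ 0) :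
    ∃ I', Reduces σ I A₁ A₂ I' (dilate σ M A₁) (dilate σ M A₂) := by
  have hk := σ.dil_ne_zero hM
  have hd : deriv (fun t => σ.dil M * t) = fun _ => σ.dil M := by ext t; simp
  refine ⟨(fun t => σ.dil M * t) '' I, I, Subset.rfl, fun t => σ.dil M * t, fun _ => M, fun _ => 0,
    ⟨hI, contDiffOn_const.mul contDiffOn_id, contDiffOn_const, isMult_dil hM⟩, rfl, ?_, ?_⟩ <;>
  · intro t _
    simp [dilate, hd, hk]

theorem dilate_cp (M a b : ℝ) : dilate σ M (cp a b) = cp (σ.dil M * a) (M * b) := rfl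

/-- Linear fields are invariant under dilations, so dilations remain available for normalizing the
other pair. -/
theorem dilate_lp {M : ℝ} (hM : M ≠ 0) (k : ℝ) : dilate σ M (lp k) = lp k := by
  have hk := σ.dil_ne_zero hM
  simp only [dilate, lp, mul_zero, Prod.mk.injEq, and_true]
  funext s
  field_simp

/-- Straightening the second component of a pair with a vanishing first component. -/
theorem exists_straighten_snd (hI : IsOpenInterval I) (h₁ : Smooth I A₁) (h₂ : Smooth I A₂)
    (hz : ∀ t ∈ I, A₁.1 t = 0) (h0 : ∀ t ∈ I, A₁.2 t ≠ 0) :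
    ∃ I' B₂, Reduces σ I A₁ A₂ I' (cp 0 1) B₂ := by
  obtain ⟨T, m, hT, hm, hmg⟩ : ∃ T m, ContDiffOn ℝ ∞ T I ∧ IsMult σ I T m ∧
      ∀ t ∈ I, m t * A₁.2 t = 1 := by
    cases σ with
    | t =>
      -- Here `m = ε √T'` must equal `1 / A₁.2`: the sign `ε` is that of `A₁.2`, and `T' = 1 / A₁.2
      -- ^ 2`.
      obtain ⟨s, hs, hpos⟩ := exists_sign hI h₁.2.continuousOn h0
      obtain ⟨T, hT, hTd⟩ := exists_antideriv hI
        (f := fun t => 1 / A₁.2 t ^ 2) (contDiffOn_const.div (h₁.2.pow 2) fun t ht =>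
          pow_ne_zero 2 (h0 t ht))
      refine ⟨T, fun t => 1 / A₁.2 t, hT, ⟨s, hs, fun t ht => ?_⟩, fun t ht => ?_⟩
      · have hg := h0 t ht
        have hp := hpos t ht
        rw [(hTd t ht).deriv]
        refine ⟨by positivity, ?_⟩
        rw [Real.sqrt_div zero_le_one, Real.sqrt_one, Real.sqrt_sq_eq_abs]
        rcases hs with rfl | rfl
        · rw [abs_of_pos (by linarith)]; ring
        · rw [abs_of_neg (by linarith)]; field_simp
      · have hg := h0 t ht
        field_simp
    | y =>
      -- Here `m = 1 / T'`, so `T' = A₁.2`.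
      obtain ⟨T, hT, hTd⟩ := exists_antideriv hI h₁.2
      refine ⟨T, fun t => 1 / A₁.2 t, hT, fun t ht => ?_, fun t ht => ?_⟩
      · rw [(hTd t ht).deriv]
        exact ⟨h0 t ht, rfl⟩
      · have hg := h0 t ht
        field_simp
  have hmove : IsMove σ I T m fun _ => 0 := ⟨hI, hT, contDiffOn_const, hm⟩
  obtain ⟨B₁, B₂, p₁, p₂, s₁, s₂, hR⟩ := hmove.reduces h₁ h₂
  refine ⟨T '' I, B₂, hR.congr ?_ fun _ _ => ⟨rfl, rfl⟩⟩
  rintro _ ⟨t, ht, rfl⟩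
  rw [(p₁ t ht).1, (p₁ t ht).2, hmg t ht, hz t ht]
  simp [cp]

/-- A pair with a nowhere vanishing first component is taken to a dilation field. -/
theorem exists_straighten_dilation (hI : IsOpenInterval I) (h₁ : Smooth I A₁) (h₂ : Smooth I A₂)
    (h0 : ∀ t ∈ I, A₁.1 t ≠ 0) : ∃ I' B₂,
      Reduces σ I A₁ A₂ I' (lp (1 / σ.wt)) B₂ ∧ ∀ t ∈ I', t ≠ 0 := by
  obtain ⟨s, hs, I₁, B, hR⟩ := exists_straighten (σ := σ) hI h₁ h₂ h0
  have hw := σ.wt_ne_zero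
  have hs2 : s * s = 1 := by rcases hs with rfl | rfl <;> norm_num
  -- This `T` has the positive derivative `exp (s t / σ.wt)`, and `s * T' = T / σ.wt`, so the
  -- constant field `s` becomes linear with slope `1 / σ.wt`. Its values avoid `0`.
  have hTd : ∀ t, HasDerivAt (fun t => s * σ.wt * Real.exp (s / σ.wt * t))
      (Real.exp (s / σ.wt * t)) t := fun t => by
    have := (((hasDerivAt_id t).const_mul (s / σ.wt)).exp).const_mul (s * σ.wt)
    refine this.congr_deriv ?_
    simp only [id, mul_one]
    field_simp
    linear_combination hs2
  have hTd' : deriv (fun t => s * σ.wt * Real.exp (s / σ.wt * t)) =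
      fun t => Real.exp (s / σ.wt * t) := funext fun t => (hTd t).deriv
  obtain ⟨m, hm⟩ := exists_mult_of_pos (σ := σ) (I := I₁)
    (T := fun t => s * σ.wt * Real.exp (s / σ.wt * t))
    fun t _ => by rw [hTd']; exact Real.exp_pos _
  have hmove : IsMove σ I₁ (fun t => s * σ.wt * Real.exp (s / σ.wt * t)) m fun _ => 0 :=
    ⟨hR.interval, by fun_prop, contDiffOn_const, hm⟩
  obtain ⟨B₁, B₂, p₁, p₂, s₁, s₂, hR'⟩ :=
    hmove.reduces (hR.smooth h₁ h₂).1 (hR.smooth h₁ h₂).2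
  refine ⟨_, B₂, (hR.trans h₁ h₂ hR').congr ?_ fun _ _ => ⟨rfl, rfl⟩, ?_⟩
  · rintro _ ⟨t, ht, rfl⟩
    rw [(p₁ t ht).1, (p₁ t ht).2, hTd']
    simp only [cp, lp, deriv_const']
    constructor
    · field_simp
    · ring
  · rintro _ ⟨t, -, rfl⟩
    have : s ≠ 0 := by rcases hs with rfl | rfl <;> norm_num
    positivity

theorem exists_normalize (c : ℝ) : ∃ M : ℝ, M ≠ 0 ∧ ∃ δ : Fin 2, M * c = (δ.val : ℝ) := by
  by_cases h : c = 0
  · exact ⟨1, one_ne_zero, 0, by simp [h]⟩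
  · exact ⟨1 / c, one_div_ne_zero h, 1, by simp [h]⟩

/-- A pair with a vanishing first component is taken to `(0, 0)` or `(0, 1)`. -/
theorem exists_straighten_snd_or_zero (hI : IsOpenInterval I) (h₁ : Smooth I A₁) (h₂ : Smooth I A₂)
    (hz : ∀ t ∈ I, A₁.1 t = 0) :
    ∃ (δ : Fin 2) (I' : Set ℝ) (B₂ : Pair), Reduces σ I A₁ A₂ I' (cp 0 δ.val) B₂ := by
  by_cases h : ∀ t ∈ I, A₁.2 t = 0
  · exact ⟨0, I, A₂, (reduces_refl hI).congr (fun t ht => by simp [hz t ht, h t ht, cp])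
      fun _ _ => ⟨rfl, rfl⟩⟩
  · obtain ⟨I₀, hs, hI₀, h0⟩ := exists_subinterval_ne_zero hI.1 h₁.2.continuousOn h
    obtain ⟨I', B₂, hR⟩ := exists_straighten_snd (σ := σ) hI₀ (h₁.mono hs) (h₂.mono hs)
      (fun t ht => hz t (hs ht)) h0
    exact ⟨1, I', B₂, by simpa using (reduces_of_subset hs hI₀).trans h₁ h₂ hR⟩

/-- Normal forms of two pairs that satisfy `[A₁, A₂] = A₁`. -/
theorem nonabelian_normal_form (hI : IsOpenInterval I) (h₁ : Smooth I A₁) (h₂ : Smooth I A₂)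
    (hb : Agree I (br σ.wt A₁ A₂) A₁) :
    (∃ s : ℝ, (s = 1 ∨ s = -1) ∧ ∃ I', Reduces σ I A₁ A₂ I' (cp s 0) (lp 1)) ∨
    (∃ (δ : Fin 2) (I' : Set ℝ), Reduces σ I A₁ A₂ I' (cp 0 δ.val) (lp (1 / σ.wt))) ∨
    (∃ (δ : Fin 2) (I' : Set ℝ), Reduces σ I A₁ A₂ I' (cp 0 0) (cp 0 δ.val)) := by
  have hw := σ.wt_ne_zero
  have hb' : Agree I (br σ.wt A₁ A₂) ((1 : ℝ) • A₁ + (0 : ℝ) • A₂) := by simpa using hb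
  by_cases hf₁ : ∀ t ∈ I, A₁.1 t = 0
  swap
  · left
    obtain ⟨I₀, hs, hI₀, h0⟩ := exists_subinterval_ne_zero hI.1 h₁.1.continuousOn hf₁
    obtain ⟨s, hs1, I₁, B, hR⟩ := exists_straighten (σ := σ) hI₀ (h₁.mono hs) (h₂.mono hs) h0
    replace hR := (reduces_of_subset hs hI₀).trans h₁ h₂ hR
    have hB := (hR.smooth h₁ h₂).2
    have hbr := hR.bracket h₁ h₂ hb'
    have hO := hR.interval.1
    have hs0 : s ≠ 0 := by rcases hs1 with rfl | rfl <;> norm_num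
    -- For `A₁ = (s, 0)` the bracket relation reads `s * B.1' = s` and `s * B.2' = 0`, hence `B = (t
    -- + c, e)`.
    have hd : ∀ t ∈ I₁, deriv B.1 t = 1 ∧ deriv B.2 t = 0 := by
      intro t ht
      have := hbr t ht
      simp only [br, cp, lin_fst, lin_snd, deriv_const'] at this
      constructor
      · apply mul_left_cancel₀ hs0; linear_combination this.1
      · apply mul_left_cancel₀ hs0; linear_combination this.2
    obtain ⟨c, hc⟩ := const_of_deriv_zero hR.interval (f := fun t => B.1 t - t) fun t ht => by
      refine ((smooth_hasDerivAt hO hB.1 ht).sub (hasDerivAt_id t)).congr_deriv ?_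
      rw [(hd t ht).1, sub_self]
    obtain ⟨e, he⟩ := const_of_deriv_zero hR.interval (f := B.2) fun t ht =>
      (smooth_hasDerivAt hO hB.2 ht).congr_deriv (hd t ht).2
    -- The translation by `c` removes `c`, and the constant shift `e / σ.wt` removes `e` because
    -- `B.1' = 1`. Both leave the constant pair `(s, 0)` unchanged.
    have hTd : deriv (fun t : ℝ => t + c) = fun _ => 1 := by ext t; simp
    have hmove : IsMove σ I₁ (fun t => t + c) (fun _ => 1) fun _ => e / σ.wt := by
      refine ⟨hR.interval, by fun_prop, contDiffOn_const, ?_⟩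
      cases σ with
      | t => exact ⟨1, Or.inl rfl, fun t _ => by simp⟩
      | y => intro t _; simp
    refine ⟨s, hs1, _, hR.trans h₁ h₂ ⟨I₁, Subset.rfl, _, _, _, hmove, rfl, ?_, ?_⟩⟩
    · intro t ht
      simp [cp, hTd, pushDeriv]
    · intro t ht
      have e1 : B.1 t = t + c := by linear_combination hc t ht
      simp only [lp, hTd, pushDeriv, (hd t ht).1, he t ht, e1, deriv_const']
      constructor
      · simp
      · field_simp
        simp
  right
  by_cases hf₂ : ∀ t ∈ I, A₂.1 t = 0
  · right
    -- Densities commute, so `A₁ = [A₁, A₂]` must vanish.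
    have hA₁ : Agree I A₁ (cp 0 0) := by
      intro t ht
      refine ⟨hf₁ t ht, ?_⟩
      have := (hb t ht).2
      have e1 : deriv A₁.1 t = 0 :=
        deriv_of_eqOn hI.1 (g := fun _ => 0) hf₁ ht (hasDerivAt_const _ _)
      have e2 : deriv A₂.1 t = 0 :=
        deriv_of_eqOn hI.1 (g := fun _ => 0) hf₂ ht (hasDerivAt_const _ _)
      simp only [br, e1, e2, hf₁ t ht, hf₂ t ht] at this
      simp only [cp]
      linear_combination -this
    obtain ⟨δ, I', B, hR⟩ := exists_straighten_snd_or_zero (σ := σ) hI h₂ h₁ hf₂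
    exact ⟨δ, I', hR.swap.congr (hR.swap.agree_zero hA₁) fun _ _ => ⟨rfl, rfl⟩⟩
  · left
    obtain ⟨I₀, hs, hI₀, h0⟩ := exists_subinterval_ne_zero hI.1 h₂.1.continuousOn hf₂
    obtain ⟨I₁, B, hR, hn⟩ := exists_straighten_dilation (σ := σ) hI₀ (h₂.mono hs) (h₁.mono hs) h0
    replace hR := (reduces_of_subset hs hI₀).trans h₁ h₂ hR.swap
    have hB := (hR.smooth h₁ h₂).1
    have hB0 := hR.fst_zero hf₁
    have hbr := hR.bracket h₁ h₂ hb'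
    have hO := hR.interval.1
    obtain ⟨c, hc⟩ := const_of_deriv_zero hR.interval (f := B.2) fun t ht => by
      refine (smooth_hasDerivAt hO hB.2 ht).congr_deriv ?_
      have e1 : deriv B.1 t = 0 :=
        deriv_of_eqOn hO (g := fun _ => 0) hB0 ht (hasDerivAt_const _ _)
      have := (hbr t ht).2
      simp only [br, lin_snd, deriv_lp, e1, hB0 t ht] at this
      simp only [lp] at this
      -- The slope `1 / σ.wt` was chosen for this: the relation becomes `-(t * B.2' / σ.wt - B.2) =
      -- B.2`, so `B.2` is constant away from `t = 0`.
      have h3 : t * deriv B.2 t = 0 := by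
        field_simp at this
        linear_combination -this
      exact (mul_eq_zero.1 h3).resolve_left (hn t ht)
    obtain ⟨M, hM, δ, hδ⟩ := exists_normalize c
    obtain ⟨I₂, hR₂⟩ := exists_dilate (σ := σ) (A₁ := cp 0 c) (A₂ := lp (1 / σ.wt)) hR.interval hM
    rw [dilate_cp, dilate_lp hM, hδ, mul_zero] at hR₂
    refine ⟨δ, I₂, (hR.congr (C₁ := cp 0 c) (fun t ht => ⟨hB0 t ht, hc t ht⟩)
      fun _ _ => ⟨rfl, rfl⟩).trans h₁ h₂ hR₂⟩

/-- Normal form of two commuting pairs, the second one with a vanishing first component. -/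
theorem abelian_normal_form (hI : IsOpenInterval I) (h₁ : Smooth I A₁) (h₂ : Smooth I A₂)
    (hb : Agree I (br σ.wt A₁ A₂) (cp 0 0)) (h0 : ∀ t ∈ I, A₁.1 t ≠ 0)
    (hz : ∀ t ∈ I, A₂.1 t = 0) :
    ∃ s : ℝ, (s = 1 ∨ s = -1) ∧ ∃ c I', Reduces σ I A₁ A₂ I' (cp s 0) (cp 0 c) := by
  have hb' : Agree I (br σ.wt A₁ A₂) ((0 : ℝ) • A₁ + (0 : ℝ) • A₂) := fun t ht => by
    simpa [lin_fst, lin_snd, cp] using hb t ht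
  obtain ⟨s, hs1, I₁, B, hR⟩ := exists_straighten (σ := σ) hI h₁ h₂ h0
  have hB := (hR.smooth h₁ h₂).2
  have hbr := hR.bracket h₁ h₂ hb'
  have hO := hR.interval.1
  have hB0 := hR.swap.fst_zero hz
  have hs0 : s ≠ 0 := by rcases hs1 with rfl | rfl <;> norm_num
  obtain ⟨c, hc⟩ := const_of_deriv_zero hR.interval (f := B.2) fun t ht => by
    refine (smooth_hasDerivAt hO hB.2 ht).congr_deriv ?_
    have := (hbr t ht).2
    simp only [br, cp, lin_snd, deriv_const', hB0 t ht] at this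
    apply mul_left_cancel₀ hs0
    linear_combination this
  exact ⟨s, hs1, c, I₁, hR.congr (fun _ _ => ⟨rfl, rfl⟩) fun t ht => ⟨hB0 t ht, hc t ht⟩⟩

/-- Of two commuting pairs, the first component of the second one is a multiple of the first
component of the first one where the latter does not vanish. -/
theorem exists_fst_eq_smul (hI : IsOpenInterval I) (h₁ : Smooth I A₁) (h₂ : Smooth I A₂) {k : ℝ}
    (hb : Agree I (br k A₁ A₂) (cp 0 0)) (h0 : ∀ t ∈ I, A₁.1 t ≠ 0) :
    ∃ c, ∀ t ∈ I, A₂.1 t = c * A₁.1 t := by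
  -- The numerator in the derivative of the quotient is the first component of the bracket.
  obtain ⟨c, hc⟩ := const_of_deriv_zero hI (f := fun t => A₂.1 t / A₁.1 t) fun t ht => by
    refine ((smooth_hasDerivAt hI.1 h₂.1 ht).div (smooth_hasDerivAt hI.1 h₁.1 ht)
      (h0 t ht)).congr_deriv ?_
    have := (hb t ht).1
    simp only [br, cp] at this
    rw [div_eq_zero_iff]
    left
    linear_combination this
  exact ⟨c, fun t ht => by rw [← hc t ht, div_mul_cancel₀ _ (h0 t ht)]⟩

end

/-! ### Pairs as vector fields in five variables. -/

section

variable {I J I' J' : Set ℝ} {A A₁ A₂ A' B B₁ B₂ B' : Pair} {p : Pt}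

theorem isOpen_strip (hI : IsOpen I) (hJ : IsOpen J) : IsOpen (strip I J) :=
  (hI.preimage (continuous_apply 0)).inter (hJ.preimage (continuous_apply 2))

/-- The expression of the vector field `D(A.1) + P(A.2) + S(B.1) + Z(B.2)`. -/
def vfExpr (A B : Pair) (p : Pt) : Pt :=
  ![A.1 (p 0), 1 / 2 * deriv A.1 (p 0) * p 1 + A.2 (p 0), B.1 (p 2),
    -(1 / 2 * deriv A.1 (p 0) * p 3 + 1 / 4 * deriv (deriv A.1) (p 0) * p 1)
      - 1 / 2 * deriv A.2 (p 0),
    -(deriv B.1 (p 2) * p 4) + B.2 (p 2)]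

/-- The vector field `D(A.1) + P(A.2) + S(B.1) + Z(B.2)`. -/
def vf (I J : Set ℝ) (A B : Pair) : Pt → Pt := restrictTo (strip I J) (vfExpr A B)

theorem vf_of_mem (hp : p ∈ strip I J) : vf I J A B p = vfExpr A B p :=
  indicator_of_mem hp _

theorem vf_of_notMem (hp : p ∉ strip I J) : vf I J A B p = 0 :=
  indicator_of_notMem hp _

theorem vec_ext {v w : Pt} (h0 : v 0 = w 0) (h1 : v 1 = w 1) (h2 : v 2 = w 2) (h3 : v 3 = w 3)
    (h4 : v 4 = w 4) : v = w := by
  funext i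
  fin_cases i <;> assumption

theorem vf_ext {V : Pt → Pt} (h : ∀ p ∈ strip I J, V p = vfExpr A B p)
    (h' : ∀ p ∉ strip I J, V p = 0) : V = vf I J A B := by
  funext p
  by_cases hp : p ∈ strip I J
  · rw [vf_of_mem hp, h p hp]
  · rw [vf_of_notMem hp, h' p hp]

theorem vf_eq : vf I J A B = D I J A.1 + P I J A.2 + S I J B.1 + Z I J B.2 := by
  simp only [D, P, S, Z, vf, ← map_add]
  congr 1
  funext p
  apply vec_ext <;> simp [vfExpr]
  ring

theorem vf_lin (hI : IsOpen I) (hJ : IsOpen J) (h₁ : Smooth I A₁) (h₂ : Smooth I A₂)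
    (h₁' : Smooth J B₁) (h₂' : Smooth J B₂) (a b : ℝ) :
    a • vf I J A₁ B₁ + b • vf I J A₂ B₂ = vf I J (a • A₁ + b • A₂) (a • B₁ + b • B₂) := by
  refine vf_ext (fun p hp => ?_) fun p hp => by simp [vf_of_notMem hp]
  have e2 : deriv (deriv (a • A₁ + b • A₂).1) (p 0) = _ :=
    deriv_of_eqOn hI (fun t ht => deriv_lin_fst hI h₁ h₂ a b ht) hp.1
      (((smooth_hasDerivAt hI (smooth_deriv hI h₁.1) hp.1).const_mul a).add
        ((smooth_hasDerivAt hI (smooth_deriv hI h₂.1) hp.1).const_mul b))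
  simp only [Pi.add_apply, Pi.smul_apply, vf_of_mem hp]
  apply vec_ext <;> simp [vfExpr, -Prod.fst_add, -Prod.snd_add, lin_fst, lin_snd,
    deriv_lin_fst hI h₁ h₂ a b hp.1, deriv_lin_snd hI h₁ h₂ a b hp.1,
    deriv_lin_fst hJ h₁' h₂' a b hp.2, e2] <;> ring

theorem agree_vf (hI : IsOpen I) (hJ : IsOpen J) (h : Agree I A A') (h' : Agree J B B') :
    vf I J A B = vf I J A' B' := by
  refine vf_ext (fun p hp => ?_) fun p hp => vf_of_notMem hp
  have e1 : ∀ t ∈ I, deriv A.1 t = deriv A'.1 t :=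
    fun t ht => deriv_congr_on hI (fun t ht => (h t ht).1) ht
  rw [vf_of_mem hp, vfExpr, vfExpr, (h _ hp.1).1, (h _ hp.1).2, (h' _ hp.2).1, (h' _ hp.2).2,
    deriv_congr_on hI e1 hp.1, e1 _ hp.1, deriv_congr_on hI (fun t ht => (h t ht).2) hp.1,
    deriv_congr_on hJ (fun t ht => (h' t ht).1) hp.2]

theorem vf_zero : vf I J (cp 0 0) (cp 0 0) = 0 := by
  symm
  refine vf_ext (fun p hp => ?_) fun p hp => rfl
  apply vec_ext <;> simp [vfExpr, cp]

theorem restrict_vf (hI : I' ⊆ I) (hJ : J' ⊆ J) :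
    restrictTo (strip I' J') (vf I J A B) = vf I' J' A B := by
  refine vf_ext (fun p hp => ?_) fun p hp => indicator_of_notMem hp _
  have hp' : p ∈ strip I J := ⟨hI hp.1, hJ hp.2⟩
  rw [← vf_of_mem hp']
  exact indicator_of_mem hp _

theorem mem_symAlgebra (hI : IsOpen I) (hJ : IsOpen J) {V : Pt → Pt} :
    V ∈ symAlgebra I J ↔ ∃ A B, Smooth I A ∧ Smooth J B ∧ V = vf I J A B := by
  constructor
  · intro hV
    induction hV using Submodule.span_induction with
    | mem V hV =>
      rcases hV with ((⟨f, hf, rfl⟩ | ⟨f, hf, rfl⟩) | ⟨f, hf, rfl⟩) | ⟨f, hf, rfl⟩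
      · refine ⟨(f, fun _ => 0), cp 0 0, ⟨hf, contDiffOn_const⟩, smooth_cp 0 0, ?_⟩
        refine congr_arg (restrictTo _) (funext fun p => ?_)
        apply vec_ext <;> simp [vfExpr, cp]
      · refine ⟨cp 0 0, (f, fun _ => 0), smooth_cp 0 0, ⟨hf, contDiffOn_const⟩, ?_⟩
        refine congr_arg (restrictTo _) (funext fun p => ?_)
        apply vec_ext <;> simp [vfExpr, cp]
      · refine ⟨(fun _ => 0, f), cp 0 0, ⟨contDiffOn_const, hf⟩, smooth_cp 0 0, ?_⟩
        refine congr_arg (restrictTo _) (funext fun p => ?_)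
        apply vec_ext <;> simp [vfExpr, cp]
      · refine ⟨cp 0 0, (fun _ => 0, f), smooth_cp 0 0, ⟨contDiffOn_const, hf⟩, ?_⟩
        refine congr_arg (restrictTo _) (funext fun p => ?_)
        apply vec_ext <;> simp [vfExpr, cp]
    | zero => exact ⟨cp 0 0, cp 0 0, smooth_cp 0 0, smooth_cp 0 0, vf_zero.symm⟩
    | add V W _ _ hV hW =>
      obtain ⟨A₁, B₁, hA₁, hB₁, rfl⟩ := hV
      obtain ⟨A₂, B₂, hA₂, hB₂, rfl⟩ := hW
      refine ⟨_, _, hA₁.lin hA₂ 1 1, hB₁.lin hB₂ 1 1, ?_⟩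
      rw [← vf_lin hI hJ hA₁ hA₂ hB₁ hB₂, one_smul, one_smul]
    | smul c V _ hV =>
      obtain ⟨A₁, B₁, hA₁, hB₁, rfl⟩ := hV
      refine ⟨_, _, hA₁.lin hA₁ c 0, hB₁.lin hB₁ c 0, ?_⟩
      rw [← vf_lin hI hJ hA₁ hA₁ hB₁ hB₁, zero_smul, add_zero]
  · rintro ⟨A, B, hA, hB, rfl⟩
    rw [vf_eq]
    refine add_mem (add_mem (add_mem ?_ ?_) ?_) ?_
    · exact Submodule.subset_span (Or.inl (Or.inl (Or.inl ⟨_, hA.1, rfl⟩)))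
    · exact Submodule.subset_span (Or.inl (Or.inr ⟨_, hA.2, rfl⟩))
    · exact Submodule.subset_span (Or.inl (Or.inl (Or.inr ⟨_, hB.1, rfl⟩)))
    · exact Submodule.subset_span (Or.inr ⟨_, hB.2, rfl⟩)

theorem hasFDerivAt_coord (i : Fin 5) :
    HasFDerivAt (fun q : Pt => q i) (ContinuousLinearMap.proj (R := ℝ) (φ := fun _ => ℝ) i) p :=
  hasFDerivAt_apply i p

theorem hasFDerivAt_comp_coord {f : ℝ → ℝ} {f' : ℝ} (i : Fin 5) (hf : HasDerivAt f f' (p i)) :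
    HasFDerivAt (fun q : Pt => f (q i))
      (f' • ContinuousLinearMap.proj (R := ℝ) (φ := fun _ => ℝ) i) p :=
  hf.comp_hasFDerivAt p (hasFDerivAt_coord i)

theorem fderiv_vec {F : Pt → Pt} {L : Fin 5 → (Pt →L[ℝ] ℝ)}
    (h0 : HasFDerivAt (fun q => F q 0) (L 0) p) (h1 : HasFDerivAt (fun q => F q 1) (L 1) p)
    (h2 : HasFDerivAt (fun q => F q 2) (L 2) p) (h3 : HasFDerivAt (fun q => F q 3) (L 3) p)
    (h4 : HasFDerivAt (fun q => F q 4) (L 4) p) (w : Pt) :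
    fderiv ℝ F p w = ![L 0 w, L 1 w, L 2 w, L 3 w, L 4 w] := by
  have : HasFDerivAt F (ContinuousLinearMap.pi L) p := by
    rw [hasFDerivAt_pi]
    intro i
    fin_cases i <;> assumption
  rw [this.fderiv]
  apply vec_ext <;> rfl

theorem fderiv_vf (hI : IsOpen I) (hJ : IsOpen J) (hA : Smooth I A) (hB : Smooth J B)
    (hp : p ∈ strip I J) (w : Pt) :
    fderiv ℝ (vf I J A B) p w =
      ![deriv A.1 (p 0) * w 0,
        1 / 2 * deriv (deriv A.1) (p 0) * w 0 * p 1 + 1 / 2 * deriv A.1 (p 0) * w 1 +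
          deriv A.2 (p 0) * w 0,
        deriv B.1 (p 2) * w 2,
        -(1 / 2 * deriv (deriv A.1) (p 0) * w 0 * p 3 + 1 / 2 * deriv A.1 (p 0) * w 3 +
          1 / 4 * deriv (deriv (deriv A.1)) (p 0) * w 0 * p 1 +
          1 / 4 * deriv (deriv A.1) (p 0) * w 1) - 1 / 2 * deriv (deriv A.2) (p 0) * w 0,
        -(deriv (deriv B.1) (p 2) * w 2 * p 4 + deriv B.1 (p 2) * w 4) + deriv B.2 (p 2) * w 2] := by
  have hev : vf I J A B =ᶠ[𝓝 p] vfExpr A B :=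
    eventually_of_mem ((isOpen_strip hI hJ).mem_nhds hp) fun q hq => vf_of_mem hq
  have a1 := smooth_deriv hI hA.1
  have a2 := smooth_deriv hI a1
  have a3 := smooth_deriv hI hA.2
  have b1 := smooth_deriv hJ hB.1
  have d0 := hasFDerivAt_comp_coord 0 (smooth_hasDerivAt hI hA.1 hp.1)
  have d1 := hasFDerivAt_comp_coord 0 (smooth_hasDerivAt hI a1 hp.1)
  have d2 := hasFDerivAt_comp_coord 0 (smooth_hasDerivAt hI a2 hp.1)
  have d3 := hasFDerivAt_comp_coord 0 (smooth_hasDerivAt hI hA.2 hp.1)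
  have d4 := hasFDerivAt_comp_coord 0 (smooth_hasDerivAt hI a3 hp.1)
  have d5 := hasFDerivAt_comp_coord 2 (smooth_hasDerivAt hJ hB.1 hp.2)
  have d6 := hasFDerivAt_comp_coord 2 (smooth_hasDerivAt hJ b1 hp.2)
  have d7 := hasFDerivAt_comp_coord 2 (smooth_hasDerivAt hJ hB.2 hp.2)
  rw [hev.fderiv_eq, fderiv_vec (L := ![_, _, _, _, _]) d0
    (((d1.const_mul (1 / 2)).mul (hasFDerivAt_coord 1)).add d3) d5
    ((((d1.const_mul (1 / 2)).mul (hasFDerivAt_coord 3)).add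
      ((d2.const_mul (1 / 4)).mul (hasFDerivAt_coord 1))).neg.sub (d4.const_mul (1 / 2)))
    ((d6.mul (hasFDerivAt_coord 4)).neg.add d7)]
  apply vec_ext <;> simp <;> ring

/-- The two blocks commute, and each of them carries the bracket of fields with densities. -/
theorem lieBracket_vf (hI : IsOpen I) (hJ : IsOpen J) (hA₁ : Smooth I A₁) (hB₁ : Smooth J B₁)
    (hA₂ : Smooth I A₂) (hB₂ : Smooth J B₂) :
    VectorField.lieBracket ℝ (vf I J A₁ B₁) (vf I J A₂ B₂) =
      vf I J (br Side.t.wt A₁ A₂) (br Side.y.wt B₁ B₂) := by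
  refine vf_ext (fun p hp => ?_) fun p hp => ?_
  swap
  -- Off the strip both fields vanish at the point itself, so both derivatives are applied to `0`;
  -- differentiability at the boundary does not matter.
  · rw [VectorField.lieBracket, vf_of_notMem hp, vf_of_notMem hp, map_zero, map_zero, sub_zero]
  have a1 := fun t (ht : t ∈ I) => smooth_hasDerivAt hI hA₁.1 ht
  have a2 := fun t (ht : t ∈ I) => smooth_hasDerivAt hI (smooth_deriv hI hA₁.1) ht
  have a3 := smooth_hasDerivAt hI (smooth_deriv hI (smooth_deriv hI hA₁.1)) hp.1
  have a4 := smooth_hasDerivAt hI hA₁.2 hp.1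
  have a5 := smooth_hasDerivAt hI (smooth_deriv hI hA₁.2) hp.1
  have c1 := fun t (ht : t ∈ I) => smooth_hasDerivAt hI hA₂.1 ht
  have c2 := fun t (ht : t ∈ I) => smooth_hasDerivAt hI (smooth_deriv hI hA₂.1) ht
  have c3 := smooth_hasDerivAt hI (smooth_deriv hI (smooth_deriv hI hA₂.1)) hp.1
  have c4 := smooth_hasDerivAt hI hA₂.2 hp.1
  have c5 := smooth_hasDerivAt hI (smooth_deriv hI hA₂.2) hp.1
  have b1 := smooth_hasDerivAt hJ hB₁.1 hp.2
  have b2 := smooth_hasDerivAt hJ (smooth_deriv hJ hB₁.1) hp.2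
  have g1 := smooth_hasDerivAt hJ hB₂.1 hp.2
  have g2 := smooth_hasDerivAt hJ (smooth_deriv hJ hB₂.1) hp.2
  have e1 : ∀ t ∈ I, deriv (br Side.t.wt A₁ A₂).1 t = _ := fun t ht =>
    HasDerivAt.deriv (((a1 t ht).mul (c2 t ht)).sub ((c1 t ht).mul (a2 t ht)))
  have e2 : deriv (deriv (br Side.t.wt A₁ A₂).1) (p 0) = _ := deriv_of_eqOn hI e1 hp.1
    ((((a2 _ hp.1).mul (c2 _ hp.1)).add ((a1 _ hp.1).mul c3)).sub
      (((c2 _ hp.1).mul (a2 _ hp.1)).add ((c1 _ hp.1).mul a3)))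
  have e3 : deriv (br Side.t.wt A₁ A₂).2 (p 0) = _ := HasDerivAt.deriv
    ((((a1 _ hp.1).mul c5).sub (((a2 _ hp.1).const_mul Side.t.wt).mul c4)).sub
      (((c1 _ hp.1).mul a5).sub (((c2 _ hp.1).const_mul Side.t.wt).mul a4)))
  have e4 : deriv (br Side.y.wt B₁ B₂).1 (p 2) = _ :=
    HasDerivAt.deriv ((b1.mul g2).sub (g1.mul b2))
  rw [VectorField.lieBracket, vf_of_mem hp, vf_of_mem hp, fderiv_vf hI hJ hA₁ hB₁ hp,
    fderiv_vf hI hJ hA₂ hB₂ hp]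
  have e1' := e1 _ hp.1
  simp only [vfExpr, e1', e2, e3, e4]
  apply vec_ext <;> simp [br, Side.wt] <;> ring

end

/-! ### Point transformations and their action on fields. -/

section

variable {I J I' J' : Set ℝ} {A A₁ A₂ A' B B₁ B₂ B' : Pair} {p : Pt}
  {T m X Y n V₀ : ℝ → ℝ} {σ : Side} {t : ℝ}

/-- The point transformation that consists of a transformation of `(t, x, u)` and a transformation
of `(y, v)`. -/
def transf (T m X Y n V₀ : ℝ → ℝ) (p : Pt) : Pt :=
  ![T (p 0), m (p 0) * p 1 + X (p 0), Y (p 2),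
    1 / m (p 0) * p 3 - m (p 0) * deriv (deriv T) (p 0) / (4 * deriv T (p 0) ^ 2) * p 1
      - deriv X (p 0) / (2 * deriv T (p 0)),
    n (p 2) * p 4 + V₀ (p 2)]

theorem transf_eq {ε : ℝ} (hε : ε = 1 ∨ ε = -1) (h : ∀ t ∈ I, 0 < deriv T t ∧
    m t = ε * √(deriv T t)) (h' : IsMult .y J Y n) (hp : p ∈ strip I J) :
    pointTransformation ε T X Y V₀ p = transf T m X Y n V₀ p := by
  have a := h _ hp.1
  have b := h' _ hp.2
  have hs := Real.sq_sqrt a.1.le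
  have hs0 := (Real.sqrt_pos.2 a.1).ne'
  have e1 : ε / √(deriv T (p 0)) = 1 / m (p 0) := by
    rw [a.2]; rcases hε with rfl | rfl <;> field_simp
  have e2 : ε * deriv (deriv T) (p 0) / (4 * √(deriv T (p 0)) ^ 3) =
      m (p 0) * deriv (deriv T) (p 0) / (4 * deriv T (p 0) ^ 2) := by
    rw [a.2]
    have h4 : deriv T (p 0) ^ 2 = √(deriv T (p 0)) ^ 4 := by
      rw [show √(deriv T (p 0)) ^ 4 = (√(deriv T (p 0)) ^ 2) ^ 2 by ring, hs]
    rw [h4]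
    field_simp
  rw [pointTransformation, transf, ← a.2, ← b.2, e1, e2]

theorem fderiv_transf (h : IsMove .t I T m X) (h' : IsMove .y J Y n V₀) (hp : p ∈ strip I J)
    (w : Pt) : fderiv ℝ (transf T m X Y n V₀) p w =
      ![deriv T (p 0) * w 0,
        1 / 2 * m (p 0) * deriv (deriv T) (p 0) / deriv T (p 0) * w 0 * p 1 + m (p 0) * w 1 +
          deriv X (p 0) * w 0,
        deriv Y (p 2) * w 2,
        -(1 / 2 * deriv (deriv T) (p 0) / (m (p 0) * deriv T (p 0))) * w 0 * p 3 +
          1 / m (p 0) * w 3 -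
          (m (p 0) * deriv (deriv (deriv T)) (p 0) / (4 * deriv T (p 0) ^ 2) -
            3 * m (p 0) * deriv (deriv T) (p 0) ^ 2 / (8 * deriv T (p 0) ^ 3)) * w 0 * p 1 -
          m (p 0) * deriv (deriv T) (p 0) / (4 * deriv T (p 0) ^ 2) * w 1 -
          (deriv (deriv X) (p 0) / (2 * deriv T (p 0)) -
            deriv X (p 0) * deriv (deriv T) (p 0) / (2 * deriv T (p 0) ^ 2)) * w 0,
        -(n (p 2) * deriv (deriv Y) (p 2) / deriv Y (p 2)) * w 2 * p 4 + n (p 2) * w 4 +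
          deriv V₀ (p 2) * w 2] := by
  have hI := h.interval.1
  have hJ := h'.interval.1
  have s1 := smooth_deriv hI h.smoothT
  have s2 := smooth_deriv hI s1
  have s3 := smooth_deriv hI h.smoothX
  have hd := h.mult.deriv_ne_zero hp.1
  have hd' := h'.mult.deriv_ne_zero hp.2
  have hm := h.mult.ne_zero hp.1
  have d0 := hasFDerivAt_comp_coord 0 (smooth_hasDerivAt hI h.smoothT hp.1)
  have dm := hasFDerivAt_comp_coord 0 (h.mult.hasDerivAt hI h.smoothT hp.1)
  have dX := hasFDerivAt_comp_coord 0 (smooth_hasDerivAt hI h.smoothX hp.1)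
  have dY := hasFDerivAt_comp_coord 2 (smooth_hasDerivAt hJ h'.smoothT hp.2)
  have dn := hasFDerivAt_comp_coord 2 (h'.mult.hasDerivAt hJ h'.smoothT hp.2)
  have dV := hasFDerivAt_comp_coord 2 (smooth_hasDerivAt hJ h'.smoothX hp.2)
  have e1 := hasFDerivAt_comp_coord 0 ((hasDerivAt_const (p 0) (1 : ℝ)).div
    (h.mult.hasDerivAt hI h.smoothT hp.1) hm)
  have e2 := hasFDerivAt_comp_coord 0 (((h.mult.hasDerivAt hI h.smoothT hp.1).mul
    (smooth_hasDerivAt hI s2 hp.1)).div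
    (((smooth_hasDerivAt hI s1 hp.1).pow 2).const_mul 4)
    (mul_ne_zero four_ne_zero (pow_ne_zero 2 hd)))
  have e3 := hasFDerivAt_comp_coord 0 ((smooth_hasDerivAt hI s3 hp.1).div
    ((smooth_hasDerivAt hI s1 hp.1).const_mul 2) (mul_ne_zero two_ne_zero hd))
  rw [fderiv_vec (L := ![_, _, _, _, _]) d0 ((dm.mul (hasFDerivAt_coord 1)).add dX) dY
    (((e1.mul (hasFDerivAt_coord 3)).sub (e2.mul (hasFDerivAt_coord 1))).sub e3)
    ((dn.mul (hasFDerivAt_coord 4)).add dV)]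
  apply vec_ext
  · simp
  · simp [Side.wt]; field_simp; ring
  · simp
  · simp [Side.wt]; field_simp; ring
  · simp [Side.wt]; field_simp; ring

theorem Push.deriv_deriv_fst (h : IsMove σ I T m X) (hA : Smooth I A) (hP : Push σ I T m X A B)
    (ht : t ∈ I) : deriv (deriv B.1) (T t) = deriv (pushDeriv T A) t / deriv T t := by
  have hO := h.interval.1
  have hB := hP.smooth h hA
  have hd := h.mult.deriv_ne_zero ht
  have e1 := (smooth_hasDerivAt h.image.1 (smooth_deriv h.image.1 hB.1)
    (mem_image_of_mem T ht)).comp t (smooth_hasDerivAt hO h.smoothT ht)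
  have e3 : deriv (deriv B.1 ∘ T) t = _ := deriv_of_eqOn hO (fun t ht => hP.deriv_fst h hA ht) ht
    (smooth_hasDerivAt hO (pushDeriv_smooth h hA) ht)
  rw [e1.deriv] at e3
  rw [eq_div_iff hd, e3]

/-- The components along `t`, `x`, `y` are the defining formulas of `Push` and their first
derivative. The `u` component involves derivatives of these formulas and closes up through `m ^ 2 =
T'`, the `v` component through `n = 1 / Y'`. -/
theorem Push.isPushforward (h : IsMove .t I T m X) (h' : IsMove .y J Y n V₀) (hA : Smooth I A)
    (hB : Smooth J B) (hP : Push .t I T m X A A') (hP' : Push .y J Y n V₀ B B')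
    (hp : p ∈ strip I J) : vfExpr A' B' (transf T m X Y n V₀ p) =
      fderiv ℝ (transf T m X Y n V₀) p (vfExpr A B p) := by
  have hd := h.mult.deriv_ne_zero hp.1
  have hd' := h'.mult.deriv_ne_zero hp.2
  have hm := h.mult.ne_zero hp.1
  have hm2 : m (p 0) ^ 2 = deriv T (p 0) := by
    obtain ⟨ε, hε, h⟩ := h.mult
    rw [(h _ hp.1).2, mul_pow, Real.sq_sqrt (h _ hp.1).1.le]
    rcases hε with rfl | rfl <;> norm_num
  have hn := (h'.mult _ hp.2).2
  rw [fderiv_transf h h' hp]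
  simp only [vfExpr]
  apply vec_ext
  · simp [transf, (hP _ hp.1).1]
  · simp [transf, (hP _ hp.1).2, hP.deriv_fst h hA hp.1, pushDeriv, Side.wt]
    field_simp
    ring
  · simp [transf, (hP' _ hp.2).1]
  · simp [transf, hP.deriv_fst h hA hp.1, hP.deriv_deriv_fst h hA hp.1, hP.deriv_snd h hA hp.1,
      (pushDeriv_hasDerivAt h hA hp.1).deriv, pushDeriv, Side.wt]
    rw [← hm2]
    field_simp
    ring
  · simp [transf, (hP' _ hp.2).2, hP'.deriv_fst h' hB hp.2, pushDeriv, Side.wt, hn]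
    field_simp
    ring

/-- The pair supplied by `exists_push` produces the same field on the image, and a pair can be
recovered from the values of its field at the images of the points with `x = u = v = 0`. -/
theorem push_of_isPushforward (h : IsMove .t I T m X) (h' : IsMove .y J Y n V₀) (hA : Smooth I A)
    (hB : Smooth J B)
    (hV : ∀ p ∈ strip I J, vfExpr A' B' (transf T m X Y n V₀ p) =
      fderiv ℝ (transf T m X Y n V₀) p (vfExpr A B p)) :
    Push .t I T m X A A' ∧ Push .y J Y n V₀ B B' := by
  obtain ⟨A'', sA, pA⟩ := h.exists_push hA
  obtain ⟨B'', sB, pB⟩ := h'.exists_push hB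
  have key : ∀ p ∈ strip I J, vfExpr A' B' (transf T m X Y n V₀ p) =
      vfExpr A'' B'' (transf T m X Y n V₀ p) := fun p hp => by
    rw [hV p hp, pA.isPushforward h h' hA hB pB hp]
  obtain ⟨t₀, ht₀⟩ := h.interval.2.2
  obtain ⟨y₀, hy₀⟩ := h'.interval.2.2
  have a1 : ∀ s ∈ T '' I, A''.1 s = A'.1 s := by
    rintro _ ⟨t, ht, rfl⟩
    have := congr_fun (key ![t, 0, y₀, 0, 0] ⟨ht, hy₀⟩) 0
    simpa [vfExpr, transf] using this.symm
  have b1 : ∀ s ∈ Y '' J, B''.1 s = B'.1 s := by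
    rintro _ ⟨y, hy, rfl⟩
    have := congr_fun (key ![t₀, 0, y, 0, 0] ⟨ht₀, hy⟩) 2
    simpa [vfExpr, transf] using this.symm
  refine ⟨pA.congr_right fun s hs => ⟨a1 s hs, ?_⟩, pB.congr_right fun s hs => ⟨b1 s hs, ?_⟩⟩
  · obtain ⟨t, ht, rfl⟩ := hs
    have := congr_fun (key ![t, 0, y₀, 0, 0] ⟨ht, hy₀⟩) 1
    have e := deriv_congr_on h.image.1 a1 (mem_image_of_mem T ht)
    simp [vfExpr, transf] at this
    rw [e] at this
    linear_combination -this
  · obtain ⟨y, hy, rfl⟩ := hs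
    have := congr_fun (key ![t₀, 0, y, 0, 0] ⟨ht₀, hy⟩) 4
    have e := deriv_congr_on h'.image.1 b1 (mem_image_of_mem Y hy)
    simp [vfExpr, transf] at this
    rw [e] at this
    linear_combination -this

end

/-! ### The listed algebras are as claimed. -/

section

variable {I J I' J' : Set ℝ} {A A₁ A₂ A' B B₁ B₂ B' : Pair} {p : Pt}
  {T m X Y n V₀ : ℝ → ℝ} {σ : Side} {t : ℝ} {g β : ℝ → ℝ} {Φ : Pt → Pt}

/-- The components of the basis elements of the listed algebras. -/
def Label.comps (g β : ℝ → ℝ) : Label → (Pair × Pair) × (Pair × Pair)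
  | .s1 => ((cp 1 0, cp 1 0), (lp 1, lp 1))
  | .s2 δ => ((cp 1 0, cp 0 δ.val), (lp 1, lp (-1)))
  | .s3 δ => ((cp 1 0, cp 0 0), (lp 1, cp 0 δ.val))
  | .s4 δ => ((cp 0 (-δ.val), cp 1 0), (lp 2, lp 1))
  | .s5 δ => ((cp 0 0, cp 1 0), (cp 0 δ.val, lp 1))
  | .s6 δ δ' => ((cp 0 δ.val, cp 0 δ'.val), (lp 2, lp (-1)))
  | .s7 δ => ((cp 0 1, cp 0 0), (lp 2, cp 0 δ.val))
  | .s8 δ => ((cp 0 0, cp 0 1), (cp 0 δ.val, lp (-1)))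
  | .s9 δ δ' => ((cp 1 0, cp 0 δ.val), (cp 0 (-δ'.val), cp 1 0))
  | .s10 δ δ' => ((cp 1 0, cp 1 0), (cp 0 δ.val, cp 0 δ'.val))
  | .s11 δ => ((cp 1 0, (fun _ => 0, β)), (cp 0 δ.val, cp 0 1))
  | .s12 δ => ((cp 1 0, cp 0 δ.val), (cp 0 1, cp 0 0))
  | .s13 δ => (((fun _ => 0, g), cp 1 0), (cp 0 1, cp 0 δ.val))
  | .s14 δ => ((cp 0 (-δ.val), cp 1 0), (cp 0 0, cp 0 1))
  | .s15 => ((cp 0 1, cp 0 0), (cp 0 0, cp 0 1))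
  | .s16 δ => ((cp 0 1, cp 0 δ.val), ((fun _ => 0, g), cp 0 0))
  | .s17 δ => ((cp 0 δ.val, cp 0 1), (cp 0 0, (fun _ => 0, β)))
  | .s18 => ((cp 0 1, cp 0 1), ((fun _ => 0, g), (fun _ => 0, β)))

theorem D_zero : D I J (fun _ => 0) = 0 := by
  rw [D, ← map_zero (restrictTo (strip I J))]
  congr 1
  funext p
  apply vec_ext <;> simp

theorem P_zero : P I J (fun _ => 0) = 0 := by
  rw [P, ← map_zero (restrictTo (strip I J))]
  congr 1
  funext p
  apply vec_ext <;> simp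

theorem S_zero : S I J (fun _ => 0) = 0 := by
  rw [S, ← map_zero (restrictTo (strip I J))]
  congr 1
  funext p
  apply vec_ext <;> simp

theorem Z_zero : Z I J (fun _ => 0) = 0 := by
  rw [Z, ← map_zero (restrictTo (strip I J))]
  congr 1
  funext p
  apply vec_ext <;> simp

theorem P_neg_const (c : ℝ) : P I J (fun _ => -c) = -P I J fun _ => c := by
  rw [P, P, ← map_neg]
  congr 1
  funext p
  apply vec_ext <;> simp

theorem S_neg_id : S I J (fun y => -y) = -S I J fun y => y := by
  rw [S, S, ← map_neg]
  congr 1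
  funext p
  apply vec_ext <;> simp

theorem Label.basis_eq (l : Label) : l.basis I J g β =
    (vf I J (l.comps g β).1.1 (l.comps g β).1.2, vf I J (l.comps g β).2.1 (l.comps g β).2.2) := by
  have h1 : const 1 = fun _ => (1 : ℝ) := by funext; simp [const]
  have h2 : ∀ δ : Fin 2, const δ = fun _ => (δ.val : ℝ) := fun _ => rfl
  simp only [vf_eq]
  cases l <;> simp only [Label.basis, Label.comps, cp, lp, h1] <;>
    simp only [D_zero, P_zero, S_zero, Z_zero, P_neg_const, S_neg_id, add_zero, zero_add, one_mul,
      neg_one_mul, sub_eq_add_neg, h2, Prod.mk.injEq, and_true, true_and]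
  all_goals exact add_comm _ _

theorem Label.comps_smooth (l : Label) (h : l.Admissible I J g β) :
    (Smooth I (l.comps g β).1.1 ∧ Smooth J (l.comps g β).1.2) ∧
      (Smooth I (l.comps g β).2.1 ∧ Smooth J (l.comps g β).2.2) := by
  have hc := fun (I : Set ℝ) (a b : ℝ) => smooth_cp (I := I) a b
  have hl := fun (I : Set ℝ) (k : ℝ) => smooth_lp (I := I) k
  have hz : ∀ {I : Set ℝ} {f : ℝ → ℝ}, ContDiffOn ℝ ∞ f I → Smooth I (fun _ => 0, f) :=
    fun h => ⟨contDiffOn_const, h⟩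
  cases l <;> simp only [Label.Admissible] at h <;>
    simp only [Label.comps, hc, hl, and_self, and_true, true_and]
  · exact hz h
  · exact hz h
  · exact hz h.1
  · exact hz h.1
  · exact ⟨hz h.1.1, hz h.2.1⟩

theorem Label.comps_bracket (l : Label) :
    (¬ l.InAbelianPart →
      Agree I (br Side.t.wt (l.comps g β).1.1 (l.comps g β).2.1) (l.comps g β).1.1 ∧
      Agree J (br Side.y.wt (l.comps g β).1.2 (l.comps g β).2.2) (l.comps g β).1.2) ∧
    (l.InAbelianPart →
      Agree I (br Side.t.wt (l.comps g β).1.1 (l.comps g β).2.1) (cp 0 0) ∧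
      Agree J (br Side.y.wt (l.comps g β).1.2 (l.comps g β).2.2) (cp 0 0)) := by
  have hd : ∀ (k t : ℝ), deriv (fun t => k * t) t = k := fun k t => by simp
  cases l <;> simp [Label.InAbelianPart, Label.comps, br, cp, lp, Side.wt, Agree]

/-- No nontrivial combination of the two fields vanishes over smaller intervals. -/
def Indep (I J : Set ℝ) (A₁ B₁ A₂ B₂ : Pair) : Prop :=
  ∀ a b : ℝ, (∃ I₀ ⊆ I, IsOpenInterval I₀ ∧ Agree I₀ (a • A₁ + b • A₂) (cp 0 0)) →
    (∃ J₀ ⊆ J, IsOpenInterval J₀ ∧ Agree J₀ (a • B₁ + b • B₂) (cp 0 0)) → a = 0 ∧ b = 0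

theorem IsOpenInterval.exists_ne (hI : IsOpenInterval I) : ∃ s ∈ I, ∃ t ∈ I, s ≠ t := by
  obtain ⟨t, ht⟩ := hI.2.2
  obtain ⟨r, hr, hb⟩ := Metric.isOpen_iff.1 hI.1 t ht
  refine ⟨t, ht, t + r / 2, hb ?_, by linarith⟩
  rw [Metric.mem_ball, Real.dist_eq, add_sub_cancel_left, abs_of_pos] <;> linarith

theorem NowhereConstantOn.coeff (h : NowhereConstantOn g I) (hI : I' ⊆ I) (hI' : IsOpenInterval I')
    {a b : ℝ} (h0 : ∀ t ∈ I', a + b * g t = 0) : a = 0 ∧ b = 0 := by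
  have hb : b = 0 := by
    by_contra hb
    exact h I' hI hI' ⟨-a / b, fun t ht => by rw [eq_div_iff hb]; linarith [h0 t ht]⟩
  obtain ⟨t, ht⟩ := hI'.2.2
  have := h0 t ht
  rw [hb] at this
  exact ⟨by linarith, hb⟩

theorem Label.indep (l : Label) (h : l.Admissible I J g β) :
    Indep I J (l.comps g β).1.1 (l.comps g β).1.2 (l.comps g β).2.1 (l.comps g β).2.2 := by
  rintro a b ⟨I₀, hI, hI₀, hA⟩ ⟨J₀, hJ, hJ₀, hB⟩
  -- Two distinct points separate constant from linear components; only the families `s16`, `s17`,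
  -- `s18` need the nowhere constant parameters.
  obtain ⟨s, hs, t, ht, hst⟩ := hI₀.exists_ne
  obtain ⟨y, hy, z, hz, hyz⟩ := hJ₀.exists_ne
  have a1 := hA s hs
  have a2 := hA t ht
  have b1 := hB y hy
  have b2 := hB z hz
  simp only [lin_fst, lin_snd] at a1 a2 b1 b2
  cases l with
  | s16 δ =>
    refine h.2.coeff hI hI₀ fun t ht => ?_
    have := (hA t ht).2
    simpa [lin_snd, Label.comps, cp] using this
  | s17 δ =>
    refine h.2.coeff hJ hJ₀ fun t ht => ?_
    have := (hB t ht).2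
    simpa [lin_snd, Label.comps, cp] using this
  | s18 =>
    refine h.1.2.coeff hI hI₀ fun t ht => ?_
    have := (hA t ht).2
    simpa [lin_snd, Label.comps, cp] using this
  | s6 δ δ' =>
    simp only [Label.comps, cp, lp] at a1 a2 b1 b2
    have hb : b = 0 := by grind
    subst hb
    have : (δ.val : ℝ) ≠ 0 ∨ (δ'.val : ℝ) ≠ 0 := by
      revert h; fin_cases δ <;> fin_cases δ' <;> simp [Label.Admissible]
    grind
  | s10 δ δ' =>
    simp only [Label.comps, cp] at a1 a2 b1 b2
    have : (δ.val : ℝ) ≠ 0 ∨ (δ'.val : ℝ) ≠ 0 := by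
      revert h; fin_cases δ <;> fin_cases δ' <;> simp [Label.Admissible]
    grind
  | _ =>
    simp only [Label.comps, cp, lp] at a1 a2 b1 b2
    grind

theorem vf_eq_zero (hI : IsOpenInterval I) (hJ : IsOpenInterval J)
    (h : ∀ p ∈ strip I J, vfExpr A B p = 0) : Agree I A (cp 0 0) ∧ Agree J B (cp 0 0) := by
  obtain ⟨t₀, ht₀⟩ := hI.2.2
  obtain ⟨y₀, hy₀⟩ := hJ.2.2
  constructor
  · intro t ht
    have e := h ![t, 0, y₀, 0, 0] ⟨ht, hy₀⟩
    have e0 := congr_fun e 0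
    have e1 := congr_fun e 1
    simp [vfExpr] at e0 e1
    exact ⟨e0, e1⟩
  · intro y hy
    have e := h ![t₀, 0, y, 0, 0] ⟨ht₀, hy⟩
    have e0 := congr_fun e 2
    have e1 := congr_fun e 4
    simp [vfExpr] at e0 e1
    exact ⟨e0, e1⟩

/-- The space spanned by two fields. -/
def span2 (I J : Set ℝ) (A₁ B₁ A₂ B₂ : Pair) : Submodule ℝ (Pt → Pt) :=
  Submodule.span ℝ {vf I J A₁ B₁, vf I J A₂ B₂}

theorem Label.algebra_eq (l : Label) : l.algebra I J g β =
    span2 I J (l.comps g β).1.1 (l.comps g β).1.2 (l.comps g β).2.1 (l.comps g β).2.2 := by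
  rw [Label.algebra, Label.basis_eq, span2]

theorem mem_span2 (hI : IsOpenInterval I) (hJ : IsOpenInterval J)
    (hA₁ : Smooth I A₁) (hB₁ : Smooth J B₁) (hA₂ : Smooth I A₂) (hB₂ : Smooth J B₂)
    {V : Pt → Pt} : V ∈ span2 I J A₁ B₁ A₂ B₂ ↔
    ∃ a b : ℝ, V = vf I J (a • A₁ + b • A₂) (a • B₁ + b • B₂) := by
  rw [span2, Submodule.mem_span_pair]
  simp only [← vf_lin hI.1 hJ.1 hA₁ hA₂ hB₁ hB₂, eq_comm]

theorem span2_linearIndependent (hI : IsOpenInterval I) (hJ : IsOpenInterval J)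
    (hA₁ : Smooth I A₁) (hB₁ : Smooth J B₁) (hA₂ : Smooth I A₂) (hB₂ : Smooth J B₂)
    (h : Indep I J A₁ B₁ A₂ B₂) :
    LinearIndependent ℝ ![vf I J A₁ B₁, vf I J A₂ B₂] := by
  rw [LinearIndependent.pair_iff]
  intro a b hab
  rw [vf_lin hI.1 hJ.1 hA₁ hA₂ hB₁ hB₂] at hab
  have := vf_eq_zero hI hJ (A := a • A₁ + b • A₂) (B := a • B₁ + b • B₂) fun p hp => by
    rw [← vf_of_mem hp, hab]; rfl
  exact h a b ⟨I, Subset.rfl, hI, this.1⟩ ⟨J, Subset.rfl, hJ, this.2⟩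

theorem finrank_span2 (hI : IsOpenInterval I) (hJ : IsOpenInterval J)
    (hA₁ : Smooth I A₁) (hB₁ : Smooth J B₁) (hA₂ : Smooth I A₂) (hB₂ : Smooth J B₂)
    (h : Indep I J A₁ B₁ A₂ B₂) :
    Module.finrank ℝ (span2 I J A₁ B₁ A₂ B₂) = 2 := by
  have := finrank_span_eq_card (span2_linearIndependent hI hJ hA₁ hB₁ hA₂ hB₂ h)
  rwa [Matrix.range_cons, Matrix.range_cons, Matrix.range_empty, union_empty,
    singleton_union, Fintype.card_fin] at this

theorem restrictsFaithfully_span2 (hI : IsOpenInterval I) (hJ : IsOpenInterval J)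
    (hA₁ : Smooth I A₁) (hB₁ : Smooth J B₁) (hA₂ : Smooth I A₂) (hB₂ : Smooth J B₂)
    (h : Indep I J A₁ B₁ A₂ B₂) :
    RestrictsFaithfully I J (span2 I J A₁ B₁ A₂ B₂) := by
  intro I' hI' J' hJ' hI'' hJ'' V hV hV0
  obtain ⟨a, b, rfl⟩ := (mem_span2 hI hJ hA₁ hB₁ hA₂ hB₂).1 hV
  by_contra hcon
  push Not at hcon
  have := vf_eq_zero hI'' hJ'' (A := a • A₁ + b • A₂) (B := a • B₁ + b • B₂) fun p hp => by
    rw [← vf_of_mem (I := I) (J := J) ⟨hI' hp.1, hJ' hp.2⟩, hcon p hp]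
  obtain ⟨rfl, rfl⟩ := h a b ⟨I', hI', hI'', this.1⟩ ⟨J', hJ', hJ'', this.2⟩
  apply hV0
  rw [← vf_lin hI.1 hJ.1 hA₁ hA₂ hB₁ hB₂]
  simp

/-- This is what faithful restriction contributes to the classification: linear independence becomes
independence over all smaller intervals. -/
theorem indep_of_restrictsFaithfully (hI : IsOpenInterval I) (hJ : IsOpenInterval J)
    (hA₁ : Smooth I A₁) (hB₁ : Smooth J B₁) (hA₂ : Smooth I A₂) (hB₂ : Smooth J B₂)
    (h : RestrictsFaithfully I J (span2 I J A₁ B₁ A₂ B₂))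
    (hli : LinearIndependent ℝ ![vf I J A₁ B₁, vf I J A₂ B₂]) : Indep I J A₁ B₁ A₂ B₂ := by
  rintro a b ⟨I', hI', hI'', hA⟩ ⟨J', hJ', hJ'', hB⟩
  rw [LinearIndependent.pair_iff] at hli
  apply hli
  by_contra hne
  obtain ⟨p, hp, hp0⟩ := h I' hI' J' hJ' hI'' hJ'' _
    ((mem_span2 hI hJ hA₁ hB₁ hA₂ hB₂).2 ⟨a, b, vf_lin hI.1 hJ.1 hA₁ hA₂ hB₁ hB₂ a b⟩) hne
  apply hp0
  rw [vf_lin hI.1 hJ.1 hA₁ hA₂ hB₁ hB₂, vf_of_mem ⟨hI' hp.1, hJ' hp.2⟩, ← vf_of_mem hp,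
    agree_vf hI''.1 hJ''.1 hA hB, vf_zero]
  rfl

theorem lieBracket_span2 (hI : IsOpenInterval I) (hJ : IsOpenInterval J)
    (hA₁ : Smooth I A₁) (hB₁ : Smooth J B₁) (hA₂ : Smooth I A₂) (hB₂ : Smooth J B₂)
    (a b c d : ℝ) :
    VectorField.lieBracket ℝ (vf I J (a • A₁ + b • A₂) (a • B₁ + b • B₂))
      (vf I J (c • A₁ + d • A₂) (c • B₁ + d • B₂)) =
    (a * d - b * c) • VectorField.lieBracket ℝ (vf I J A₁ B₁) (vf I J A₂ B₂) := by
  rw [lieBracket_vf hI.1 hJ.1 hA₁ hB₁ hA₂ hB₂, lieBracket_vf hI.1 hJ.1 (hA₁.lin hA₂ a b)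
    (hB₁.lin hB₂ a b) (hA₁.lin hA₂ c d) (hB₁.lin hB₂ c d)]
  have s1 := br_smooth hI.1 Side.t.wt hA₁ hA₂
  have s2 := br_smooth hJ.1 Side.y.wt hB₁ hB₂
  have := vf_lin hI.1 hJ.1 s1 s1 s2 s2 (a * d - b * c) 0
  rw [zero_smul, add_zero] at this
  rw [this]
  refine agree_vf hI.1 hJ.1 (fun t ht => ?_) fun t ht => ?_
  · simpa [lin_fst, lin_snd] using br_lin hI.1 Side.t.wt hA₁ hA₂ a b c d ht
  · simpa [lin_fst, lin_snd] using br_lin hJ.1 Side.y.wt hB₁ hB₂ a b c d ht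

theorem Label.isTwoDimSubalgebra (hI : IsOpenInterval I) (hJ : IsOpenInterval J) (l : Label)
    (h : l.Admissible I J g β) :
    IsTwoDimSubalgebra I J (l.algebra I J g β) ∧ RestrictsFaithfully I J (l.algebra I J g β) ∧
      (IsAbelian (l.algebra I J g β) ↔ l.InAbelianPart) := by
  obtain ⟨⟨hA₁, hB₁⟩, hA₂, hB₂⟩ := l.comps_smooth h
  have hind := l.indep h
  have hbr := l.comps_bracket (I := I) (J := J) (g := g) (β := β)
  rw [l.algebra_eq]
  generalize l.comps g β = q at *
  obtain ⟨⟨A₁, B₁⟩, A₂, B₂⟩ := q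
  simp only at *
  have hmem := fun V => mem_span2 hI hJ hA₁ hB₁ hA₂ hB₂ (V := V)
  have hbr0 := lieBracket_vf hI.1 hJ.1 hA₁ hB₁ hA₂ hB₂
  have hbr1 : ¬ l.InAbelianPart →
      VectorField.lieBracket ℝ (vf I J A₁ B₁) (vf I J A₂ B₂) = vf I J A₁ B₁ := fun hl => by
    rw [hbr0, agree_vf hI.1 hJ.1 (hbr.1 hl).1 (hbr.1 hl).2]
  have hbr2 : l.InAbelianPart →
      VectorField.lieBracket ℝ (vf I J A₁ B₁) (vf I J A₂ B₂) = 0 := fun hl => by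
    rw [hbr0, agree_vf hI.1 hJ.1 (hbr.2 hl).1 (hbr.2 hl).2, vf_zero]
  refine ⟨⟨?_, finrank_span2 hI hJ hA₁ hB₁ hA₂ hB₂ hind, ?_⟩,
    restrictsFaithfully_span2 hI hJ hA₁ hB₁ hA₂ hB₂ hind, ?_⟩
  · intro V hV
    obtain ⟨a, b, rfl⟩ := (hmem _).1 hV
    exact (mem_symAlgebra hI.1 hJ.1).2 ⟨_, _, hA₁.lin hA₂ a b, hB₁.lin hB₂ a b, rfl⟩
  · intro V hV W hW
    obtain ⟨a, b, rfl⟩ := (hmem _).1 hV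
    obtain ⟨c, d, rfl⟩ := (hmem _).1 hW
    rw [lieBracket_span2 hI hJ hA₁ hB₁ hA₂ hB₂]
    refine Submodule.smul_mem _ _ ?_
    by_cases hl : l.InAbelianPart
    · rw [hbr2 hl]; exact zero_mem _
    · rw [hbr1 hl]; exact Submodule.subset_span (mem_insert _ _)
  · constructor
    · intro hab
      by_contra hl
      have h1 := hab _ (Submodule.subset_span (mem_insert _ _)) _
        (Submodule.subset_span (mem_insert_of_mem _ rfl))
      rw [hbr1 hl] at h1
      exact (span2_linearIndependent hI hJ hA₁ hB₁ hA₂ hB₂ hind).ne_zero 0 h1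
    · intro hl V hV W hW
      obtain ⟨a, b, rfl⟩ := (hmem _).1 hV
      obtain ⟨c, d, rfl⟩ := (hmem _).1 hW
      rw [lieBracket_span2 hI hJ hA₁ hB₁ hA₂ hB₂, hbr2 hl, smul_zero]

end

/-! ### Equivalence expressed through pairs. -/

section

variable {I J I' J' : Set ℝ} {A A₁ A₂ A' A₁' A₂' B B₁ B₂ B' B₁' B₂' : Pair} {p : Pt}
  {T m X Y n V₀ : ℝ → ℝ} {σ : Side} {t : ℝ} {g β : ℝ → ℝ} {Φ : Pt → Pt}

theorem vf_inj (hI : IsOpenInterval I) (hJ : IsOpenInterval J)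
    (h : vf I J A B = vf I J A' B') : Agree I A A' ∧ Agree J B B' := by
  obtain ⟨t₀, ht₀⟩ := hI.2.2
  obtain ⟨y₀, hy₀⟩ := hJ.2.2
  have h' : ∀ p ∈ strip I J, vfExpr A B p = vfExpr A' B' p := fun p hp => by
    rw [← vf_of_mem hp, ← vf_of_mem hp, h]
  constructor
  · intro t ht
    have e := h' ![t, 0, y₀, 0, 0] ⟨ht, hy₀⟩
    have e0 := congr_fun e 0
    have e1 := congr_fun e 1
    simp [vfExpr] at e0 e1
    exact ⟨e0, e1⟩
  · intro y hy
    have e := h' ![t₀, 0, y, 0, 0] ⟨ht₀, hy⟩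
    have e0 := congr_fun e 2
    have e1 := congr_fun e 4
    simp [vfExpr] at e0 e1
    exact ⟨e0, e1⟩

/-- `Φ` is given over the strip by a transformation of `(t, x, u)` and one of `(y, v)`. -/
structure Represents (I J : Set ℝ) (Φ : Pt → Pt) (T m X Y n V₀ : ℝ → ℝ) : Prop where
  moveT : IsMove .t I T m X
  moveY : IsMove .y J Y n V₀
  apply : ∀ p ∈ strip I J, Φ p = transf T m X Y n V₀ p

theorem Represents.fderiv_eq (h : Represents I J Φ T m X Y n V₀) (hp : p ∈ strip I J) :
    fderiv ℝ Φ p = fderiv ℝ (transf T m X Y n V₀) p :=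
  Filter.EventuallyEq.fderiv_eq (eventually_of_mem
    ((isOpen_strip h.moveT.interval.1 h.moveY.interval.1).mem_nhds hp) h.apply)

theorem Represents.mem (h : Represents I J Φ T m X Y n V₀) (hp : p ∈ strip I J) :
    Φ p ∈ strip (T '' I) (Y '' J) := by
  rw [h.apply p hp]
  exact ⟨mem_image_of_mem T hp.1, mem_image_of_mem Y hp.2⟩

theorem InPseudogroup.represents (hI : IsOpenInterval I) (hJ : IsOpenInterval J)
    (h : InPseudogroup I J I' J' Φ) : ∃ T m X Y n V₀, Represents I J Φ T m X Y n V₀ ∧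
      T '' I = I' ∧ Y '' J = J' := by
  obtain ⟨ε, T, X, Y, V₀, hε, hT, hX, hY, hV, hTp, hYp, h1, h2, rfl⟩ := h
  exact ⟨T, fun t => ε * √(deriv T t), X, Y, fun y => 1 / deriv Y y, V₀,
    ⟨⟨hI, hT, hX, ε, hε, fun t ht => ⟨hTp t ht, rfl⟩⟩, ⟨hJ, hY, hV, fun y hy => ⟨hYp y hy, rfl⟩⟩,
      fun p hp => transf_eq hε (fun t ht => ⟨hTp t ht, rfl⟩) (fun y hy => ⟨hYp y hy, rfl⟩) hp⟩,
    h1, h2⟩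

theorem exists_inPseudogroup (h : IsMove .t I T m X) (h' : IsMove .y J Y n V₀) :
    ∃ Φ, InPseudogroup I J (T '' I) (Y '' J) Φ ∧ Represents I J Φ T m X Y n V₀ := by
  obtain ⟨ε, hε, hm⟩ := h.mult
  exact ⟨_, ⟨ε, T, X, Y, V₀, hε, h.smoothT, h.smoothX, h'.smoothT, h'.smoothX,
    fun t ht => (hm t ht).1, fun y hy => (h'.mult y hy).1, rfl, rfl, rfl⟩,
    ⟨h, h', fun p hp => transf_eq hε hm h'.mult hp⟩⟩

/-- The dictionary that reduces equivalence in five variables to separate transformations of the two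
blocks. -/
theorem Represents.isPushforward_iff (h : Represents I J Φ T m X Y n V₀) (hA : Smooth I A)
    (hB : Smooth J B) :
    IsPushforward Φ (strip I J) (vf I J A B) (vf (T '' I) (Y '' J) A' B') ↔
      Push .t I T m X A A' ∧ Push .y J Y n V₀ B B' := by
  have key : IsPushforward Φ (strip I J) (vf I J A B) (vf (T '' I) (Y '' J) A' B') ↔
      ∀ p ∈ strip I J, vfExpr A' B' (transf T m X Y n V₀ p) =
        fderiv ℝ (transf T m X Y n V₀) p (vfExpr A B p) := by
    refine forall₂_congr fun p hp => ?_
    rw [h.fderiv_eq hp, vf_of_mem (h.mem hp), vf_of_mem hp, h.apply p hp]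
  rw [key]
  exact ⟨push_of_isPushforward h.moveT h.moveY hA hB,
    fun hP p hp => hP.1.isPushforward h.moveT h.moveY hA hB hP.2 hp⟩

theorem IsPushforward.lin {Ω : Set Pt} {V₁ V₂ W₁ W₂ : Pt → Pt} (h₁ : IsPushforward Φ Ω V₁ W₁)
    (h₂ : IsPushforward Φ Ω V₂ W₂) (a b : ℝ) :
    IsPushforward Φ Ω (a • V₁ + b • V₂) (a • W₁ + b • W₂) := by
  intro p hp
  simp [h₁ p hp, h₂ p hp]

theorem gEquivalent_span2 (h : IsMove .t I T m X) (h' : IsMove .y J Y n V₀)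
    (hA₁ : Smooth I A₁) (hB₁ : Smooth J B₁) (hA₂ : Smooth I A₂) (hB₂ : Smooth J B₂)
    (p₁ : Push .t I T m X A₁ A₁') (p₂ : Push .t I T m X A₂ A₂')
    (q₁ : Push .y J Y n V₀ B₁ B₁') (q₂ : Push .y J Y n V₀ B₂ B₂') :
    GEquivalent I J (span2 I J A₁ B₁ A₂ B₂) (T '' I) (Y '' J)
      (span2 (T '' I) (Y '' J) A₁' B₁' A₂' B₂') := by
  obtain ⟨Φ, hΦ, hr⟩ := exists_inPseudogroup h h'
  have r₁ := (hr.isPushforward_iff hA₁ hB₁).2 ⟨p₁, q₁⟩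
  have r₂ := (hr.isPushforward_iff hA₂ hB₂).2 ⟨p₂, q₂⟩
  refine ⟨Φ, hΦ, fun V hV => ?_, fun W hW => ?_⟩
  · obtain ⟨a, b, rfl⟩ := Submodule.mem_span_pair.1 hV
    exact ⟨_, Submodule.mem_span_pair.2 ⟨a, b, rfl⟩, r₁.lin r₂ a b⟩
  · obtain ⟨a, b, rfl⟩ := Submodule.mem_span_pair.1 hW
    exact ⟨_, Submodule.mem_span_pair.2 ⟨a, b, rfl⟩, r₁.lin r₂ a b⟩

/-- The space spanned by the two fields is locally equivalent to a listed algebra. -/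
def Good (I J : Set ℝ) (A₁ B₁ A₂ B₂ : Pair) : Prop :=
  ∃ a b c d : ℝ, a * d - b * c ≠ 0 ∧ ∃ (I' J' : Set ℝ) (l : Label) (g β : ℝ → ℝ),
    l.Admissible I' J' g β ∧
    Reduces .t I (a • A₁ + b • A₂) (c • A₁ + d • A₂) I' (l.comps g β).1.1 (l.comps g β).2.1 ∧
    Reduces .y J (a • B₁ + b • B₂) (c • B₁ + d • B₂) J' (l.comps g β).1.2 (l.comps g β).2.2

/-- The blocks may be reduced by unrelated transformations; only the matrix `a, b, c, d` has to be
the same for both. -/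
theorem Good.of_reduces (hA₁ : Smooth I A₁) (hB₁ : Smooth J B₁) (hA₂ : Smooth I A₂)
    (hB₂ : Smooth J B₂) (hA : Reduces .t I A₁ A₂ I' A₁' A₂') (hB : Reduces .y J B₁ B₂ J' B₁' B₂')
    (h : Good I' J' A₁' B₁' A₂' B₂') : Good I J A₁ B₁ A₂ B₂ := by
  obtain ⟨a, b, c, d, hdet, I'', J'', l, g, β, hl, h₁, h₂⟩ := h
  exact ⟨a, b, c, d, hdet, I'', J'', l, g, β, hl,
    (hA.lin hA₁ hA₂ a b c d).trans (hA₁.lin hA₂ a b) (hA₁.lin hA₂ c d) h₁,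
    (hB.lin hB₁ hB₂ a b c d).trans (hB₁.lin hB₂ a b) (hB₁.lin hB₂ c d) h₂⟩

theorem lin_lin (a b a' b' c' d' : ℝ) : a • (a' • A₁ + b' • A₂) + b • (c' • A₁ + d' • A₂) =
    (a * a' + b * c') • A₁ + (a * b' + b * d') • A₂ := by
  module

theorem Good.of_basis {a b c d : ℝ} (hdet : a * d - b * c ≠ 0)
    (h : Good I J (a • A₁ + b • A₂) (a • B₁ + b • B₂) (c • A₁ + d • A₂) (c • B₁ + d • B₂)) :
    Good I J A₁ B₁ A₂ B₂ := by
  obtain ⟨a', b', c', d', hdet', I'', J'', l, g, β, hl, h₁, h₂⟩ := h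
  simp only [lin_lin] at h₁ h₂
  refine ⟨_, _, _, _, ?_, I'', J'', l, g, β, hl, h₁, h₂⟩
  convert mul_ne_zero hdet hdet' using 1
  ring

theorem Good.of_agree (hI : IsOpenInterval I) (hJ : IsOpenInterval J) (l : Label)
    (hl : l.Admissible I J g β) {a b c d : ℝ} (hdet : a * d - b * c ≠ 0)
    (h₁ : Agree I (a • A₁ + b • A₂) (l.comps g β).1.1)
    (h₂ : Agree I (c • A₁ + d • A₂) (l.comps g β).2.1)
    (h₃ : Agree J (a • B₁ + b • B₂) (l.comps g β).1.2)
    (h₄ : Agree J (c • B₁ + d • B₂) (l.comps g β).2.2) : Good I J A₁ B₁ A₂ B₂ :=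
  ⟨a, b, c, d, hdet, I, J, l, g, β, hl, (reduces_refl hI).congr h₁ h₂, (reduces_refl hJ).congr h₃ h₄⟩

theorem Indep.basis {a b c d : ℝ} (hdet : a * d - b * c ≠ 0) (h : Indep I J A₁ B₁ A₂ B₂) :
    Indep I J (a • A₁ + b • A₂) (a • B₁ + b • B₂) (c • A₁ + d • A₂) (c • B₁ + d • B₂) := by
  intro a' b' h₁ h₂
  simp only [lin_lin] at h₁ h₂
  obtain ⟨e1, e2⟩ := h _ _ h₁ h₂
  constructor
  · refine (mul_eq_zero.1 ?_).resolve_right hdet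
    linear_combination d * e1 - c * e2
  · refine (mul_eq_zero.1 ?_).resolve_right hdet
    linear_combination a * e2 - b * e1

theorem Indep.reduces (hA₁ : Smooth I A₁) (hB₁ : Smooth J B₁) (hA₂ : Smooth I A₂)
    (hB₂ : Smooth J B₂) (hA : Reduces .t I A₁ A₂ I' A₁' A₂') (hB : Reduces .y J B₁ B₂ J' B₁' B₂')
    (h : Indep I J A₁ B₁ A₂ B₂) : Indep I' J' A₁' B₁' A₂' B₂' := by
  rintro a b ⟨I₀, hI, hI₀, h₁⟩ ⟨J₀, hJ, hJ₀, h₂⟩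
  exact h a b (hA.vanish hA₁ hA₂ hI hI₀ h₁) (hB.vanish hB₁ hB₂ hJ hJ₀ h₂)

theorem span_pair_basis {E : Type*} [AddCommGroup E] [Module ℝ E] (V W : E) {a b c d : ℝ}
    (hdet : a * d - b * c ≠ 0) :
    Submodule.span ℝ {a • V + b • W, c • V + d • W} = Submodule.span ℝ {V, W} := by
  apply le_antisymm
  · rw [Submodule.span_le]
    rintro _ (rfl | rfl)
    · exact Submodule.mem_span_pair.2 ⟨a, b, rfl⟩
    · exact Submodule.mem_span_pair.2 ⟨c, d, rfl⟩
  · rw [Submodule.span_le]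
    rintro _ (rfl | rfl)
    · refine Submodule.mem_span_pair.2 ⟨d * (a * d - b * c)⁻¹, -b * (a * d - b * c)⁻¹, ?_⟩
      match_scalars
      · linear_combination mul_inv_cancel₀ hdet
      · ring
    · refine Submodule.mem_span_pair.2 ⟨-c * (a * d - b * c)⁻¹, a * (a * d - b * c)⁻¹, ?_⟩
      match_scalars
      · ring
      · linear_combination mul_inv_cancel₀ hdet

theorem map_span2 (hI : I' ⊆ I) (hJ : J' ⊆ J) :
    (span2 I J A₁ B₁ A₂ B₂).map (restrictTo (strip I' J')) = span2 I' J' A₁ B₁ A₂ B₂ := by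
  rw [span2, Submodule.map_span, image_pair, restrict_vf hI hJ, restrict_vf hI hJ, span2]

theorem Good.exists_gEquivalent (hA₁ : Smooth I A₁) (hB₁ : Smooth J B₁) (hA₂ : Smooth I A₂)
    (hB₂ : Smooth J B₂) (h : Good I J A₁ B₁ A₂ B₂) :
    ∃ I₀ ⊆ I, ∃ J₀ ⊆ J, IsOpenInterval I₀ ∧ IsOpenInterval J₀ ∧
      ∃ I' J' : Set ℝ, IsOpenInterval I' ∧ IsOpenInterval J' ∧
      ∃ (l : Label) (g β : ℝ → ℝ), l.Admissible I' J' g β ∧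
        GEquivalent I₀ J₀ ((span2 I J A₁ B₁ A₂ B₂).map (restrictTo (strip I₀ J₀)))
          I' J' (l.algebra I' J' g β) := by
  obtain ⟨a, b, c, d, hdet, I', J', l, g, β, hl, ⟨I₀, hI₀, T, m, X, hT, rfl, p₁, p₂⟩,
    ⟨J₀, hJ₀, Y, n, V₀, hY, rfl, q₁, q₂⟩⟩ := h
  refine ⟨I₀, hI₀, J₀, hJ₀, hT.interval, hY.interval, _, _, hT.image, hY.image, l, g, β, hl, ?_⟩
  rw [map_span2 hI₀ hJ₀, l.algebra_eq]
  have sA₁ := hA₁.mono hI₀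
  have sA₂ := hA₂.mono hI₀
  have sB₁ := hB₁.mono hJ₀
  have sB₂ := hB₂.mono hJ₀
  have := gEquivalent_span2 hT hY (sA₁.lin sA₂ a b) (sB₁.lin sB₂ a b) (sA₁.lin sA₂ c d)
    (sB₁.lin sB₂ c d) p₁ p₂ q₁ q₂
  rwa [span2, ← vf_lin hT.interval.1 hY.interval.1 sA₁ sA₂ sB₁ sB₂,
    ← vf_lin hT.interval.1 hY.interval.1 sA₁ sA₂ sB₁ sB₂, span_pair_basis _ _ hdet] at this

end

/-! ### Classification of the non-Abelian subalgebras. -/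

section

variable {I J I' J' : Set ℝ} {A A₁ A₂ A' A₁' A₂' B B₁ B₂ B' B₁' B₂' : Pair} {p : Pt}
  {T m X Y n V₀ : ℝ → ℝ} {σ : Side} {t : ℝ} {g β : ℝ → ℝ} {Φ : Pt → Pt}

theorem sq_eq_one_of_sign {s : ℝ} (hs : s = 1 ∨ s = -1) : s * s = 1 ∧ s ≠ 0 := by
  rcases hs with rfl | rfl <;> norm_num

theorem Reduces.dilate (hA₁ : Smooth I A₁) (hA₂ : Smooth I A₂)
    (h : Reduces σ I A₁ A₂ I' A₁' A₂') {M : ℝ} (hM : M ≠ 0) :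
    ∃ I'', Reduces σ I A₁ A₂ I'' (BLP.dilate σ M A₁') (BLP.dilate σ M A₂') := by
  obtain ⟨I'', h'⟩ := exists_dilate (σ := σ) (A₁ := A₁') (A₂ := A₂') h.interval hM
  exact ⟨I'', h.trans hA₁ hA₂ h'⟩

theorem Indep.false_of_zero (hI : IsOpenInterval I) (hJ : IsOpenInterval J)
    (h : Indep I J A₁ B₁ A₂ B₂) {a b : ℝ} (hab : ¬ (a = 0 ∧ b = 0))
    (h₁ : Agree I (a • A₁ + b • A₂) (cp 0 0)) (h₂ : Agree J (a • B₁ + b • B₂) (cp 0 0)) : False :=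
  hab (h a b ⟨I, Subset.rfl, hI, h₁⟩ ⟨J, Subset.rfl, hJ, h₂⟩)

theorem fin_two_eq_one {δ : Fin 2} (h : δ.val ≠ 0) : δ = 1 := by
  revert h; fin_cases δ <;> simp

/-- Three normal forms in each block give nine combinations, one of which has a zero first field and
contradicts independence. The sign `s` in the block of `t` survives dilations there. It is removed
by multiplying the first field by `s`, and a dilation of `y` by `s` compensates for this where the
other block is affected. -/
theorem good_nonabelian (hI : IsOpenInterval I) (hJ : IsOpenInterval J) (hA₁ : Smooth I A₁)
    (hB₁ : Smooth J B₁) (hA₂ : Smooth I A₂) (hB₂ : Smooth J B₂) (hind : Indep I J A₁ B₁ A₂ B₂)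
    (hA : Agree I (br Side.t.wt A₁ A₂) A₁) (hB : Agree J (br Side.y.wt B₁ B₂) B₁) :
    Good I J A₁ B₁ A₂ B₂ := by
  have et : 1 / Side.t.wt = 2 := by norm_num [Side.wt]
  have ey : 1 / Side.y.wt = -1 := by norm_num [Side.wt]
  have ed : Side.y.dil = fun M => 1 / M := rfl
  have nA := nonabelian_normal_form hI hA₁ hA₂ hA
  -- In the block of `y` orientation may be reversed, so a dilation by `s` turns the constant `s`
  -- into `1`.
  have nB : (∃ J', Reduces .y J B₁ B₂ J' (cp 1 0) (lp 1)) ∨ _ :=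
    (nonabelian_normal_form hJ hB₁ hB₂ hB).imp_left fun ⟨s, hs, J', hR⟩ => by
      obtain ⟨hs2, hs0⟩ := sq_eq_one_of_sign hs
      obtain ⟨J'', hR'⟩ := hR.dilate hB₁ hB₂ hs0
      rw [dilate_cp, dilate_lp hs0, ed, one_div_mul_cancel hs0, mul_zero] at hR'
      exact ⟨J'', hR'⟩
  rw [et] at nA
  rw [ey] at nB
  rcases nA with ⟨s, hs, I', hRA⟩ | ⟨δ, I', hRA⟩ | ⟨δ, I', hRA⟩
  · obtain ⟨hs2, hs0⟩ := sq_eq_one_of_sign hs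
    rcases nB with ⟨J', hRB⟩ | ⟨δ', J', hRB⟩ | ⟨δ', J', hRB⟩
    · obtain ⟨J'', hRB'⟩ := hRB.dilate hB₁ hB₂ hs0
      rw [dilate_cp, dilate_lp hs0, ed, mul_zero] at hRB'
      refine Good.of_reduces hA₁ hB₁ hA₂ hB₂ hRA hRB' (Good.of_agree (g := 0) (β := 0) (a := s)
        (b := 0) (c := 0) (d := 1) hRA.interval hRB'.interval .s1 trivial ?_ ?_ ?_ ?_ ?_)
      · simpa using hs0
      all_goals intro t _; simp [Label.comps, cp, lp, hs2, hs0]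
    · obtain ⟨J'', hRB'⟩ := hRB.dilate hB₁ hB₂ hs0
      rw [dilate_cp, dilate_lp hs0, ed, mul_zero] at hRB'
      refine Good.of_reduces hA₁ hB₁ hA₂ hB₂ hRA hRB' (Good.of_agree (g := 0) (β := 0) (a := s)
        (b := 0) (c := 0) (d := 1) hRA.interval hRB'.interval (.s2 δ') trivial ?_ ?_ ?_ ?_ ?_)
      · simpa using hs0
      all_goals intro t _; simp [Label.comps, cp, lp, ← mul_assoc, hs2]
    · refine Good.of_reduces hA₁ hB₁ hA₂ hB₂ hRA hRB (Good.of_agree (g := 0) (β := 0) (a := s)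
        (b := 0) (c := 0) (d := 1) hRA.interval hRB.interval (.s3 δ') trivial ?_ ?_ ?_ ?_ ?_)
      · simpa using hs0
      all_goals intro t _; simp [Label.comps, cp, lp, hs2]
  · rcases nB with ⟨J', hRB⟩ | ⟨δ', J', hRB⟩ | ⟨δ', J', hRB⟩
    -- The dilation by `-1` fixes `t` and reverses `x`, which yields the minus sign in `-P(δ)`.
    · have hm : (-1 : ℝ) ≠ 0 := by norm_num
      obtain ⟨I'', hRA'⟩ := hRA.dilate hA₁ hA₂ hm
      rw [dilate_cp, dilate_lp hm, mul_zero] at hRA'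
      refine Good.of_reduces hA₁ hB₁ hA₂ hB₂ hRA' hRB (Good.of_agree (g := 0) (β := 0) (a := 1)
        (b := 0) (c := 0) (d := 1) hRA'.interval hRB.interval (.s4 δ) trivial ?_ ?_ ?_ ?_ ?_)
      · norm_num
      all_goals intro t _; simp [Label.comps, cp, lp]
    · have hi := hind.reduces hA₁ hB₁ hA₂ hB₂ hRA hRB
      refine Good.of_reduces hA₁ hB₁ hA₂ hB₂ hRA hRB (Good.of_agree (g := 0) (β := 0) (a := 1)
        (b := 0) (c := 0) (d := 1) hRA.interval hRB.interval (.s6 δ δ') ?_ ?_ ?_ ?_ ?_ ?_)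
      · intro h
        obtain ⟨rfl, rfl⟩ := Prod.mk.inj h
        refine hi.false_of_zero (a := 1) (b := 0) hRA.interval hRB.interval (by simp) ?_ ?_ <;>
        · intro t _; simp [cp]
      · norm_num
      all_goals intro t _; simp [Label.comps, cp, lp]
    · have hi := hind.reduces hA₁ hB₁ hA₂ hB₂ hRA hRB
      have hδ : δ = 1 := fin_two_eq_one fun h => by
        refine hi.false_of_zero (a := 1) (b := 0) hRA.interval hRB.interval (by simp) ?_ ?_ <;>
        · intro t _; simp [cp, h]
      subst hδ
      refine Good.of_reduces hA₁ hB₁ hA₂ hB₂ hRA hRB (Good.of_agree (g := 0) (β := 0) (a := 1)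
        (b := 0) (c := 0) (d := 1) hRA.interval hRB.interval (.s7 δ') trivial ?_ ?_ ?_ ?_ ?_)
      · norm_num
      all_goals intro t _; simp [Label.comps, cp, lp]
  · have hi : ∀ {J' B₂'}, Reduces .y J B₁ B₂ J' (cp 0 0) B₂' → False := fun hRB => by
      refine (hind.reduces hA₁ hB₁ hA₂ hB₂ hRA hRB).false_of_zero (a := 1) (b := 0)
        hRA.interval hRB.interval (by simp) ?_ ?_ <;>
      · intro t _; simp [cp]
    rcases nB with ⟨J', hRB⟩ | ⟨δ', J', hRB⟩ | ⟨δ', J', hRB⟩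
    · refine Good.of_reduces hA₁ hB₁ hA₂ hB₂ hRA hRB (Good.of_agree (g := 0) (β := 0) (a := 1)
        (b := 0) (c := 0) (d := 1) hRA.interval hRB.interval (.s5 δ) trivial ?_ ?_ ?_ ?_ ?_)
      · norm_num
      all_goals intro t _; simp [Label.comps, cp, lp]
    · have hδ : δ' = 1 := fin_two_eq_one fun h => hi (J' := J') (B₂' := lp (-1)) (by simpa [h] using hRB)
      subst hδ
      refine Good.of_reduces hA₁ hB₁ hA₂ hB₂ hRA hRB (Good.of_agree (g := 0) (β := 0) (a := 1)
        (b := 0) (c := 0) (d := 1) hRA.interval hRB.interval (.s8 δ) trivial ?_ ?_ ?_ ?_ ?_)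
      · norm_num
      all_goals intro t _; simp [Label.comps, cp, lp]
    · exact (hi hRB).elim

end

/-! ### Classification of the Abelian subalgebras. -/

section

variable {I J I' J' : Set ℝ} {A A₁ A₂ A' A₁' A₂' B B₁ B₂ B' B₁' B₂' : Pair} {p : Pt}
  {T m X Y n V₀ : ℝ → ℝ} {σ : Side} {t : ℝ} {g β : ℝ → ℝ} {Φ : Pt → Pt}

/-- Two commuting fields that stay independent over smaller intervals. -/
structure Commuting (I J : Set ℝ) (A₁ B₁ A₂ B₂ : Pair) : Prop where
  hI : IsOpenInterval I
  hJ : IsOpenInterval J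
  hA₁ : Smooth I A₁
  hB₁ : Smooth J B₁
  hA₂ : Smooth I A₂
  hB₂ : Smooth J B₂
  brA : Agree I (br Side.t.wt A₁ A₂) (cp 0 0)
  brB : Agree J (br Side.y.wt B₁ B₂) (cp 0 0)
  indep : Indep I J A₁ B₁ A₂ B₂

theorem br_lin_zero (hI : IsOpen I) (k : ℝ) (h₁ : Smooth I A₁) (h₂ : Smooth I A₂)
    (h : Agree I (br k A₁ A₂) (cp 0 0)) (a b c d : ℝ) :
    Agree I (br k (a • A₁ + b • A₂) (c • A₁ + d • A₂)) (cp 0 0) := fun t ht => by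
  rw [(br_lin hI k h₁ h₂ a b c d ht).1, (br_lin hI k h₁ h₂ a b c d ht).2, (h t ht).1, (h t ht).2]
  simp [cp]

theorem Commuting.basis (h : Commuting I J A₁ B₁ A₂ B₂) {a b c d : ℝ} (hdet : a * d - b * c ≠ 0) :
    Commuting I J (a • A₁ + b • A₂) (a • B₁ + b • B₂) (c • A₁ + d • A₂) (c • B₁ + d • B₂) :=
  ⟨h.hI, h.hJ, h.hA₁.lin h.hA₂ a b, h.hB₁.lin h.hB₂ a b, h.hA₁.lin h.hA₂ c d, h.hB₁.lin h.hB₂ c d,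
    br_lin_zero h.hI.1 _ h.hA₁ h.hA₂ h.brA a b c d, br_lin_zero h.hJ.1 _ h.hB₁ h.hB₂ h.brB a b c d,
    h.indep.basis hdet⟩

theorem Commuting.mono (h : Commuting I J A₁ B₁ A₂ B₂) (hI : I' ⊆ I) (hI' : IsOpenInterval I')
    (hJ : J' ⊆ J) (hJ' : IsOpenInterval J') : Commuting I' J' A₁ B₁ A₂ B₂ :=
  ⟨hI', hJ', h.hA₁.mono hI, h.hB₁.mono hJ, h.hA₂.mono hI, h.hB₂.mono hJ, h.brA.mono hI,
    h.brB.mono hJ, h.indep.reduces h.hA₁ h.hB₁ h.hA₂ h.hB₂ (reduces_of_subset hI hI')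
      (reduces_of_subset hJ hJ')⟩

theorem Commuting.good (h : Commuting I J A₁ B₁ A₂ B₂) (hA : Reduces .t I A₁ A₂ I' A₁' A₂')
    (hB : Reduces .y J B₁ B₂ J' B₁' B₂') (hG : Good I' J' A₁' B₁' A₂' B₂') :
    Good I J A₁ B₁ A₂ B₂ :=
  hG.of_reduces h.hA₁ h.hB₁ h.hA₂ h.hB₂ hA hB

theorem Commuting.good_of_subset (h : Commuting I J A₁ B₁ A₂ B₂) (hI : I' ⊆ I)
    (hI' : IsOpenInterval I') (hJ : J' ⊆ J) (hJ' : IsOpenInterval J')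
    (hG : Good I' J' A₁ B₁ A₂ B₂) : Good I J A₁ B₁ A₂ B₂ :=
  h.good (reduces_of_subset hI hI') (reduces_of_subset hJ hJ') hG

theorem exists_pow_three (c : ℝ) : ∃ M : ℝ, M ^ 3 = c := by
  have h3 : ∀ x : ℝ, 0 ≤ x → (x ^ (1 / 3 : ℝ)) ^ 3 = x := fun x hx => by
    rw [← Real.rpow_natCast, ← Real.rpow_mul hx]; norm_num
  rcases le_total 0 c with h | h
  · exact ⟨_, h3 c h⟩
  · refine ⟨-((-c) ^ (1 / 3 : ℝ)), ?_⟩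
    have := h3 (-c) (by linarith)
    linear_combination -this

/-- The two constants can be normalized by dilations and by scaling. -/
theorem exists_scaling (b c k : ℝ) (hk : k ≠ 0) : ∃ M N : ℝ, M ≠ 0 ∧ N ≠ 0 ∧ ∃ δ δ' : Fin 2,
    N * b / M ^ 2 = δ.val ∧ N * M * c = k * δ'.val := by
  by_cases hb : b = 0
  · by_cases hc : c = 0
    · exact ⟨1, 1, one_ne_zero, one_ne_zero, 0, 0, by simp [hb], by simp [hc]⟩
    · exact ⟨k / c, 1, by positivity, one_ne_zero, 0, 1, by simp [hb], by simp; field_simp⟩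
  · by_cases hc : c = 0
    · exact ⟨1, 1 / b, one_ne_zero, by positivity, 1, 0, by simp; field_simp, by simp [hc]⟩
    -- The values `1` and `k` are required. The first equation gives `N = M ^ 2 / b`, the second
    -- then `M ^ 3 = k * b / c`, which has a real root for either sign.
    · obtain ⟨M, hM⟩ := exists_pow_three (k * b / c)
      have hM0 : M ≠ 0 := by
        rintro rfl
        have : k * b / c ≠ 0 := by positivity
        exact this (by rw [← hM]; norm_num)
      refine ⟨M, M ^ 2 / b, hM0, by positivity, 1, 1, by simp; field_simp, ?_⟩
      have e : M ^ 2 / b * M * c = M ^ 3 * c / b := by ring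
      rw [e, hM]
      simp
      field_simp

theorem Reduces.dilate_cp (hA₁ : Smooth I A₁) (hA₂ : Smooth I A₂) {a b c d : ℝ}
    (h : Reduces σ I A₁ A₂ I' (cp a b) (cp c d)) {M : ℝ} (hM : M ≠ 0) :
    ∃ I'', Reduces σ I A₁ A₂ I'' (cp (σ.dil M * a) (M * b)) (cp (σ.dil M * c) (M * d)) :=
  h.dilate hA₁ hA₂ hM

/-- After dilations by `M` and `N`, rescaling the fields so that they start with `D(1)` and `S(1)`
leaves the constants `N * (b * s) / M ^ 2` and `N * M * (c * s')`. The value `-1` of `k` in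
`exists_scaling` accounts for the minus sign in `s9`. -/
theorem Commuting.good_translations (h : Commuting I J A₁ B₁ A₂ B₂) {s s' b c : ℝ}
    (hs : s = 1 ∨ s = -1) (hs' : s' = 1 ∨ s' = -1)
    (hA : Reduces .t I A₁ A₂ I' (cp s 0) (cp 0 c))
    (hB : Reduces .y J B₁ B₂ J' (cp 0 b) (cp s' 0)) : Good I J A₁ B₁ A₂ B₂ := by
  obtain ⟨hs2, hs0⟩ := sq_eq_one_of_sign hs
  obtain ⟨hs2', hs0'⟩ := sq_eq_one_of_sign hs'
  obtain ⟨M, N, hM, hN, δ, δ', e1, e2⟩ := exists_scaling (b * s) (c * s') (-1) (by norm_num)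
  obtain ⟨I₁, hA'⟩ := hA.dilate_cp h.hA₁ h.hA₂ hM
  obtain ⟨J₁, hB'⟩ := hB.dilate_cp h.hB₁ h.hB₂ hN
  refine h.good hA' hB' (Good.of_agree (g := 0) (β := 0) (a := s / M ^ 2)
    (b := 0) (c := 0) (d := s' * N) hA'.interval hB'.interval (.s9 δ δ') trivial ?_ ?_ ?_ ?_ ?_)
  · simp [hs0, hs0', hM, hN]
  · intro t _
    simp [Label.comps, cp, Side.dil]
    field_simp
    linear_combination hs2
  · intro t _
    simp [Label.comps, cp, Side.dil]
    linear_combination e2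
  · intro t _
    simp [Label.comps, cp, Side.dil]
    rw [← e1]
    ring
  · intro t _
    simp [Label.comps, cp, Side.dil]
    field_simp
    linear_combination hs2'

theorem Commuting.good_diagonal (h : Commuting I J A₁ B₁ A₂ B₂) {s s' b c : ℝ}
    (hs : s = 1 ∨ s = -1) (hs' : s' = 1 ∨ s' = -1)
    (hA : Reduces .t I A₁ A₂ I' (cp s 0) (cp 0 c))
    (hB : Reduces .y J B₁ B₂ J' (cp s' 0) (cp 0 b)) : Good I J A₁ B₁ A₂ B₂ := by
  obtain ⟨hs2, hs0⟩ := sq_eq_one_of_sign hs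
  obtain ⟨hs2', hs0'⟩ := sq_eq_one_of_sign hs'
  obtain ⟨M, N, hM, hN, δ', δ, e1, e2⟩ := exists_scaling b (c * (s * s')) 1 one_ne_zero
  -- The dilation of `y` is tied to that of `t`: with this factor, multiplication by `s / M ^ 2`
  -- gives `D(1)` and `S(1)` at the same time. The free scale `N` multiplies the second field only.
  have hK : s * s' / M ^ 2 ≠ 0 := by positivity
  obtain ⟨I₁, hA'⟩ := hA.dilate_cp h.hA₁ h.hA₂ hM
  obtain ⟨J₁, hB'⟩ := hB.dilate_cp h.hB₁ h.hB₂ hK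
  have hi := h.indep.reduces h.hA₁ h.hB₁ h.hA₂ h.hB₂ hA' hB'
  have eA : M * c * (N * (s * s')) = δ.val := by linear_combination e2
  have eB : s * s' / M ^ 2 * b * (N * (s * s')) = δ'.val := by
    rw [← e1]
    linear_combination (N * b / M ^ 2) * (s' ^ 2 * hs2 + hs2')
  refine h.good hA' hB' (Good.of_agree (g := 0) (β := 0) (a := s / M ^ 2)
    (b := 0) (c := 0) (d := N * (s * s')) hA'.interval hB'.interval (.s10 δ δ') ?_ ?_ ?_ ?_ ?_ ?_)
  · intro h0
    obtain ⟨rfl, rfl⟩ := Prod.mk.inj h0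
    refine hi.false_of_zero (a := 0) (b := N * (s * s')) hA'.interval hB'.interval
      (by simp [hN, hs0, hs0']) ?_ ?_
    · intro t _
      simp [cp]
      simp at eA
      tauto
    · intro t _
      simp [cp]
      simp at eB
      tauto
  · simp [hs0, hs0', hM, hN]
  · intro t _
    simp [Label.comps, cp, Side.dil]
    field_simp
    linear_combination hs2
  · intro t _
    simp [Label.comps, cp, Side.dil]
    linear_combination eA
  · intro t _
    simp [Label.comps, cp, Side.dil]
    field_simp
  · intro t _
    simp [Label.comps, cp, Side.dil]
    linear_combination eB

/-- If `B₂` vanishes, the second field is a multiple of `P(1)` and the density in `B₁` can be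
straightened (`s12`). Otherwise the density in `B₂` is straightened to `1`, on a subinterval, and
the one in `B₁` remains as the arbitrary parameter of `s11`. -/
theorem Commuting.good_fst_t (h : Commuting I J A₁ B₁ A₂ B₂) (h0 : ∀ t ∈ I, A₁.1 t ≠ 0)
    (hz : ∀ t ∈ I, A₂.1 t = 0) (hB₁ : ∀ y ∈ J, B₁.1 y = 0) (hB₂ : ∀ y ∈ J, B₂.1 y = 0) :
    Good I J A₁ B₁ A₂ B₂ := by
  obtain ⟨s, hs, c, I', hA⟩ := abelian_normal_form h.hI h.hA₁ h.hA₂ h.brA h0 hz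
  obtain ⟨hs2, hs0⟩ := sq_eq_one_of_sign hs
  by_cases hB0 : ∀ y ∈ J, B₂.2 y = 0
  · obtain ⟨δ, J', B, hB⟩ := exists_straighten_snd_or_zero (σ := .y) h.hJ h.hB₁ h.hB₂ hB₁
    replace hB := hB.congr (fun _ _ => ⟨rfl, rfl⟩)
      (hB.swap.agree_zero fun y hy => ⟨hB₂ y hy, hB0 y hy⟩)
    have hc : c ≠ 0 := by
      rintro rfl
      refine (h.indep.reduces h.hA₁ h.hB₁ h.hA₂ h.hB₂ hA hB).false_of_zero (a := 0) (b := 1)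
        hA.interval hB.interval (by simp) ?_ ?_ <;>
      · intro t _; simp [cp]
    obtain ⟨J'', hB'⟩ := hB.dilate_cp h.hB₁ h.hB₂ hs0
    refine h.good hA hB' (Good.of_agree (g := 0) (β := 0) (a := s) (b := 0) (c := 0) (d := 1 / c)
      hA.interval hB'.interval (.s12 δ) trivial ?_ ?_ ?_ ?_ ?_)
    · simp [hs0, hc]
    all_goals intro t _; simp [Label.comps, cp, hs2, hc, ← mul_assoc]
  · obtain ⟨J₀, hJ₀, hJi, hne⟩ := exists_subinterval_ne_zero h.hJ.1 h.hB₂.2.continuousOn hB0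
    obtain ⟨J₁, B, hB⟩ := exists_straighten_snd (σ := .y) hJi (h.hB₂.mono hJ₀) (h.hB₁.mono hJ₀)
      (fun y hy => hB₂ y (hJ₀ hy)) hne
    replace hB := ((reduces_of_subset hJ₀ hJi).trans h.hB₂ h.hB₁ hB).swap
    have hz' := hB.fst_zero hB₁
    obtain ⟨M, hM, δ, hδ⟩ := exists_normalize c
    obtain ⟨I'', hA'⟩ := hA.dilate_cp h.hA₁ h.hA₂ hM
    refine h.good hA' hB (Good.of_agree (g := 0) (β := fun y => s / M ^ 2 * B.2 y)
      (a := s / M ^ 2) (b := 0) (c := 0) (d := 1) hA'.interval hB.interval (.s11 δ) ?_ ?_ ?_ ?_ ?_ ?_)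
    · exact contDiffOn_const.mul (hB.smooth h.hB₁ h.hB₂).1.2
    · simp [hs0, hM]
    · intro t _
      simp [Label.comps, cp, Side.dil]
      field_simp
      linear_combination hs2
    all_goals intro t ht; simp [Label.comps, cp, hδ]
    exact Or.inr (hz' t ht)

/-- The mirror image of `good_fst_t`, which leads to `s14` and `s13`. -/
theorem Commuting.good_fst_y (h : Commuting I J A₁ B₁ A₂ B₂) (h0 : ∀ y ∈ J, B₁.1 y ≠ 0)
    (hz : ∀ y ∈ J, B₂.1 y = 0) (hA₁ : ∀ t ∈ I, A₁.1 t = 0) (hA₂ : ∀ t ∈ I, A₂.1 t = 0) :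
    Good I J A₁ B₁ A₂ B₂ := by
  obtain ⟨s, hs, b, J', hB⟩ := abelian_normal_form h.hJ h.hB₁ h.hB₂ h.brB h0 hz
  obtain ⟨hs2, hs0⟩ := sq_eq_one_of_sign hs
  by_cases hA0 : ∀ t ∈ I, A₂.2 t = 0
  · obtain ⟨δ, I', A, hA⟩ := exists_straighten_snd_or_zero (σ := .t) h.hI h.hA₁ h.hA₂ hA₁
    replace hA := hA.congr (fun _ _ => ⟨rfl, rfl⟩)
      (hA.swap.agree_zero fun t ht => ⟨hA₂ t ht, hA0 t ht⟩)
    have hb : b ≠ 0 := by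
      rintro rfl
      refine (h.indep.reduces h.hA₁ h.hB₁ h.hA₂ h.hB₂ hA hB).false_of_zero (a := 0) (b := 1)
        hA.interval hB.interval (by simp) ?_ ?_ <;>
      · intro t _; simp [cp]
    -- Together with the later factor `s`, the dilation by `-s` gives the sign of `-P(δ)`.
    obtain ⟨I'', hA'⟩ := hA.dilate_cp h.hA₁ h.hA₂ (neg_ne_zero.2 hs0)
    refine h.good hA' hB (Good.of_agree (g := 0) (β := 0) (a := s) (b := 0) (c := 0) (d := 1 / b)
      hA'.interval hB.interval (.s14 δ) trivial ?_ ?_ ?_ ?_ ?_)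
    · simp [hs0, hb]
    all_goals intro t _; simp [Label.comps, cp, hs2, hb, ← mul_assoc]
  · obtain ⟨I₀, hI₀, hIi, hne⟩ := exists_subinterval_ne_zero h.hI.1 h.hA₂.2.continuousOn hA0
    obtain ⟨I₁, A, hA⟩ := exists_straighten_snd (σ := .t) hIi (h.hA₂.mono hI₀) (h.hA₁.mono hI₀)
      (fun t ht => hA₂ t (hI₀ ht)) hne
    replace hA := ((reduces_of_subset hI₀ hIi).trans h.hA₂ h.hA₁ hA).swap
    have hz' := hA.fst_zero hA₁
    obtain ⟨M, hM, δ, hδ⟩ := exists_normalize b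
    obtain ⟨J'', hB'⟩ := hB.dilate_cp h.hB₁ h.hB₂ hM
    refine h.good hA hB' (Good.of_agree (g := fun t => s * M * A.2 t) (β := 0)
      (a := s * M) (b := 0) (c := 0) (d := 1) hA.interval hB'.interval (.s13 δ) ?_ ?_ ?_ ?_ ?_ ?_)
    · exact contDiffOn_const.mul (hA.smooth h.hA₁ h.hA₂).1.2
    · simp [hs0, hM]
    · intro t ht
      simp [Label.comps]
      exact Or.inr (hz' t ht)
    · intro t ht; simp [Label.comps, cp]
    · intro t ht
      simp [Label.comps, cp, Side.dil]
      field_simp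
      linear_combination hs2
    · intro t ht; simp [Label.comps, cp, hδ]

/-- The pairs satisfy no linear relation over smaller intervals. -/
def NoRelation (I : Set ℝ) (A₁ A₂ : Pair) : Prop :=
  ∀ a b : ℝ, (∃ I₀ ⊆ I, IsOpenInterval I₀ ∧ Agree I₀ (a • A₁ + b • A₂) (cp 0 0)) → a = 0 ∧ b = 0

theorem NoRelation.basis {a b c d : ℝ} (hdet : a * d - b * c ≠ 0) (h : NoRelation I A₁ A₂) :
    NoRelation I (a • A₁ + b • A₂) (c • A₁ + d • A₂) := by
  intro a' b' h₁
  simp only [lin_lin] at h₁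
  obtain ⟨e1, e2⟩ := h _ _ h₁
  constructor
  · refine (mul_eq_zero.1 ?_).resolve_right hdet
    linear_combination d * e1 - c * e2
  · refine (mul_eq_zero.1 ?_).resolve_right hdet
    linear_combination a * e2 - b * e1

theorem NoRelation.normal_form (h : NoRelation I A₁ A₂) (hI : IsOpenInterval I)
    (hA₁ : Smooth I A₁) (hA₂ : Smooth I A₂) (h₁ : ∀ t ∈ I, A₁.1 t = 0) (h₂ : ∀ t ∈ I, A₂.1 t = 0) :
    ∃ I' g, ContDiffOn ℝ ∞ g I' ∧ NowhereConstantOn g I' ∧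
      Reduces σ I A₁ A₂ I' (cp 0 1) (fun _ => 0, g) := by
  have hne : ¬ ∀ t ∈ I, A₁.2 t = 0 := fun h0 => by
    have := h 1 0 ⟨I, Subset.rfl, hI, fun t ht => by simp [cp, h₁ t ht, h0 t ht]⟩
    simp at this
  obtain ⟨I₀, hI₀, hIi, hne⟩ := exists_subinterval_ne_zero hI.1 hA₁.2.continuousOn hne
  obtain ⟨I₁, A, hA⟩ := exists_straighten_snd (σ := σ) hIi (hA₁.mono hI₀) (hA₂.mono hI₀)
    (fun t ht => h₁ t (hI₀ ht)) hne
  replace hA := (reduces_of_subset hI₀ hIi).trans hA₁ hA₂ hA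
  have hz := hA.swap.fst_zero h₂
  refine ⟨I₁, A.2, (hA.smooth hA₁ hA₂).2.2, ?_, hA.congr (fun _ _ => ⟨rfl, rfl⟩)
    fun t ht => ⟨hz t ht, rfl⟩⟩
  rintro I' hI' hI'' ⟨c, hc⟩
  have := h (-c) 1 (hA.vanish hA₁ hA₂ hI' hI'' fun t ht => by
    simp [cp, hz t (hI' ht), hc t ht])
  simp at this

theorem not_noRelation (h : ¬ NoRelation I A₁ A₂) : ∃ a b : ℝ, ¬ (a = 0 ∧ b = 0) ∧
    ∃ I₀ ⊆ I, IsOpenInterval I₀ ∧ Agree I₀ (a • A₁ + b • A₂) (cp 0 0) := by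
  unfold NoRelation at h
  push Not at h
  obtain ⟨a, b, h1, h2⟩ := h
  exact ⟨a, b, fun h => h2 h.1 h.2, h1⟩

/-- The determinant of the basis `b V₁ - a V₂`, `a V₁ + b V₂`, which completes the vector of a given
relation. -/
theorem sq_add_sq_ne_zero {a b : ℝ} (h : ¬ (a = 0 ∧ b = 0)) : b * b - -a * a ≠ 0 := fun h0 => by
  have h1 : a = 0 := by nlinarith [mul_self_nonneg a, mul_self_nonneg b]
  have h2 : b = 0 := by nlinarith [mul_self_nonneg a, mul_self_nonneg b]
  exact h ⟨h1, h2⟩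

theorem lin_fst_zero (h₁ : ∀ t ∈ I, A₁.1 t = 0) (h₂ : ∀ t ∈ I, A₂.1 t = 0) (a b : ℝ) :
    ∀ t ∈ I, (a • A₁ + b • A₂).1 t = 0 := fun t ht => by simp [h₁ t ht, h₂ t ht]

/-- Only densities are left, and each block either satisfies a linear relation over some subinterval
or has none: no relations give `s18`, one in the block of `y` gives `s16`, one in the block of `t`
gives `s17`, one in each gives `s15`. -/
theorem Commuting.good_snd (h : Commuting I J A₁ B₁ A₂ B₂) (hA₁ : ∀ t ∈ I, A₁.1 t = 0)
    (hA₂ : ∀ t ∈ I, A₂.1 t = 0) (hB₁ : ∀ y ∈ J, B₁.1 y = 0) (hB₂ : ∀ y ∈ J, B₂.1 y = 0) :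
    Good I J A₁ B₁ A₂ B₂ := by
  by_cases hA : NoRelation I A₁ A₂ <;> by_cases hB : NoRelation J B₁ B₂
  · obtain ⟨I', g, hg, hgn, hRA⟩ := hA.normal_form (σ := .t) h.hI h.hA₁ h.hA₂ hA₁ hA₂
    obtain ⟨J', β, hβ, hβn, hRB⟩ := hB.normal_form (σ := .y) h.hJ h.hB₁ h.hB₂ hB₁ hB₂
    refine h.good hRA hRB (Good.of_agree (g := g) (β := β) (a := 1) (b := 0) (c := 0) (d := 1)
      hRA.interval hRB.interval .s18 ⟨⟨hg, hgn⟩, hβ, hβn⟩ ?_ ?_ ?_ ?_ ?_)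
    · norm_num
    all_goals intro t _; simp [Label.comps]
  · obtain ⟨a, b, hab, J₀, hJ₀, hJi, hv⟩ := not_noRelation hB
    have hdet := sq_add_sq_ne_zero hab
    refine h.good_of_subset Subset.rfl h.hI hJ₀ hJi (Good.of_basis hdet ?_)
    have h' := (h.mono Subset.rfl h.hI hJ₀ hJi).basis hdet
    obtain ⟨I', g, hg, hgn, hRA⟩ := (hA.basis hdet).normal_form (σ := .t) h'.hI h'.hA₁ h'.hA₂
      (lin_fst_zero hA₁ hA₂ _ _) (lin_fst_zero hA₁ hA₂ _ _)
    obtain ⟨δ, J', B, hRB⟩ := exists_straighten_snd_or_zero (σ := .y) hJi h'.hB₁ h'.hB₂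
      fun y hy => lin_fst_zero hB₁ hB₂ _ _ y (hJ₀ hy)
    replace hRB := hRB.congr (fun _ _ => ⟨rfl, rfl⟩) (hRB.swap.agree_zero hv)
    refine h'.good hRA hRB (Good.of_agree (g := g) (β := 0) (a := 1) (b := 0) (c := 0) (d := 1)
      hRA.interval hRB.interval (.s16 δ) ⟨hg, hgn⟩ ?_ ?_ ?_ ?_ ?_)
    · norm_num
    all_goals intro t _; simp [Label.comps]
  · obtain ⟨a, b, hab, I₀, hI₀, hIi, hv⟩ := not_noRelation hA
    have hdet := sq_add_sq_ne_zero hab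
    refine h.good_of_subset hI₀ hIi Subset.rfl h.hJ (Good.of_basis hdet ?_)
    have h' := (h.mono hI₀ hIi Subset.rfl h.hJ).basis hdet
    obtain ⟨J', β, hβ, hβn, hRB⟩ := (hB.basis hdet).normal_form (σ := .y) h'.hJ h'.hB₁ h'.hB₂
      (lin_fst_zero hB₁ hB₂ _ _) (lin_fst_zero hB₁ hB₂ _ _)
    obtain ⟨δ, I', A, hRA⟩ := exists_straighten_snd_or_zero (σ := .t) hIi h'.hA₁ h'.hA₂
      fun t ht => lin_fst_zero hA₁ hA₂ _ _ t (hI₀ ht)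
    replace hRA := hRA.congr (fun _ _ => ⟨rfl, rfl⟩) (hRA.swap.agree_zero hv)
    refine h'.good hRA hRB (Good.of_agree (g := 0) (β := β) (a := 1) (b := 0) (c := 0) (d := 1)
      hRA.interval hRB.interval (.s17 δ) ⟨hβ, hβn⟩ ?_ ?_ ?_ ?_ ?_)
    · norm_num
    all_goals intro t _; simp [Label.comps]
  · obtain ⟨a, b, hab, I₀, hI₀, hIi, hv⟩ := not_noRelation hA
    obtain ⟨c, d, hcd, J₀, hJ₀, hJi, hw⟩ := not_noRelation hB
    -- Proportional relations would make one combination vanish in both blocks. Hence the two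
    -- combinations form a basis, one vector lying in each block.
    have hdet : c * b - d * a ≠ 0 := fun h0 => by
      refine (h.mono hI₀ hIi hJ₀ hJi).indep.false_of_zero hIi hJi hab hv ?_
      by_cases hc : c = 0
      · subst hc
        have hd : d ≠ 0 := fun hd => hcd ⟨rfl, hd⟩
        have ha : a = 0 := by
          apply mul_left_cancel₀ hd; linear_combination -h0
        subst ha
        intro y hy
        have := hw y hy
        simp [cp, hd] at this
        simp [cp, this]
      · have hb : b = d * a / c := by
          rw [eq_div_iff hc]; linear_combination h0
        intro y hy
        have := hw y hy
        simp only [lin_fst, lin_snd, cp] at this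
        simp only [lin_fst, lin_snd, cp, hb]
        constructor
        · field_simp
          linear_combination a * this.1
        · field_simp
          linear_combination a * this.2
    refine h.good_of_subset hI₀ hIi hJ₀ hJi (Good.of_basis hdet ?_)
    have h' := (h.mono hI₀ hIi hJ₀ hJi).basis hdet
    obtain ⟨δ, I', A, hRA⟩ := exists_straighten_snd_or_zero (σ := .t) hIi h'.hA₁ h'.hA₂
      fun t ht => lin_fst_zero hA₁ hA₂ _ _ t (hI₀ ht)
    replace hRA := hRA.congr (fun _ _ => ⟨rfl, rfl⟩) (hRA.swap.agree_zero hv)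
    obtain ⟨δ', J', B, hRB⟩ := exists_straighten_snd_or_zero (σ := .y) hJi h'.hB₂ h'.hB₁
      fun y hy => lin_fst_zero hB₁ hB₂ _ _ y (hJ₀ hy)
    replace hRB := (hRB.congr (fun _ _ => ⟨rfl, rfl⟩) (hRB.swap.agree_zero hw)).swap
    have hi := h'.indep.reduces h'.hA₁ h'.hB₁ h'.hA₂ h'.hB₂ hRA hRB
    have hδ : δ = 1 := fin_two_eq_one fun h => by
      refine hi.false_of_zero (a := 1) (b := 0) hRA.interval hRB.interval (by simp) ?_ ?_ <;>
      · intro t _; simp [cp, h]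
    have hδ' : δ' = 1 := fin_two_eq_one fun h => by
      refine hi.false_of_zero (a := 0) (b := 1) hRA.interval hRB.interval (by simp) ?_ ?_ <;>
      · intro t _; simp [cp, h]
    subst hδ hδ'
    refine h'.good hRA hRB (Good.of_agree (g := 0) (β := 0) (a := 1) (b := 0) (c := 0) (d := 1)
      hRA.interval hRB.interval .s15 trivial ?_ ?_ ?_ ?_ ?_)
    · norm_num
    all_goals intro t _; simp [Label.comps, cp]

theorem Commuting.swap (h : Commuting I J A₁ B₁ A₂ B₂) : Commuting I J A₂ B₂ A₁ B₁ := by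
  have := h.basis (a := 0) (b := 1) (c := 1) (d := 0) (by norm_num)
  simpa only [zero_smul, one_smul, zero_add, add_zero] using this

/-- With `D` present only in the first field, the `S` components decide: none (`s11`, `s12`), one in
the first field only (`s10`), or one in the second field (`s9`). -/
theorem Commuting.good_fst (h : Commuting I J A₁ B₁ A₂ B₂) (h0 : ∀ t ∈ I, A₁.1 t ≠ 0)
    (hz : ∀ t ∈ I, A₂.1 t = 0) : Good I J A₁ B₁ A₂ B₂ := by
  by_cases hB₂ : ∀ y ∈ J, B₂.1 y = 0
  · by_cases hB₁ : ∀ y ∈ J, B₁.1 y = 0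
    · exact h.good_fst_t h0 hz hB₁ hB₂
    · obtain ⟨J₀, hJ₀, hJi, hne⟩ := exists_subinterval_ne_zero h.hJ.1 h.hB₁.1.continuousOn hB₁
      refine h.good_of_subset Subset.rfl h.hI hJ₀ hJi ?_
      have h' := h.mono Subset.rfl h.hI hJ₀ hJi
      obtain ⟨s, hs, c, I', hA⟩ := abelian_normal_form h'.hI h'.hA₁ h'.hA₂ h'.brA h0 hz
      obtain ⟨s', hs', b, J', hB⟩ := abelian_normal_form h'.hJ h'.hB₁ h'.hB₂ h'.brB hne
        fun y hy => hB₂ y (hJ₀ hy)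
      exact h'.good_diagonal hs hs' hA hB
  · obtain ⟨J₀, hJ₀, hJi, hne⟩ := exists_subinterval_ne_zero h.hJ.1 h.hB₂.1.continuousOn hB₂
    refine h.good_of_subset Subset.rfl h.hI hJ₀ hJi ?_
    have h₁ := (h.mono Subset.rfl h.hI hJ₀ hJi).swap
    obtain ⟨c, hc⟩ := exists_fst_eq_smul hJi h₁.hB₁ h₁.hB₂ h₁.brB hne
    -- Subtracting `c` times the second field from the first removes the `S` component of the first
    -- and keeps its `D` component, since the second field has none.
    have hdet : (1 : ℝ) * 1 - (-c) * 0 ≠ 0 := by norm_num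
    refine Good.of_basis hdet ?_
    have h' := (h.mono Subset.rfl h.hI hJ₀ hJi).basis hdet
    obtain ⟨s, hs, c', I', hA⟩ := abelian_normal_form h'.hI h'.hA₁ h'.hA₂ h'.brA
      (fun t ht => by simpa [hz t ht] using h0 t ht) fun t ht => by simp [hz t ht]
    have h'' := h'.swap
    obtain ⟨s', hs', b, J', hB⟩ := abelian_normal_form h''.hJ h''.hB₁ h''.hB₂ h''.brB
      (fun y hy => by simpa using hne y hy) fun y hy => by simp [hc y hy]
    exact h'.good_translations hs hs' hA hB.swap

theorem Good.swap (h : Good I J A₂ B₂ A₁ B₁) : Good I J A₁ B₁ A₂ B₂ := by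
  refine Good.of_basis (a := 0) (b := 1) (c := 1) (d := 0) (by norm_num) ?_
  simpa only [zero_smul, one_smul, zero_add, add_zero] using h

theorem Commuting.good_of_fst_ne_zero (h : Commuting I J A₁ B₁ A₂ B₂)
    (hA : ¬ ∀ t ∈ I, A₁.1 t = 0) : Good I J A₁ B₁ A₂ B₂ := by
  obtain ⟨I₀, hI₀, hIi, hne⟩ := exists_subinterval_ne_zero h.hI.1 h.hA₁.1.continuousOn hA
  refine h.good_of_subset hI₀ hIi Subset.rfl h.hJ ?_
  have h' := h.mono hI₀ hIi Subset.rfl h.hJ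
  obtain ⟨c, hc⟩ := exists_fst_eq_smul hIi h'.hA₁ h'.hA₂ h'.brA hne
  have hdet : (1 : ℝ) * 1 - 0 * (-c) ≠ 0 := by norm_num
  exact Good.of_basis hdet ((h'.basis hdet).good_fst (fun t ht => by simpa using hne t ht)
    fun t ht => by simp [hc t ht])

theorem Commuting.good_of_fst_y_ne_zero (h : Commuting I J A₁ B₁ A₂ B₂)
    (hA₁ : ∀ t ∈ I, A₁.1 t = 0) (hA₂ : ∀ t ∈ I, A₂.1 t = 0) (hB : ¬ ∀ y ∈ J, B₁.1 y = 0) :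
    Good I J A₁ B₁ A₂ B₂ := by
  obtain ⟨J₀, hJ₀, hJi, hne⟩ := exists_subinterval_ne_zero h.hJ.1 h.hB₁.1.continuousOn hB
  refine h.good_of_subset Subset.rfl h.hI hJ₀ hJi ?_
  have h' := h.mono Subset.rfl h.hI hJ₀ hJi
  obtain ⟨c, hc⟩ := exists_fst_eq_smul hJi h'.hB₁ h'.hB₂ h'.brB hne
  have hdet : (1 : ℝ) * 1 - 0 * (-c) ≠ 0 := by norm_num
  exact Good.of_basis hdet ((h'.basis hdet).good_fst_y (fun t ht => by simpa using hne t ht)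
    (fun t ht => by simp [hc t ht]) (lin_fst_zero hA₁ hA₂ _ _) (lin_fst_zero hA₁ hA₂ _ _))

theorem good_abelian (h : Commuting I J A₁ B₁ A₂ B₂) : Good I J A₁ B₁ A₂ B₂ := by
  by_cases hA₁ : ∀ t ∈ I, A₁.1 t = 0
  swap
  · exact h.good_of_fst_ne_zero hA₁
  by_cases hA₂ : ∀ t ∈ I, A₂.1 t = 0
  swap
  · exact (h.swap.good_of_fst_ne_zero hA₂).swap
  by_cases hB₁ : ∀ y ∈ J, B₁.1 y = 0
  swap
  · exact h.good_of_fst_y_ne_zero hA₁ hA₂ hB₁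
  by_cases hB₂ : ∀ y ∈ J, B₂.1 y = 0
  swap
  · exact (h.swap.good_of_fst_y_ne_zero hA₂ hA₁ hB₂).swap
  exact h.good_snd hA₁ hA₂ hB₁ hB₂

end

/-! ### Completeness of the list, and profiles as invariants of equivalence. -/

section

variable {I J I' J' : Set ℝ} {A A₁ A₂ A' A₁' A₂' B B₁ B₂ B' B₁' B₂' : Pair} {p : Pt}
  {T m X Y n V₀ : ℝ → ℝ} {σ : Side} {t : ℝ} {g β g' β' : ℝ → ℝ} {Φ : Pt → Pt}

theorem exists_span2 (hI : IsOpenInterval I) (hJ : IsOpenInterval J) {s : Submodule ℝ (Pt → Pt)}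
    (h : IsTwoDimSubalgebra I J s) : ∃ A₁ B₁ A₂ B₂, Smooth I A₁ ∧ Smooth J B₁ ∧ Smooth I A₂ ∧
      Smooth J B₂ ∧ s = span2 I J A₁ B₁ A₂ B₂ ∧
      LinearIndependent ℝ ![vf I J A₁ B₁, vf I J A₂ B₂] := by
  obtain ⟨hs, hr, -⟩ := h
  have : FiniteDimensional ℝ s := Module.finite_of_finrank_pos (by omega)
  have b := Module.finBasisOfFinrankEq ℝ s hr
  obtain ⟨A₁, B₁, hA₁, hB₁, e₁⟩ := (mem_symAlgebra hI.1 hJ.1).1 (hs (b 0).2)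
  obtain ⟨A₂, B₂, hA₂, hB₂, e₂⟩ := (mem_symAlgebra hI.1 hJ.1).1 (hs (b 1).2)
  have hfun : (![vf I J A₁ B₁, vf I J A₂ B₂] : Fin 2 → Pt → Pt) = s.subtype ∘ b := by
    funext i
    fin_cases i
    · exact e₁.symm
    · exact e₂.symm
  refine ⟨A₁, B₁, A₂, B₂, hA₁, hB₁, hA₂, hB₂, ?_, ?_⟩
  · have hsp := congr_arg (Submodule.map s.subtype) b.span_eq
    rw [Submodule.map_span, ← range_comp, ← hfun, Submodule.map_top, Submodule.range_subtype,
      Matrix.range_cons, Matrix.range_cons, Matrix.range_empty, union_empty, singleton_union] at hsp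
    exact hsp.symm
  · rw [hfun]
    exact b.linearIndependent.map' s.subtype (Submodule.ker_subtype s)

theorem exists_gEquivalent_algebra (hI : IsOpenInterval I) (hJ : IsOpenInterval J)
    {s : Submodule ℝ (Pt → Pt)} (h : IsTwoDimSubalgebra I J s) (hf : RestrictsFaithfully I J s) :
    ∃ I₀ ⊆ I, ∃ J₀ ⊆ J, IsOpenInterval I₀ ∧ IsOpenInterval J₀ ∧
      ∃ I' J' : Set ℝ, IsOpenInterval I' ∧ IsOpenInterval J' ∧
      ∃ (l : Label) (g β : ℝ → ℝ), l.Admissible I' J' g β ∧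
        GEquivalent I₀ J₀ (s.map (restrictTo (strip I₀ J₀))) I' J' (l.algebra I' J' g β) := by
  obtain ⟨A₁, B₁, A₂, B₂, hA₁, hB₁, hA₂, hB₂, rfl, hli⟩ := exists_span2 hI hJ h
  apply Good.exists_gEquivalent hA₁ hB₁ hA₂ hB₂
  have hind := indep_of_restrictsFaithfully hI hJ hA₁ hB₁ hA₂ hB₂ hf hli
  have hmem := h.2.2 _ (Submodule.subset_span (mem_insert _ _)) _
    (Submodule.subset_span (mem_insert_of_mem _ rfl))
  rw [lieBracket_vf hI.1 hJ.1 hA₁ hB₁ hA₂ hB₂, mem_span2 hI hJ hA₁ hB₁ hA₂ hB₂] at hmem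
  obtain ⟨a, b, hab⟩ := hmem
  obtain ⟨hA, hB⟩ := vf_inj hI hJ hab
  by_cases h0 : a = 0 ∧ b = 0
  · obtain ⟨rfl, rfl⟩ := h0
    rw [zero_smul, zero_smul, add_zero] at hA hB
    exact good_abelian ⟨hI, hJ, hA₁, hB₁, hA₂, hB₂, hA, hB, hind⟩
  -- The vector `(a, b)` spans the derived algebra; completing it to a basis of determinant `1`
  -- makes the bracket of the new basis equal to its first element.
  · obtain ⟨c, d, hdet⟩ : ∃ c d : ℝ, a * d - b * c = 1 := by
      by_cases ha : a = 0
      · have hb : b ≠ 0 := fun hb => h0 ⟨ha, hb⟩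
        exact ⟨-1 / b, 0, by field_simp; simp⟩
      · exact ⟨0, 1 / a, by field_simp; simp⟩
    have hdet' : a * d - b * c ≠ 0 := by rw [hdet]; exact one_ne_zero
    refine Good.of_basis hdet' (good_nonabelian hI hJ (hA₁.lin hA₂ _ _) (hB₁.lin hB₂ _ _)
      (hA₁.lin hA₂ _ _) (hB₁.lin hB₂ _ _) (hind.basis hdet') ?_ ?_)
    · intro t ht
      have := br_lin hI.1 Side.t.wt hA₁ hA₂ a b c d ht
      rw [hdet, one_mul, one_mul] at this
      rw [this.1, this.2]
      exact hA t ht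
    · intro t ht
      have := br_lin hJ.1 Side.y.wt hB₁ hB₂ a b c d ht
      rw [hdet, one_mul, one_mul] at this
      rw [this.1, this.2]
      exact hB t ht

/-- Which components of a field vanish identically. -/
@[ext]
structure Profile where
  t₁ : Prop
  t₂ : Prop
  y₁ : Prop
  y₂ : Prop
  zero : Prop

/-- The profile of the combination of two fields with given coefficients. -/
def profile (I J : Set ℝ) (A₁ B₁ A₂ B₂ : Pair) (a b : ℝ) : Profile where
  t₁ := ∀ t ∈ I, (a • A₁ + b • A₂).1 t = 0
  t₂ := Agree I (a • A₁ + b • A₂) (cp 0 0)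
  y₁ := ∀ y ∈ J, (a • B₁ + b • B₂).1 y = 0
  y₂ := Agree J (a • B₁ + b • B₂) (cp 0 0)
  zero := a = 0 ∧ b = 0

theorem Push.fst_zero_iff (h : IsMove σ I T m X) (hP : Push σ I T m X A A') :
    (∀ t ∈ I, A.1 t = 0) ↔ ∀ s ∈ T '' I, A'.1 s = 0 := by
  rw [forall_mem_image]
  refine forall₂_congr fun t ht => ?_
  rw [(hP t ht).1, mul_eq_zero, or_iff_right (h.mult.deriv_ne_zero ht)]

theorem Push.agree_zero_iff (h : IsMove σ I T m X) (hP : Push σ I T m X A A') :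
    Agree I A (cp 0 0) ↔ Agree (T '' I) A' (cp 0 0) :=
  ⟨fun h0 => (hP.congr_left h.interval.1 h0).unique push_zero,
    fun h0 => hP.agree_zero h Subset.rfl h.interval.1 fun _ ht => h0 _ (mem_image_of_mem T ht)⟩

/-- Equivalent algebras have the same profiles and are simultaneously Abelian. -/
theorem GEquivalent.invariants (hI : IsOpenInterval I) (hJ : IsOpenInterval J)
    (hI' : IsOpenInterval I') (hJ' : IsOpenInterval J')
    (hA₁ : Smooth I A₁) (hB₁ : Smooth J B₁) (hA₂ : Smooth I A₂) (hB₂ : Smooth J B₂)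
    (hA₁' : Smooth I' A₁') (hB₁' : Smooth J' B₁') (hA₂' : Smooth I' A₂') (hB₂' : Smooth J' B₂')
    (hi : Indep I J A₁ B₁ A₂ B₂) (hi' : Indep I' J' A₁' B₁' A₂' B₂')
    (h : GEquivalent I J (span2 I J A₁ B₁ A₂ B₂) I' J' (span2 I' J' A₁' B₁' A₂' B₂')) :
    (∀ a b, ∃ c d, profile I J A₁ B₁ A₂ B₂ a b = profile I' J' A₁' B₁' A₂' B₂' c d) ∧
    (∀ c d, ∃ a b, profile I J A₁ B₁ A₂ B₂ a b = profile I' J' A₁' B₁' A₂' B₂' c d) ∧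
    ((Agree I (br Side.t.wt A₁ A₂) (cp 0 0) ∧ Agree J (br Side.y.wt B₁ B₂) (cp 0 0)) ↔
      (Agree I' (br Side.t.wt A₁' A₂') (cp 0 0) ∧ Agree J' (br Side.y.wt B₁' B₂') (cp 0 0))) := by
  obtain ⟨Φ, hΦ, h₁, h₂⟩ := h
  obtain ⟨T, m, X, Y, n, V₀, hr, rfl, rfl⟩ := hΦ.represents hI hJ
  have F : ∀ a b : ℝ, ∃ c d : ℝ, Push .t I T m X (a • A₁ + b • A₂) (c • A₁' + d • A₂') ∧
      Push .y J Y n V₀ (a • B₁ + b • B₂) (c • B₁' + d • B₂') := by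
    intro a b
    obtain ⟨W, hW, hP⟩ := h₁ _ ((mem_span2 hI hJ hA₁ hB₁ hA₂ hB₂).2 ⟨a, b, rfl⟩)
    obtain ⟨c, d, rfl⟩ := (mem_span2 hI' hJ' hA₁' hB₁' hA₂' hB₂').1 hW
    exact ⟨c, d, (hr.isPushforward_iff (hA₁.lin hA₂ a b) (hB₁.lin hB₂ a b)).1 hP⟩
  have G : ∀ c d : ℝ, ∃ a b : ℝ, Push .t I T m X (a • A₁ + b • A₂) (c • A₁' + d • A₂') ∧
      Push .y J Y n V₀ (a • B₁ + b • B₂) (c • B₁' + d • B₂') := by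
    intro c d
    obtain ⟨V, hV, hP⟩ := h₂ _ ((mem_span2 hI' hJ' hA₁' hB₁' hA₂' hB₂').2 ⟨c, d, rfl⟩)
    obtain ⟨a, b, rfl⟩ := (mem_span2 hI hJ hA₁ hB₁ hA₂ hB₂).1 hV
    exact ⟨a, b, (hr.isPushforward_iff (hA₁.lin hA₂ a b) (hB₁.lin hB₂ a b)).1 hP⟩
  have key : ∀ a b c d : ℝ, Push .t I T m X (a • A₁ + b • A₂) (c • A₁' + d • A₂') →
      Push .y J Y n V₀ (a • B₁ + b • B₂) (c • B₁' + d • B₂') →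
      profile I J A₁ B₁ A₂ B₂ a b = profile (T '' I) (Y '' J) A₁' B₁' A₂' B₂' c d := by
    intro a b c d hP hQ
    have e1 := hP.agree_zero_iff hr.moveT
    have e2 := hQ.agree_zero_iff hr.moveY
    refine Profile.ext (propext (hP.fst_zero_iff hr.moveT)) (propext e1)
      (propext (hQ.fst_zero_iff hr.moveY)) (propext e2) (propext ⟨?_, ?_⟩)
    · rintro ⟨rfl, rfl⟩
      exact hi' c d ⟨_, Subset.rfl, hI', e1.1 fun t _ => by simp [cp]⟩
        ⟨_, Subset.rfl, hJ', e2.1 fun t _ => by simp [cp]⟩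
    · rintro ⟨rfl, rfl⟩
      exact hi a b ⟨_, Subset.rfl, hI, e1.2 fun t _ => by simp [cp]⟩
        ⟨_, Subset.rfl, hJ, e2.2 fun t _ => by simp [cp]⟩
  refine ⟨fun a b => ?_, fun c d => ?_, ?_⟩
  · obtain ⟨c, d, hP, hQ⟩ := F a b
    exact ⟨c, d, key a b c d hP hQ⟩
  · obtain ⟨a, b, hP, hQ⟩ := G c d
    exact ⟨a, b, key a b c d hP hQ⟩
  · constructor
    · rintro ⟨z₁, z₂⟩
      -- The generators of the second algebra are images of combinations of the first generators,
      -- and the bracket of these combinations is a multiple of the original one.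
      obtain ⟨a, b, p₁, q₁⟩ := G 1 0
      obtain ⟨c, d, p₂, q₂⟩ := G 0 1
      simp only [one_smul, zero_smul, zero_add, add_zero] at p₁ q₁ p₂ q₂
      exact ⟨((p₁.bracket hr.moveT (hA₁.lin hA₂ a b) (hA₁.lin hA₂ c d) p₂).agree_zero_iff
          hr.moveT).1 (br_lin_zero hI.1 _ hA₁ hA₂ z₁ a b c d),
        ((q₁.bracket hr.moveY (hB₁.lin hB₂ a b) (hB₁.lin hB₂ c d) q₂).agree_zero_iff
          hr.moveY).1 (br_lin_zero hJ.1 _ hB₁ hB₂ z₂ a b c d)⟩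
    · rintro ⟨z₁, z₂⟩
      obtain ⟨a, b, p₁, q₁⟩ := F 1 0
      obtain ⟨c, d, p₂, q₂⟩ := F 0 1
      simp only [one_smul, zero_smul, zero_add, add_zero] at p₁ q₁ p₂ q₂
      exact ⟨((p₁.bracket hr.moveT hA₁ hA₂ p₂).agree_zero_iff hr.moveT).2
          (br_lin_zero hI'.1 _ hA₁' hA₂' z₁ a b c d),
        ((q₁.bracket hr.moveY hB₁ hB₂ q₂).agree_zero_iff hr.moveY).2
          (br_lin_zero hJ'.1 _ hB₁' hB₂' z₂ a b c d)⟩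

end

/-! ### Boolean invariants of the labels. -/

section

variable {I J I' J' : Set ℝ} {g β g' β' : ℝ → ℝ} {l l' : Label}

/-- The linear conditions `a = 0` and/or `b = 0`. -/
def Cond (c : Bool × Bool) (a b : ℝ) : Prop := (c.1 = true → a = 0) ∧ (c.2 = true → b = 0)

def condAnd (c c' : Bool × Bool) : Bool × Bool := (c.1 || c'.1, c.2 || c'.2)

/-- The condition holds for some nonzero coefficients. -/
def condSome (c : Bool × Bool) : Bool := !(c.1 && c.2)

/-- The condition holds for all coefficients. -/
def condAll (c : Bool × Bool) : Bool := !(c.1 || c.2)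

theorem cond_and {c c' : Bool × Bool} {a b : ℝ} :
    Cond c a b ∧ Cond c' a b ↔ Cond (condAnd c c') a b := by
  simp only [Cond, condAnd, Bool.or_eq_true]
  tauto

theorem condSome_iff (c : Bool × Bool) :
    condSome c = true ↔ ∃ a b : ℝ, Cond c a b ∧ ¬ (a = 0 ∧ b = 0) := by
  obtain ⟨p, q⟩ := c
  cases p <;> cases q <;> simp [condSome, Cond]
  · exact ⟨1, 1, fun h => absurd h one_ne_zero⟩
  · exact ⟨1, one_ne_zero⟩
  · exact ⟨1, one_ne_zero⟩

theorem condAll_iff (c : Bool × Bool) : condAll c = true ↔ ∀ a b : ℝ, Cond c a b := by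
  obtain ⟨p, q⟩ := c
  cases p <;> cases q <;> simp [condAll, Cond]
  · exact ⟨1, one_ne_zero⟩
  · exact ⟨1, one_ne_zero⟩
  · exact ⟨1, 1, fun h => absurd h one_ne_zero⟩

def bit (δ : Fin 2) : Bool := δ == 1

/-- The condition on the coefficients for the vanishing of `f`. -/
def Label.condT₁ : Label → Bool × Bool
  | .s1 | .s2 _ | .s3 _ => (true, true)
  | .s4 _ | .s6 _ _ | .s7 _ => (false, true)
  | .s9 _ _ | .s10 _ _ | .s11 _ | .s12 _ => (true, false)
  | _ => (false, false)

/-- The condition on the coefficients for the vanishing of `f` and `g`. -/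
def Label.condT₂ : Label → Bool × Bool
  | .s4 δ | .s6 δ _ => (bit δ, true)
  | .s5 δ | .s8 δ => (false, bit δ)
  | .s9 _ δ | .s10 δ _ | .s11 δ => (true, bit δ)
  | .s14 δ | .s17 δ => (bit δ, false)
  | .s15 => (true, false)
  | _ => (true, true)

/-- The condition on the coefficients for the vanishing of `α`. -/
def Label.condY₁ : Label → Bool × Bool
  | .s1 | .s4 _ | .s5 _ => (true, true)
  | .s2 _ | .s6 _ _ | .s8 _ | .s9 _ _ => (false, true)
  | .s10 _ _ | .s13 _ | .s14 _ => (true, false)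
  | _ => (false, false)

/-- The condition on the coefficients for the vanishing of `α` and `β`. -/
def Label.condY₂ : Label → Bool × Bool
  | .s2 δ | .s6 _ δ | .s9 δ _ => (bit δ, true)
  | .s3 δ | .s7 δ => (false, bit δ)
  | .s10 _ δ | .s13 δ => (true, bit δ)
  | .s12 δ | .s16 δ => (bit δ, false)
  | .s15 => (false, true)
  | _ => (true, true)

def Label.isAbelian : Label → Bool
  | .s1 | .s2 _ | .s3 _ | .s4 _ | .s5 _ | .s6 _ _ | .s7 _ | .s8 _ => false
  | _ => true

theorem Label.condT₁_iff (hI : IsOpenInterval I) (a b : ℝ) :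
    (∀ t ∈ I, (a • (l.comps g β).1.1 + b • (l.comps g β).2.1).1 t = 0) ↔ Cond l.condT₁ a b := by
  obtain ⟨s, hs, t, ht, hst⟩ := hI.exists_ne
  constructor
  · intro h
    have h1 := h s hs
    have h2 := h t ht
    simp only [lin_fst] at h1 h2
    cases l <;> simp only [Label.comps, Label.condT₁, Cond, cp, lp] at h1 h2 ⊢ <;> grind
  · rintro ⟨h1, h2⟩ t -
    rw [lin_fst]
    cases l <;> simp only [Label.comps, Label.condT₁, cp, lp] at h1 h2 ⊢ <;> grind

theorem Label.condY₁_iff (hJ : IsOpenInterval J) (a b : ℝ) :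
    (∀ y ∈ J, (a • (l.comps g β).1.2 + b • (l.comps g β).2.2).1 y = 0) ↔ Cond l.condY₁ a b := by
  obtain ⟨s, hs, t, ht, hst⟩ := hJ.exists_ne
  constructor
  · intro h
    have h1 := h s hs
    have h2 := h t ht
    simp only [lin_fst] at h1 h2
    cases l <;> simp only [Label.comps, Label.condY₁, Cond, cp, lp] at h1 h2 ⊢ <;> grind
  · rintro ⟨h1, h2⟩ t -
    rw [lin_fst]
    cases l <;> simp only [Label.comps, Label.condY₁, cp, lp] at h1 h2 ⊢ <;> grind

theorem bit_cases (δ : Fin 2) :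
    (bit δ = false ∧ (δ.val : ℝ) = 0) ∨ (bit δ = true ∧ (δ.val : ℝ) = 1) := by
  fin_cases δ <;> simp [bit]

/-- In `s13` the vanishing depends on the arbitrary `g` unless `a = 0`, which is why `ha` is
assumed. -/
theorem Label.condT₂_iff (hI : IsOpenInterval I) (h : l.Admissible I J g β) {a b : ℝ}
    (ha : ∀ δ, l = .s13 δ → a = 0) :
    Agree I (a • (l.comps g β).1.1 + b • (l.comps g β).2.1) (cp 0 0) ↔ Cond l.condT₂ a b := by
  obtain ⟨s, hs, t, ht, hst⟩ := hI.exists_ne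
  constructor
  · intro h0
    have h1 := h0 s hs
    have h2 := h0 t ht
    simp only [lin_fst, lin_snd] at h1 h2
    cases l with
    | s16 δ =>
      have := h.2.coeff (a := a) (b := b) Subset.rfl hI fun t ht => by
        simpa [Label.comps, cp] using (h0 t ht).2
      simpa [Cond, Label.condT₂] using this
    | s18 =>
      have := h.1.2.coeff (a := a) (b := b) Subset.rfl hI fun t ht => by
        simpa [Label.comps, cp] using (h0 t ht).2
      simpa [Cond, Label.condT₂] using this
    | s13 δ =>
      have := ha δ rfl
      subst this
      simpa [Label.comps, cp, Cond, Label.condT₂] using h1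
    | s9 δ' δ | s10 δ δ' | s4 δ | s5 δ | s6 δ δ' | s8 δ | s11 δ | s14 δ | s17 δ =>
      have := bit_cases δ
      simp only [Label.comps, Label.condT₂, Cond, cp, lp] at h1 h2 ⊢
      grind
    | _ =>
      simp only [Label.comps, Label.condT₂, Cond, cp, lp] at h1 h2 ⊢
      grind
  · rintro ⟨h1, h2⟩ t -
    rw [lin_fst, lin_snd]
    cases l with
    | s9 δ' δ | s10 δ δ' | s4 δ | s5 δ | s6 δ δ' | s8 δ | s11 δ | s14 δ | s17 δ =>
      have := bit_cases δ
      simp only [Label.comps, Label.condT₂, cp, lp] at h1 h2 ⊢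
      grind
    | _ =>
      simp only [Label.comps, Label.condT₂, cp, lp] at h1 h2 ⊢
      grind

/-- Here the arbitrary `β` of `s11` plays the role that `g` has in `s13`. -/
theorem Label.condY₂_iff (hJ : IsOpenInterval J) (h : l.Admissible I J g β) {a b : ℝ}
    (ha : ∀ δ, l = .s11 δ → a = 0) :
    Agree J (a • (l.comps g β).1.2 + b • (l.comps g β).2.2) (cp 0 0) ↔ Cond l.condY₂ a b := by
  obtain ⟨s, hs, t, ht, hst⟩ := hJ.exists_ne
  constructor
  · intro h0
    have h1 := h0 s hs
    have h2 := h0 t ht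
    simp only [lin_fst, lin_snd] at h1 h2
    cases l with
    | s17 δ =>
      have := h.2.coeff (a := a) (b := b) Subset.rfl hJ fun t ht => by
        simpa [Label.comps, cp] using (h0 t ht).2
      simpa [Cond, Label.condY₂] using this
    | s18 =>
      have := h.2.2.coeff (a := a) (b := b) Subset.rfl hJ fun t ht => by
        simpa [Label.comps, cp] using (h0 t ht).2
      simpa [Cond, Label.condY₂] using this
    | s11 δ =>
      have := ha δ rfl
      subst this
      simpa [Label.comps, cp, Cond, Label.condY₂] using h1
    | s2 δ | s6 δ' δ | s9 δ δ' | s3 δ | s7 δ | s10 δ' δ | s13 δ | s12 δ | s16 δ =>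
      have := bit_cases δ
      simp only [Label.comps, Label.condY₂, Cond, cp, lp] at h1 h2 ⊢
      grind
    | _ =>
      simp only [Label.comps, Label.condY₂, Cond, cp, lp] at h1 h2 ⊢
      grind
  · rintro ⟨h1, h2⟩ t -
    rw [lin_fst, lin_snd]
    cases l with
    | s2 δ | s6 δ' δ | s9 δ δ' | s3 δ | s7 δ | s10 δ' δ | s13 δ | s12 δ | s16 δ =>
      have := bit_cases δ
      simp only [Label.comps, Label.condY₂, cp, lp] at h1 h2 ⊢
      grind
    | _ =>
      simp only [Label.comps, Label.condY₂, cp, lp] at h1 h2 ⊢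
      grind

/-- The invariants that separate the listed algebras. -/
def Label.inv (l : Label) : Fin 12 → Bool :=
  ![l.isAbelian, condAll l.condT₁, condAll l.condY₁, condSome l.condT₁, condSome l.condY₁,
    condSome (condAnd l.condT₁ l.condY₁), !condAll l.condT₁ && condSome l.condT₂, condAll l.condT₂,
    !condAll l.condY₁ && condSome l.condY₂, condAll l.condY₂,
    condSome (condAnd l.condT₁ l.condY₂), condSome (condAnd l.condT₂ l.condY₁)]

/-- The invariants record vanishing, so `true` stands for the parameter value `0`. -/
def unbit (b : Bool) : Fin 2 := if b then 0 else 1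

/-- The label with the given invariants. -/
def labelOf (v : Fin 12 → Bool) : Label :=
  if v 0 then
    if v 1 then
      if v 2 then
        if v 11 then if v 10 then .s15 else .s17 (unbit (v 7))
        else if v 10 then .s16 (unbit (v 9)) else .s18
      else if v 11 then .s14 (unbit (v 7)) else .s13 (unbit (v 8))
    else if v 2 then if v 10 then .s12 (unbit (v 9)) else .s11 (unbit (v 6))
    else if v 5 then .s10 (unbit (v 6)) (unbit (v 8)) else .s9 (unbit (v 8)) (unbit (v 6))
  else if v 3 then
    if v 1 then if v 4 then .s8 (unbit (v 7)) else .s5 (unbit (v 7))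
    else if v 4 then
      if v 2 then .s7 (unbit (v 9)) else .s6 (unbit (v 6)) (unbit (v 8))
    else .s4 (unbit (v 6))
  else if v 4 then if v 2 then .s3 (unbit (v 9)) else .s2 (unbit (v 8))
  else .s1

/-- A finite check, since the invariants do not involve `g` and `β`. -/
theorem labelOf_inv (l : Label) : labelOf l.inv = l := by
  cases l with
  | s1 | s15 | s18 => rfl
  | s6 δ δ' | s9 δ δ' | s10 δ δ' => fin_cases δ <;> fin_cases δ' <;> rfl
  | s2 δ | s3 δ | s4 δ | s5 δ | s7 δ | s8 δ | s11 δ | s12 δ | s13 δ | s14 δ | s16 δ | s17 δ =>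
    fin_cases δ <;> rfl

end

/-! ### The invariants read off from the algebra, and inequivalence. -/

section

variable {I J I' J' : Set ℝ} {g β g' β' : ℝ → ℝ} {l l' : Label}

/-- The invariants of an algebra in terms of the profiles of its elements. -/
def profileInv (R : Set Profile) (ab : Prop) : Fin 12 → Prop :=
  ![ab, ∀ v ∈ R, v.t₁, ∀ v ∈ R, v.y₁, ∃ v ∈ R, v.t₁ ∧ ¬ v.zero, ∃ v ∈ R, v.y₁ ∧ ¬ v.zero,
    ∃ v ∈ R, (v.t₁ ∧ v.y₁) ∧ ¬ v.zero, (¬ ∀ v ∈ R, v.t₁) ∧ ∃ v ∈ R, v.t₂ ∧ ¬ v.zero,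
    ∀ v ∈ R, v.t₂, (¬ ∀ v ∈ R, v.y₁) ∧ ∃ v ∈ R, v.y₂ ∧ ¬ v.zero, ∀ v ∈ R, v.y₂,
    ∃ v ∈ R, (v.t₁ ∧ v.y₂) ∧ ¬ v.zero, ∃ v ∈ R, (v.t₂ ∧ v.y₁) ∧ ¬ v.zero]

/-- The profiles of the elements of a listed algebra. -/
def Label.profiles (I J : Set ℝ) (g β : ℝ → ℝ) (l : Label) : Set Profile :=
  {v | ∃ a b, v = profile I J (l.comps g β).1.1 (l.comps g β).1.2 (l.comps g β).2.1
    (l.comps g β).2.2 a b}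

def Label.BracketZero (I J : Set ℝ) (g β : ℝ → ℝ) (l : Label) : Prop :=
  Agree I (br Side.t.wt (l.comps g β).1.1 (l.comps g β).2.1) (cp 0 0) ∧
    Agree J (br Side.y.wt (l.comps g β).1.2 (l.comps g β).2.2) (cp 0 0)

theorem Label.bracketZero_iff (hI : IsOpenInterval I) (hJ : IsOpenInterval J)
    (h : l.Admissible I J g β) : l.isAbelian = true ↔ l.BracketZero I J g β := by
  have e : l.isAbelian = true ↔ l.InAbelianPart := by
    cases l <;> simp [Label.isAbelian, Label.InAbelianPart]
  have hb := l.comps_bracket (I := I) (J := J) (g := g) (β := β)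
  rw [e]
  refine ⟨hb.2, fun hz => ?_⟩
  by_contra hl
  have h1 := hb.1 hl
  refine (l.indep h).false_of_zero (a := 1) (b := 0) hI hJ (by simp) (fun t ht => ?_)
    fun t ht => ?_
  · rw [lin_fst, lin_snd, ← (h1.1 t ht).1, ← (h1.1 t ht).2, (hz.1 t ht).1, (hz.1 t ht).2]
    simp [cp]
  · rw [lin_fst, lin_snd, ← (h1.2 t ht).1, ← (h1.2 t ht).2, (hz.2 t ht).1, (hz.2 t ht).2]
    simp [cp]

/-- The invariants are chosen so that the arbitrary functions in `s13` and `s11` have no influence.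
Either these families are excluded by a guard, or the companion condition forces `a = 0`, or the
second basis element alone decides. -/
theorem Label.inv_iff (hI : IsOpenInterval I) (hJ : IsOpenInterval J) (h : l.Admissible I J g β)
    (k : Fin 12) :
    l.inv k = true ↔ profileInv (l.profiles I J g β) (l.BracketZero I J g β) k := by
  have c₁ := l.condT₁_iff (g := g) (β := β) hI
  have d₁ := l.condY₁_iff (g := g) (β := β) hJ
  have c₂ := fun a b => l.condT₂_iff (a := a) (b := b) hI h
  have d₂ := fun a b => l.condY₂_iff (a := a) (b := b) hJ h
  have hs : ∀ q : Profile → Prop, (∃ v ∈ l.profiles I J g β, q v) ↔ ∃ a b : ℝ, q (profile I J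
      (l.comps g β).1.1 (l.comps g β).1.2 (l.comps g β).2.1 (l.comps g β).2.2 a b) := fun q => by
    constructor
    · rintro ⟨_, ⟨a, b, rfl⟩, hq⟩
      exact ⟨a, b, hq⟩
    · rintro ⟨a, b, hq⟩
      exact ⟨_, ⟨a, b, rfl⟩, hq⟩
  have ha : ∀ q : Profile → Prop, (∀ v ∈ l.profiles I J g β, q v) ↔ ∀ a b : ℝ, q (profile I J
      (l.comps g β).1.1 (l.comps g β).1.2 (l.comps g β).2.1 (l.comps g β).2.2 a b) := fun q => by
    constructor
    · intro hq a b
      exact hq _ ⟨a, b, rfl⟩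
    · rintro hq _ ⟨a, b, rfl⟩
      exact hq a b
  have hT : (∀ v ∈ l.profiles I J g β, v.t₁) ↔ condAll l.condT₁ = true := by
    rw [ha, condAll_iff]
    exact forall₂_congr c₁
  have hY : (∀ v ∈ l.profiles I J g β, v.y₁) ↔ condAll l.condY₁ = true := by
    rw [ha, condAll_iff]
    exact forall₂_congr d₁
  have n13 : (∃ δ, l = .s13 δ) → condAll l.condT₁ = true := by rintro ⟨δ, rfl⟩; rfl
  have n11 : (∃ δ, l = .s11 δ) → condAll l.condY₁ = true := by rintro ⟨δ, rfl⟩; rfl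
  fin_cases k
  · exact l.bracketZero_iff hI hJ h
  · exact hT.symm
  · exact hY.symm
  · refine (condSome_iff _).trans (((hs fun v => v.t₁ ∧ ¬ v.zero).trans ?_).symm)
    exact exists₂_congr fun a b => and_congr_left' (c₁ a b)
  · refine (condSome_iff _).trans (((hs fun v => v.y₁ ∧ ¬ v.zero).trans ?_).symm)
    exact exists₂_congr fun a b => and_congr_left' (d₁ a b)
  · refine (condSome_iff _).trans (((hs fun v => (v.t₁ ∧ v.y₁) ∧ ¬ v.zero).trans ?_).symm)
    refine exists₂_congr fun a b => and_congr_left' ?_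
    rw [← cond_and]
    exact and_congr (c₁ a b) (d₁ a b)
  · change (!condAll l.condT₁ && condSome l.condT₂) = true ↔ (¬ ∀ v ∈ l.profiles I J g β, v.t₁) ∧
      ∃ v ∈ l.profiles I J g β, v.t₂ ∧ ¬ v.zero
    rw [hT, Bool.and_eq_true, Bool.not_eq_true']
    simp only [Bool.not_eq_true]
    refine and_congr_right fun hc => (condSome_iff _).trans ((hs _).trans ?_).symm
    exact exists₂_congr fun a b => and_congr_left' (c₂ a b fun δ hl => by
      rw [n13 ⟨δ, hl⟩] at hc; exact absurd hc (by simp))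
  · change condAll l.condT₂ = true ↔ ∀ v ∈ l.profiles I J g β, v.t₂
    rw [ha]
    by_cases h13 : ∃ δ, l = .s13 δ
    · refine iff_of_false ?_ fun hq => ?_
      · obtain ⟨δ, rfl⟩ := h13
        simp [condAll, Label.condT₂]
      -- The element `P(1) + Z(δ)` of `s13` has a nonzero `P` component whatever `g` is.
      · have := (c₂ 0 1 fun _ _ => rfl).1 (hq 0 1)
        obtain ⟨δ, rfl⟩ := h13
        simp [Cond, Label.condT₂] at this
    · rw [condAll_iff]
      exact forall₂_congr fun a b => (c₂ a b fun δ hl => absurd ⟨δ, hl⟩ h13).symm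
  · change (!condAll l.condY₁ && condSome l.condY₂) = true ↔ (¬ ∀ v ∈ l.profiles I J g β, v.y₁) ∧
      ∃ v ∈ l.profiles I J g β, v.y₂ ∧ ¬ v.zero
    rw [hY, Bool.and_eq_true, Bool.not_eq_true']
    simp only [Bool.not_eq_true]
    refine and_congr_right fun hc => (condSome_iff _).trans ((hs _).trans ?_).symm
    exact exists₂_congr fun a b => and_congr_left' (d₂ a b fun δ hl => by
      rw [n11 ⟨δ, hl⟩] at hc; exact absurd hc (by simp))
  · change condAll l.condY₂ = true ↔ ∀ v ∈ l.profiles I J g β, v.y₂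
    rw [ha]
    by_cases h11 : ∃ δ, l = .s11 δ
    · refine iff_of_false ?_ fun hq => ?_
      · obtain ⟨δ, rfl⟩ := h11
        simp [condAll, Label.condY₂]
      · have := (d₂ 0 1 fun _ _ => rfl).1 (hq 0 1)
        obtain ⟨δ, rfl⟩ := h11
        simp [Cond, Label.condY₂] at this
    · rw [condAll_iff]
      exact forall₂_congr fun a b => (d₂ a b fun δ hl => absurd ⟨δ, hl⟩ h11).symm
  · refine (condSome_iff _).trans (((hs fun v => (v.t₁ ∧ v.y₂) ∧ ¬ v.zero).trans ?_).symm)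
    refine exists₂_congr fun a b => and_congr_left' ?_
    rw [← cond_and]
    refine (and_congr_left' (c₁ a b)).trans (and_congr_right fun hc => d₂ a b fun δ hl => ?_)
    subst hl
    exact hc.1 rfl
  · refine (condSome_iff _).trans (((hs fun v => (v.t₂ ∧ v.y₁) ∧ ¬ v.zero).trans ?_).symm)
    refine exists₂_congr fun a b => and_congr_left' ?_
    rw [← cond_and]
    refine (and_congr_right' (d₁ a b)).trans (and_congr_left fun hc => c₂ a b fun δ hl => ?_)
    subst hl
    exact hc.1 rfl

theorem Label.eq_of_gEquivalent (hI : IsOpenInterval I) (hJ : IsOpenInterval J)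
    (hI' : IsOpenInterval I') (hJ' : IsOpenInterval J') (h : l.Admissible I J g β)
    (h' : l'.Admissible I' J' g' β')
    (he : GEquivalent I J (l.algebra I J g β) I' J' (l'.algebra I' J' g' β')) : l = l' := by
  obtain ⟨⟨hA₁, hB₁⟩, hA₂, hB₂⟩ := l.comps_smooth h
  obtain ⟨⟨hA₁', hB₁'⟩, hA₂', hB₂'⟩ := l'.comps_smooth h'
  rw [l.algebra_eq, l'.algebra_eq] at he
  obtain ⟨F, G, hab⟩ := he.invariants hI hJ hI' hJ' hA₁ hB₁ hA₂ hB₂ hA₁' hB₁' hA₂' hB₂'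
    (l.indep h) (l'.indep h')
  have hR : l.profiles I J g β = l'.profiles I' J' g' β' := by
    ext v
    constructor
    · rintro ⟨a, b, rfl⟩
      exact F a b
    · rintro ⟨c, d, rfl⟩
      obtain ⟨a, b, e⟩ := G c d
      exact ⟨a, b, e.symm⟩
  have hB : l.BracketZero I J g β = l'.BracketZero I' J' g' β' := propext hab
  have hinv : l.inv = l'.inv := by
    funext k
    rw [Bool.eq_iff_iff, l.inv_iff hI hJ h, l'.inv_iff hI' hJ' h', hR, hB]
  rw [← labelOf_inv l, hinv, labelOf_inv]

end

end BLP

end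

theorem mainTheorem7 :
    -- the listed algebras are two-dimensional subalgebras, Abelian or not as claimed
    (∀ I J : Set ℝ, BLP.IsOpenInterval I → BLP.IsOpenInterval J →
      ∀ (l : BLP.Label) (g β : ℝ → ℝ), l.Admissible I J g β →
        BLP.IsTwoDimSubalgebra I J (l.algebra I J g β) ∧
        BLP.RestrictsFaithfully I J (l.algebra I J g β) ∧
        (BLP.IsAbelian (l.algebra I J g β) ↔ l.InAbelianPart)) ∧
    -- every two-dimensional subalgebra is locally equivalent to a listed one
    (∀ I J : Set ℝ, BLP.IsOpenInterval I → BLP.IsOpenInterval J →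
      ∀ s : Submodule ℝ (BLP.Pt → BLP.Pt),
        BLP.IsTwoDimSubalgebra I J s → BLP.RestrictsFaithfully I J s →
        ∃ I₀ ⊆ I, ∃ J₀ ⊆ J, BLP.IsOpenInterval I₀ ∧ BLP.IsOpenInterval J₀ ∧
        ∃ I' J' : Set ℝ, BLP.IsOpenInterval I' ∧ BLP.IsOpenInterval J' ∧
        ∃ (l : BLP.Label) (g β : ℝ → ℝ), l.Admissible I' J' g β ∧
          BLP.GEquivalent I₀ J₀ (s.map (BLP.restrictTo (BLP.strip I₀ J₀)))
            I' J' (l.algebra I' J' g β)) ∧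
    -- algebras of different families, or of one family with different `δ, δ'`, are inequivalent
    (∀ I J I' J' : Set ℝ, BLP.IsOpenInterval I → BLP.IsOpenInterval J →
      BLP.IsOpenInterval I' → BLP.IsOpenInterval J' →
      ∀ (l l' : BLP.Label) (g β g' β' : ℝ → ℝ),
        l.Admissible I J g β → l'.Admissible I' J' g' β' → l ≠ l' →
        ¬ BLP.GEquivalent I J (l.algebra I J g β) I' J' (l'.algebra I' J' g' β')) :=
  ⟨fun _ _ hI hJ l _ _ h => l.isTwoDimSubalgebra hI hJ h,
    fun _ _ hI hJ _ hs hf => BLP.exists_gEquivalent_algebra hI hJ hs hf,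
    fun _ _ _ _ hI hJ hI' hJ' _ _ _ _ _ _ h h' hne he =>
      hne (BLP.Label.eq_of_gEquivalent hI hJ hI' hJ' h h' he)⟩
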